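/- All manifolds are finite-dimensional, $C^\infty$, Hausdorff and second countable, and all vector bundles are smooth, real and of finite rank. Let $p\colon P\to M$ be a principal bundle with structure Lie group $G$, acting on $P$ on the right by $R_g(u)=ug$. Let $A\to P$ be a transitive PBG-Lie algebroid on $P(M,G)$. That is, $A$ is a Lie algebroid over $P$ with fibrewise surjective anchor $q\colon A\to TP$, together with a smooth right action of $G$ on $A$ such that each right translation $\hat R_g\colon A\to A$ is a Lie algebroid automorphism over $R_g$. Let $L=\ker q$ be the adjoint bundle of $A$; it is a Lie algebra bundle over $P$, that is, a vector bundle with Lie algebra structures on its fibres which is smoothly locally trivial by fibrewise Lie algebra isomorphisms. The action of $G$ on $A$ restricts to an action of $G$ on $L$ by Lie algebra bundle automorphisms. Let $G$ act on $TP$ by the differentials $TR_g$. Then: 1. The quotient manifold $A/G$ exists: the orbit space $A/G$, with the quotient topology, is Hausdorff and second countable and has the structure of a smooth manifold for which the projection $\natural\colon A\to A/G$ is a submersion. 2. $A/G$ is a smooth vector bundle over $M$ for which $\natural$ is fibrewise linear over $p$, and it is a transitive Lie algebroid over $M$, the quotient of $A$: its anchor $r$ satisfies $r\circ\natural=Tp\circ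 q$, and if $X,Y$ are sections of $A$ and $X',Y'$ sections of $A/G$ with $\natural\circ X=X'\circ p$ and $\natural\circ Y=Y'\circ p$, then $\natural\circ[X,Y]=[X',Y']\circ p$. 3. In the same sense the Lie algebroid $TP$ has a quotient Lie algebroid $TP/G$ over $M$ (the Atiyah algebroid of $P(M,G)$, i.e. the Lie algebroid of its gauge groupoid), and $L$ has a quotient Lie algebra bundle $L/G$ over $M$. The inclusion $L\hookrightarrow A$ and the anchor $q\colon A\to TP$ induce smooth, fibrewise linear maps over $M$ $$\frac{L}{G}\ \overset{\iota}{\rightarrowtail}\ \frac{A}{G}\ \overset{\pi}{\twoheadrightarrow}\ \frac{TP}{G}$$ which are morphisms of Lie algebroids over $M$ ($L/G$ having zero anchor and the pointwise bracket), with $\iota$ fibrewise injective, $\pi$ fibrewise surjective and $\operatorname{im}\iota=\ker\pi$. So $A/G$ is an extension of the Lie algebroid $TP/G$ by the Lie algebra bundle $L/G$. -/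

import Mathlib

open Set Bundle Manifold Topology
open scoped ContDiff Manifold RightActions

noncomputable section

namespace PBG

universe uE uM uF uV

/-! ## Smooth vector bundles, Lie algebroids, Lie algebra bundles -/

section Bundles

variable (E : Type uE) [NormedAddCommGroup E] [NormedSpace ℝ E]
  (M : Type uM) [TopologicalSpace M] [ChartedSpace E M]
  (F : Type uF) [NormedAddCommGroup F] [NormedSpace ℝ F]

/-- A smooth real vector bundle over the manifold `M` (modelled on `E`) with model fibre `F`:
Mathlib's smooth vector bundles, with the type of fibres and its structure packed together. -/
structure SmoothVectorBundle where
  /-- the fibre over a point -/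
  Fib : M → Type uV
  [addCommGroup : ∀ x, AddCommGroup (Fib x)]
  [module : ∀ x, Module ℝ (Fib x)]
  [topFib : ∀ x, TopologicalSpace (Fib x)]
  [topTotal : TopologicalSpace (TotalSpace F Fib)]
  [fiberBundle : FiberBundle F Fib]
  [vectorBundle : VectorBundle ℝ F Fib]
  [smooth : ContMDiffVectorBundle ∞ F Fib 𝓘(ℝ, E)]

attribute [instance] SmoothVectorBundle.addCommGroup SmoothVectorBundle.module
  SmoothVectorBundle.topFib SmoothVectorBundle.topTotal SmoothVectorBundle.fiberBundle
  SmoothVectorBundle.vectorBundle SmoothVectorBundle.smooth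

variable {E M F}

/-- The total space of a vector bundle. -/
abbrev SmoothVectorBundle.Total (V : SmoothVectorBundle.{uE, uM, uF, uV} E M F) :
    Type (max uM uV) :=
  TotalSpace F V.Fib

/-- The space `Γ V` of smooth global sections of a vector bundle. -/
abbrev SmoothVectorBundle.Sections (V : SmoothVectorBundle.{uE, uM, uF, uV} E M F) :
    Type (max uM uV) :=
  ContMDiffSection 𝓘(ℝ, E) F ∞ V.Fib

/-- The product `u • X` of a smooth function and a smooth section. -/
def SmoothVectorBundle.smulSection (V : SmoothVectorBundle.{uE, uM, uF, uV} E M F)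
    (u : C^∞⟮𝓘(ℝ, E), M; ℝ⟯) (X : V.Sections) : V.Sections :=
  ⟨fun x => u x • X x, u.contMDiff.smul_section X.contMDiff⟩

variable (E M F)

/-- A Lie algebroid over `M`: a smooth vector bundle with an anchor to the tangent bundle and an
`ℝ`-bilinear, alternating bracket on its sections which satisfies the Jacobi identity, is
preserved by the anchor and satisfies the Leibniz rule `[X, uY] = u[X, Y] + q(X)(u)Y`. -/
structure LieAlgebroid [IsManifold 𝓘(ℝ, E) ∞ M] extends
    SmoothVectorBundle.{uE, uM, uF, uV} E M F where
  /-- the anchor -/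
  anchor : ∀ x : M, Fib x →ₗ[ℝ] TangentSpace 𝓘(ℝ, E) x
  smooth_anchor : ContMDiff (𝓘(ℝ, E).prod 𝓘(ℝ, F)) 𝓘(ℝ, E).tangent ∞
    (fun z : TotalSpace F Fib => (⟨z.1, anchor z.1 z.2⟩ : TangentBundle 𝓘(ℝ, E) M))
  /-- the bracket of sections -/
  bracket : toSmoothVectorBundle.Sections →ₗ[ℝ] toSmoothVectorBundle.Sections →ₗ[ℝ]
    toSmoothVectorBundle.Sections
  bracket_self : ∀ X, bracket X X = 0
  jacobi : ∀ X Y Z, bracket X (bracket Y Z) + bracket Y (bracket Z X) +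
    bracket Z (bracket X Y) = 0
  anchor_bracket : ∀ X Y x, anchor x (bracket X Y x) =
    VectorField.mlieBracket 𝓘(ℝ, E) (fun y => anchor y (X y)) (fun y => anchor y (Y y)) x
  leibniz : ∀ X Y (u : C^∞⟮𝓘(ℝ, E), M; ℝ⟯) (x : M),
    bracket X (toSmoothVectorBundle.smulSection u Y) x =
      u x • bracket X Y x + mvfderiv 𝓘(ℝ, E) u x (anchor x (X x)) • Y x

/-- A Lie algebra bundle over `M`: a smooth vector bundle with a Lie algebra structure on each
fibre which, around each point `x₀`, has a smooth local trivialization by Lie algebra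
isomorphisms onto a fixed Lie algebra (which can be taken to be the fibre over `x₀`). -/
structure LieAlgebraBundle extends SmoothVectorBundle.{uE, uM, uF, uV} E M F where
  /-- the Lie bracket of a fibre -/
  lie : ∀ x : M, Fib x →ₗ[ℝ] Fib x →ₗ[ℝ] Fib x
  lie_self : ∀ x v, lie x v v = 0
  lie_jacobi : ∀ x u v w, lie x u (lie x v w) + lie x v (lie x w u) + lie x w (lie x u v) = 0
  locally_trivial : ∀ x₀ : M, ∃ U : Set M, IsOpen U ∧ x₀ ∈ U ∧
    ∃ Φ : ∀ x : M, Fib x₀ →ₗ[ℝ] Fib x,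
      (∀ x ∈ U, Function.Bijective (Φ x)) ∧
      (∀ x ∈ U, ∀ v w, Φ x (lie x₀ v w) = lie x (Φ x v) (Φ x w)) ∧
      ∀ v : Fib x₀, ContMDiffOn 𝓘(ℝ, E) (𝓘(ℝ, E).prod 𝓘(ℝ, F)) ∞
        (fun x => (⟨x, Φ x v⟩ : TotalSpace F Fib)) U

end Bundles

section Morphisms

variable {E : Type*} [NormedAddCommGroup E] [NormedSpace ℝ E]
  {M : Type*} [TopologicalSpace M] [ChartedSpace E M]
  {F : Type*} [NormedAddCommGroup F] [NormedSpace ℝ F]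
  {F' : Type*} [NormedAddCommGroup F'] [NormedSpace ℝ F']

/-- A fibrewise linear map over the identity of `M` is a morphism of smooth vector bundles. -/
def IsBundleMorphism (V : SmoothVectorBundle E M F) (W : SmoothVectorBundle E M F')
    (φ : ∀ x, V.Fib x →ₗ[ℝ] W.Fib x) : Prop :=
  ContMDiff (𝓘(ℝ, E).prod 𝓘(ℝ, F)) (𝓘(ℝ, E).prod 𝓘(ℝ, F')) ∞
    (fun z : V.Total => (⟨z.1, φ z.1 z.2⟩ : W.Total))

variable [IsManifold 𝓘(ℝ, E) ∞ M]

/-- A Lie algebroid is transitive if its anchor is fibrewise surjective. -/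
def LieAlgebroid.IsTransitive (A : LieAlgebroid E M F) : Prop :=
  ∀ x, Function.Surjective (A.anchor x)

/-- Morphisms of Lie algebroids over the identity of `M`. -/
structure IsLieAlgebroidMorphism (A : LieAlgebroid E M F) (B : LieAlgebroid E M F')
    (φ : ∀ x, A.Fib x →ₗ[ℝ] B.Fib x) : Prop where
  smooth : IsBundleMorphism A.toSmoothVectorBundle B.toSmoothVectorBundle φ
  anchor : ∀ x v, B.anchor x (φ x v) = A.anchor x v
  bracket : ∀ (X Y : A.Sections) (X' Y' : B.Sections),
    (∀ x, X' x = φ x (X x)) → (∀ x, Y' x = φ x (Y x)) →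
    ∀ x, B.bracket X' Y' x = φ x (A.bracket X Y x)

/-- `j : L → A` identifies the Lie algebra bundle `L` with the kernel of the fibrewise linear map
`q` on the Lie algebroid `A`, where `q` takes its values in the vector spaces `W x`, and `j` is a
morphism of Lie algebroids if `L` is given the zero anchor and the pointwise bracket of sections. -/
structure IsKernelBundle {W : M → Type*} [∀ x, AddCommGroup (W x)] [∀ x, Module ℝ (W x)]
    (A : LieAlgebroid E M F) (q : ∀ x, A.Fib x →ₗ[ℝ] W x) (L : LieAlgebraBundle E M F')
    (j : ∀ x, L.Fib x →ₗ[ℝ] A.Fib x) : Prop where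
  smooth : IsBundleMorphism L.toSmoothVectorBundle A.toSmoothVectorBundle j
  injective : ∀ x, Function.Injective (j x)
  exact : ∀ x, LinearMap.range (j x) = LinearMap.ker (q x)
  anchor : ∀ x v, A.anchor x (j x v) = 0
  bracket : ∀ (V W : L.Sections) (X Y : A.Sections),
    (∀ x, X x = j x (V x)) → (∀ x, Y x = j x (W x)) →
    ∀ x, A.bracket X Y x = j x (L.lie x (V x) (W x))

end Morphisms

/-! ## The tangent bundle as a Lie algebroid -/

section Tangent

variable (E : Type*) [NormedAddCommGroup E] [NormedSpace ℝ E] [FiniteDimensional ℝ E]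
  (M : Type*) [TopologicalSpace M] [ChartedSpace E M] [IsManifold 𝓘(ℝ, E) ∞ M]

/-- The tangent bundle as a smooth vector bundle. -/
abbrev tangentVectorBundle : SmoothVectorBundle E M E where
  Fib := fun x : M => TangentSpace 𝓘(ℝ, E) x

/-- The Lie bracket of smooth vector fields. -/
def vectorFieldBracket (X Y : (tangentVectorBundle E M).Sections) :
    (tangentVectorBundle E M).Sections where
  toFun := VectorField.mlieBracket 𝓘(ℝ, E) X Y
  contMDiff_toFun := by
    have := FiniteDimensional.complete ℝ E
    have : IsManifold 𝓘(ℝ, E) (minSmoothness ℝ 2) M := by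
      rw [minSmoothness_of_isRCLikeNormedField]; infer_instance
    have : IsManifold 𝓘(ℝ, E) (((⊤ : ℕ∞) : WithTop ℕ∞) + 1) M :=
      inferInstanceAs (IsManifold 𝓘(ℝ, E) ∞ M)
    intro x
    exact ContMDiffAt.mlieBracket_vectorField (m := ⊤) (n := ⊤) (X.contMDiff x) (Y.contMDiff x)
      (by simp)

/-- The tangent bundle `TM` as a Lie algebroid: the anchor is the identity and the bracket is the
Lie bracket of vector fields. -/
def tangentLieAlgebroid : LieAlgebroid E M E where
  toSmoothVectorBundle := tangentVectorBundle E M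
  anchor := fun _ => LinearMap.id
  smooth_anchor := contMDiff_id
  bracket := LinearMap.mk₂ ℝ (vectorFieldBracket E M)
    (fun X X' Y => by
      have := FiniteDimensional.complete ℝ E
      ext x
      exact VectorField.mlieBracket_add_left (X.contMDiff.mdifferentiable (by simp) x)
        (X'.contMDiff.mdifferentiable (by simp) x))
    (fun c X Y => by
      have := FiniteDimensional.complete ℝ E
      ext x
      exact VectorField.mlieBracket_const_smul_left (X.contMDiff.mdifferentiable (by simp) x))
    (fun X Y Y' => by
      have := FiniteDimensional.complete ℝ E
      ext x
      exact VectorField.mlieBracket_add_right (Y.contMDiff.mdifferentiable (by simp) x)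
        (Y'.contMDiff.mdifferentiable (by simp) x))
    (fun c X Y => by
      have := FiniteDimensional.complete ℝ E
      ext x
      exact VectorField.mlieBracket_const_smul_right (Y.contMDiff.mdifferentiable (by simp) x))
  bracket_self := fun X => by
    ext x
    exact congrFun VectorField.mlieBracket_self x
  jacobi := fun X Y Z => by
    have := FiniteDimensional.complete ℝ E
    have : IsManifold 𝓘(ℝ, E) (minSmoothness ℝ 3) M := by
      rw [minSmoothness_of_isRCLikeNormedField]; infer_instance
    have h2 : (minSmoothness ℝ 2 : WithTop ℕ∞) ≤ ∞ := by
      rw [minSmoothness_of_isRCLikeNormedField]; exact ENat.LEInfty.out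
    ext x
    have h := VectorField.leibniz_identity_mlieBracket_apply (I := 𝓘(ℝ, E)) (U := X) (V := Y)
      (W := Z) (x := x) ((X.contMDiff x).of_le h2) ((Y.contMDiff x).of_le h2)
      ((Z.contMDiff x).of_le h2)
    have h₀ : VectorField.mlieBracket 𝓘(ℝ, E) Z X =
        (-1 : ℝ) • VectorField.mlieBracket 𝓘(ℝ, E) X Z := by
      rw [VectorField.mlieBracket_swap, neg_one_smul]
    have h₁ : VectorField.mlieBracket 𝓘(ℝ, E) Y (VectorField.mlieBracket 𝓘(ℝ, E) Z X) x =
        (-1 : ℝ) • VectorField.mlieBracket 𝓘(ℝ, E) Y (VectorField.mlieBracket 𝓘(ℝ, E) X Z) x := by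
      rw [h₀]
      exact VectorField.mlieBracket_const_smul_right
        ((vectorFieldBracket E M X Z).contMDiff.mdifferentiable (by simp) x)
    have h₂ := VectorField.mlieBracket_swap_apply (I := 𝓘(ℝ, E)) (V := Z)
      (W := VectorField.mlieBracket 𝓘(ℝ, E) X Y) (x := x)
    change VectorField.mlieBracket 𝓘(ℝ, E) X (VectorField.mlieBracket 𝓘(ℝ, E) Y Z) x +
      VectorField.mlieBracket 𝓘(ℝ, E) Y (VectorField.mlieBracket 𝓘(ℝ, E) Z X) x +
      VectorField.mlieBracket 𝓘(ℝ, E) Z (VectorField.mlieBracket 𝓘(ℝ, E) X Y) x = 0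
    rw [h, h₁, h₂, neg_one_smul]
    abel
  anchor_bracket := fun X Y x => rfl
  leibniz := fun X Y u x => by
    have := FiniteDimensional.complete ℝ E
    have h := VectorField.mlieBracket_smul_right (I := 𝓘(ℝ, E)) (V := X) (W := Y) (f := u) (x := x)
      (u.contMDiff.mdifferentiable (by simp) x) (Y.contMDiff.mdifferentiable (by simp) x)
    rw [add_comm] at h
    exact h

end Tangent

/-! ## Principal bundles and equivariant structures

Right actions are actions of the opposite group, written `u <• g`. -/

section Principal

variable (EP : Type*) [NormedAddCommGroup EP] [NormedSpace ℝ EP]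
  (EM : Type*) [NormedAddCommGroup EM] [NormedSpace ℝ EM]
  (EG : Type*) [NormedAddCommGroup EG] [NormedSpace ℝ EG]
  {P : Type*} [TopologicalSpace P] [ChartedSpace EP P]
  {M : Type*} [TopologicalSpace M] [ChartedSpace EM M]
  {G : Type*} [TopologicalSpace G] [ChartedSpace EG G] [Group G] [MulAction Gᵐᵒᵖ P]

/-- `p : P → M` is a smooth principal bundle for the given right action of the Lie group `G` on
`P`: everything is smooth, `p` is invariant and, over a neighbourhood `U` of each point,
there is an equivariant diffeomorphism `p⁻¹(U) ≅ U × G` over `U`. -/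
structure IsPrincipalBundle (p : P → M) : Prop where
  smooth_proj : ContMDiff 𝓘(ℝ, EP) 𝓘(ℝ, EM) ∞ p
  smooth_act : ContMDiff (𝓘(ℝ, EP).prod 𝓘(ℝ, EG)) 𝓘(ℝ, EP) ∞ (fun z : P × G => z.1 <• z.2)
  proj_act : ∀ (u : P) (g : G), p (u <• g) = p u
  locally_trivial : ∀ x : M, ∃ U : Set M, IsOpen U ∧ x ∈ U ∧
    ∃ φ : OpenPartialHomeomorph P (M × G),
      φ.source = p ⁻¹' U ∧ φ.target = U ×ˢ (univ : Set G) ∧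
      ContMDiffOn 𝓘(ℝ, EP) (𝓘(ℝ, EM).prod 𝓘(ℝ, EG)) ∞ φ φ.source ∧
      ContMDiffOn (𝓘(ℝ, EM).prod 𝓘(ℝ, EG)) 𝓘(ℝ, EP) ∞ φ.symm φ.target ∧
      (∀ u ∈ φ.source, (φ u).1 = p u) ∧
      ∀ u ∈ φ.source, ∀ g : G, φ (u <• g) = (p u, (φ u).2 * g)

variable {EP EM}
variable {F : Type*} [NormedAddCommGroup F] [NormedSpace ℝ F]

variable (G) in
/-- A smooth right action of `G` on (the total space of) a vector bundle `V → P` such that each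
`g` acts by a vector bundle map `R g` over the right translation by `g` in `P`. -/
structure PBGAction (V : SmoothVectorBundle EP P F) where
  /-- the right translations, fibre by fibre -/
  R : ∀ (g : G) (u : P), V.Fib u →ₗ[ℝ] V.Fib (u <• g)
  act_one : ∀ z : V.Total, (⟨z.1 <• (1 : G), R 1 z.1 z.2⟩ : V.Total) = z
  act_mul : ∀ (g h : G) (z : V.Total), (⟨z.1 <• (g * h), R (g * h) z.1 z.2⟩ : V.Total) =
    ⟨(z.1 <• g) <• h, R h (z.1 <• g) (R g z.1 z.2)⟩
  smooth : ContMDiff ((𝓘(ℝ, EP).prod 𝓘(ℝ, F)).prod 𝓘(ℝ, EG)) (𝓘(ℝ, EP).prod 𝓘(ℝ, F)) ∞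
    (fun z : V.Total × G => (⟨z.1.1 <• z.2, R z.2 z.1.1 z.1.2⟩ : V.Total))

namespace PBGAction

variable {EG} {V : SmoothVectorBundle EP P F} (ρ : PBGAction EG G V)

/-- The right translation by `g` on the total space. -/
def act (g : G) (z : V.Total) : V.Total := ⟨z.1 <• g, ρ.R g z.1 z.2⟩

/-- Lying in the same `G`-orbit. -/
def orbitSetoid : Setoid V.Total where
  r z w := ∃ g : G, w = ρ.act g z
  iseqv :=
    { refl := fun z => ⟨1, (ρ.act_one z).symm⟩
      symm := by
        rintro z _ ⟨g, rfl⟩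
        refine ⟨g⁻¹, ?_⟩
        have h := ρ.act_mul g g⁻¹ z
        rw [mul_inv_cancel, ρ.act_one] at h
        exact h
      trans := by
        rintro z _ _ ⟨g, rfl⟩ ⟨h, rfl⟩
        exact ⟨g * h, (ρ.act_mul g h z).symm⟩ }

/-- The orbit space `V/G`, with the quotient topology. -/
def OrbitSpace : Type _ := Quotient ρ.orbitSetoid

instance : TopologicalSpace ρ.OrbitSpace := inferInstanceAs (TopologicalSpace (Quotient _))

/-- The projection of the total space onto the orbit space. -/
def toOrbit (z : V.Total) : ρ.OrbitSpace := Quotient.mk ρ.orbitSetoid z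

end PBGAction

/-- `W → M` is the quotient vector bundle of `V → P` by the action of `G`, with projection
`♮ : V → W` over `p`: the total space of `W` is the quotient manifold of the total space of `V`
(`♮` is a surjective submersion whose fibres are the `G`-orbits) and `♮` is fibrewise linear. -/
structure IsQuotientBundle (p : P → M) {V : SmoothVectorBundle EP P F} (ρ : PBGAction EG G V)
    (W : SmoothVectorBundle EM M F) (nat : ∀ u : P, V.Fib u →ₗ[ℝ] W.Fib (p u)) : Prop where
  submersion : IsSubmersion (𝓘(ℝ, EP).prod 𝓘(ℝ, F)) (𝓘(ℝ, EM).prod 𝓘(ℝ, F)) ∞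
    (fun z : V.Total => (⟨p z.1, nat z.1 z.2⟩ : W.Total))
  surjective : Function.Surjective (fun z : V.Total => (⟨p z.1, nat z.1 z.2⟩ : W.Total))
  orbits : ∀ z w : V.Total, (⟨p z.1, nat z.1 z.2⟩ : W.Total) = ⟨p w.1, nat w.1 w.2⟩ ↔
    ∃ g : G, w = ρ.act g z

/-- An action of `G` on a Lie algebra bundle over `P` is by Lie algebra bundle automorphisms,
i.e. defines a PBG-Lie algebra bundle. -/
def IsPBGLieAlgebraBundle (L : LieAlgebraBundle EP P F)
    (ρ : PBGAction EG G L.toSmoothVectorBundle) : Prop :=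
  ∀ (g : G) (u : P) (v w : L.Fib u), L.lie (u <• g) (ρ.R g u v) (ρ.R g u w) =
    ρ.R g u (L.lie u v w)

/-- `K → M` is the quotient Lie algebra bundle of the PBG-Lie algebra bundle `L → P`. -/
structure IsQuotientLieAlgebraBundle (p : P → M) (L : LieAlgebraBundle EP P F)
    (ρ : PBGAction EG G L.toSmoothVectorBundle) (K : LieAlgebraBundle EM M F)
    (nat : ∀ u : P, L.Fib u →ₗ[ℝ] K.Fib (p u)) : Prop where
  quotient : IsQuotientBundle EG p ρ K.toSmoothVectorBundle nat
  lie : ∀ (u : P) (v w : L.Fib u),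
    K.lie (p u) (nat u v) (nat u w) = nat u (L.lie u v w)

variable [IsManifold 𝓘(ℝ, EP) ∞ P] [IsManifold 𝓘(ℝ, EM) ∞ M]

/-- An action of `G` on a Lie algebroid over `P` is by Lie algebroid automorphisms over the right
translations of `P`, i.e. defines a PBG-algebroid: it preserves anchors, and the bracket of the
translates `X', Y'` of two sections `X, Y` by `g` is the translate of their bracket. -/
structure IsPBGAlgebroid (A : LieAlgebroid EP P F)
    (ρ : PBGAction EG G A.toSmoothVectorBundle) : Prop where
  anchor : ∀ (g : G) (u : P) (v : A.Fib u), A.anchor (u <• g) (ρ.R g u v) =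
    mfderiv 𝓘(ℝ, EP) 𝓘(ℝ, EP) (fun w : P => w <• g) u (A.anchor u v)
  bracket : ∀ (g : G) (X Y X' Y' : A.Sections),
    (∀ u, X' (u <• g) = ρ.R g u (X u)) → (∀ u, Y' (u <• g) = ρ.R g u (Y u)) →
    ∀ u, A.bracket X' Y' (u <• g) = ρ.R g u (A.bracket X Y u)

/-- `B → M` is the quotient Lie algebroid of the PBG-algebroid `A → P`, with projection
`♮ : A → B` over `p`: it is the quotient vector bundle, `♮` commutes with the anchors, and the
bracket of sections of `B` is the bracket of the corresponding (equivariant) sections of `A`. -/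
structure IsQuotientLieAlgebroid (p : P → M) (A : LieAlgebroid EP P F)
    (ρ : PBGAction EG G A.toSmoothVectorBundle) (B : LieAlgebroid EM M F)
    (nat : ∀ u : P, A.Fib u →ₗ[ℝ] B.Fib (p u)) : Prop where
  quotient : IsQuotientBundle EG p ρ B.toSmoothVectorBundle nat
  anchor : ∀ (u : P) (v : A.Fib u), B.anchor (p u) (nat u v) =
    mfderiv 𝓘(ℝ, EP) 𝓘(ℝ, EM) p u (A.anchor u v)
  bracket : ∀ (X Y : A.Sections) (X' Y' : B.Sections),
    (∀ u, nat u (X u) = X' (p u)) → (∀ u, nat u (Y u) = Y' (p u)) →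
    ∀ u, nat u (A.bracket X Y u) = B.bracket X' Y' (p u)

variable [FiniteDimensional ℝ EP] [LieGroup 𝓘(ℝ, EG) ∞ G]

/-- The action of `G` on the tangent bundle `TP` by the differentials of the right translations. -/
def tangentAction (hact : ContMDiff (𝓘(ℝ, EP).prod 𝓘(ℝ, EG)) 𝓘(ℝ, EP) ∞
    (fun z : P × G => z.1 <• z.2)) :
    PBGAction EG G (tangentLieAlgebroid EP P).toSmoothVectorBundle where
  R := fun g u => (mfderiv 𝓘(ℝ, EP) 𝓘(ℝ, EP) (fun w : P => w <• g) u).toLinearMap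
  act_one := fun z => by
    have h : (fun w : P => w <• (1 : G)) = id := by
      funext w
      simp
    change tangentMap 𝓘(ℝ, EP) 𝓘(ℝ, EP) (fun w : P => w <• (1 : G)) z = z
    rw [h, tangentMap_id]
    rfl
  act_mul := fun g h z => by
    have hs : ∀ g : G, MDifferentiable 𝓘(ℝ, EP) 𝓘(ℝ, EP) (fun w : P => w <• g) := fun g =>
      (hact.comp (contMDiff_id.prodMk contMDiff_const)).mdifferentiable (by simp)
    have hc : (fun w : P => w <• (g * h)) = (fun w : P => w <• h) ∘ (fun w : P => w <• g) := by
      funext w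
      simp [mul_smul]
    change tangentMap 𝓘(ℝ, EP) 𝓘(ℝ, EP) (fun w : P => w <• (g * h)) z =
      tangentMap 𝓘(ℝ, EP) 𝓘(ℝ, EP) (fun w : P => w <• h)
        (tangentMap 𝓘(ℝ, EP) 𝓘(ℝ, EP) (fun w : P => w <• g) z)
    rw [hc]
    exact congrFun (tangentMap_comp (hs h) (hs g)) z
  smooth := by
    have h₁ : ContMDiff (𝓘(ℝ, EP).prod 𝓘(ℝ, EG)).tangent 𝓘(ℝ, EP).tangent ∞
        (tangentMap (𝓘(ℝ, EP).prod 𝓘(ℝ, EG)) 𝓘(ℝ, EP) (fun z : P × G => z.1 <• z.2)) :=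
      hact.contMDiff_tangentMap (by simp)
    have h₂ : ContMDiff (𝓘(ℝ, EP).tangent.prod 𝓘(ℝ, EG).tangent)
        (𝓘(ℝ, EP).prod 𝓘(ℝ, EG)).tangent ∞
        (equivTangentBundleProd 𝓘(ℝ, EP) P 𝓘(ℝ, EG) G).symm :=
      contMDiff_equivTangentBundleProd_symm
    have h₃ : ContMDiff (𝓘(ℝ, EP).tangent.prod 𝓘(ℝ, EG))
        (𝓘(ℝ, EP).tangent.prod 𝓘(ℝ, EG).tangent) ∞
        (fun z : TangentBundle 𝓘(ℝ, EP) P × G => (z.1, (⟨z.2, 0⟩ : TangentBundle 𝓘(ℝ, EG) G))) :=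
      contMDiff_fst.prodMk
        ((contMDiff_zeroSection ℝ (fun g : G => TangentSpace 𝓘(ℝ, EG) g)).comp contMDiff_snd)
    refine (h₁.comp (h₂.comp h₃)).congr ?_
    rintro ⟨⟨u, v⟩, g⟩
    have h := mfderiv_prod_eq_add_apply (v := ((v, 0) : EP × EG))
      (hact.mdifferentiable (by simp) (u, g))
    have h' := h.trans ((congrArg (_ + ·) (map_zero _)).trans (add_zero _))
    exact congrArg (fun w => (⟨u <• g, w⟩ : TangentBundle 𝓘(ℝ, EP) P)) h'.symm

end Principal

end PBG

end

open PBG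

universe uEP uEM uEG uP uM uG uF uV

/-! Why `A/G` exists. The action on `P` is free with the fibres of `p` as orbits, so over the image
of a local section `σ` of `p` every orbit in `A` has exactly one representative. The quotient over
the domain of `σ` is therefore the pullback of `A` along `σ`, and a vector of `A` amounts to its
class together with the group coordinate of its base point. Two local sections differ by the smooth
map `div`, so the pulled back frames fit together to a vector bundle, and `♮` is a locally trivial
fibration with typical fibre `G` (`exists_quotientBundle_aux`). This one fact gives that `♮` is a
submersion and a quotient map, and that smoothness downstairs can be tested upstairs. Moreover `♮`
is an isomorphism on each fibre.

Why it is a Lie algebroid. Sections of `A/G` are the same as equivariant sections of `A` (`pull`,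
`exists_push`). These are closed under the bracket because `G` acts by automorphisms. The identities
are inherited through the injective map `pull`; compatibility with the anchor rests on the fact that
brackets of `p`-related vector fields are `p`-related (`mfderiv_mlieBracket_of_related`). The case
`A = TP` gives the Atiyah algebroid. The maps of the exact sequence descend because they are
equivariant, and their properties are checked over `P`.

Why `L` is a Lie algebra bundle. The kernel of a surjective bundle map of constant rank is a bundle,
and its fibre bracket is the tensorial part of the bracket of `A`. Local triviality is the analytic
core. In frames, Jacobi says that the structure functions `c` satisfy `dc(q(a)) = c · Γ(a)`, the
infinitesimal action of an endomorphism on a bilinear operation. Transitivity turns this into an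
equation for `dc` in all directions. The implicit function theorem provides a smooth gauge `Ψ` that
moves `c(y)` to `c(x₀)` up to an error `n` in a complement of the tangent space of the orbit of
`c(x₀)`. The equation then yields `‖dn‖ ≤ C‖n‖`, and `n` vanishes by a Grönwall argument along rays
(`exists_trivialization_of_parallel`). No flatness of `Γ` is needed. -/

noncomputable section

namespace PBG

universe vE vM vF vV vI

/-! ### Brackets of related vector fields -/

section RelatedVectorFields

open VectorField

variable {E : Type*} [NormedAddCommGroup E] [NormedSpace ℝ E]
  {E' : Type*} [NormedAddCommGroup E'] [NormedSpace ℝ E']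
  {M' : Type*} [TopologicalSpace M'] [ChartedSpace E' M']
  {M : Type*} [TopologicalSpace M] [ChartedSpace E M]

/-- If `f` maps the vector fields `V, W` to `V', W'`, then it maps `[V, W]` to `[V', W']`:
the case of normed spaces. -/
theorem fderiv_lieBracket_of_related {f : E → E'} {V W : E → E} {V' W' : E' → E'} {x : E}
    (hf : ContDiffAt ℝ 2 f x) (hV : DifferentiableAt ℝ V x) (hW : DifferentiableAt ℝ W x)
    (hV' : DifferentiableAt ℝ V' (f x)) (hW' : DifferentiableAt ℝ W' (f x))
    (hfV : ∀ᶠ y in 𝓝 x, fderiv ℝ f y (V y) = V' (f y))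
    (hfW : ∀ᶠ y in 𝓝 x, fderiv ℝ f y (W y) = W' (f y)) :
    fderiv ℝ f x (lieBracket ℝ V W x) = lieBracket ℝ V' W' (f x) := by
  have hfx : DifferentiableAt ℝ f x := hf.differentiableAt (by simp)
  -- By symmetry of the second derivative, only the derivatives of `y ↦ Df(V)` and `y ↦ Df(W)`
  -- remain; relatedness replaces these maps by `V' ∘ f` and `W' ∘ f`.
  rw [fderiv_apply_lieBracket hf (by simp) hW hV, Filter.EventuallyEq.fderiv_eq hfV,
    Filter.EventuallyEq.fderiv_eq hfW, fderiv_fun_comp x hV' hfx, fderiv_fun_comp x hW' hfx,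
    lieBracket_eq]
  simp [hfV.self_of_nhds, hfW.self_of_nhds]

variable [IsManifold 𝓘(ℝ, E') ∞ M'] [IsManifold 𝓘(ℝ, E) ∞ M]

/-- A vector field in the coordinates of the chart at `x`. -/
def chartField (x : M) (V : Π x : M, TangentSpace 𝓘(ℝ, E) x) : E → E :=
  mpullbackWithin 𝓘(ℝ, E) 𝓘(ℝ, E) (extChartAt 𝓘(ℝ, E) x).symm V (range 𝓘(ℝ, E))

/-- Pulling back along the inverse chart is pushing forward along the chart, because the two
derivatives are inverse to each other. -/
theorem chartField_apply (V : Π x : M, TangentSpace 𝓘(ℝ, E) x) (x : M) {y : M}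
    (hy : y ∈ (extChartAt 𝓘(ℝ, E) x).source) :
    chartField x V (extChartAt 𝓘(ℝ, E) x y) =
      mfderiv 𝓘(ℝ, E) 𝓘(ℝ, E) (extChartAt 𝓘(ℝ, E) x) y (V y) := by
  have : IsManifold 𝓘(ℝ, E) 1 M := .of_le (n := ∞) (by simp)
  have hy' := (extChartAt 𝓘(ℝ, E) x).map_source hy
  have hl := (extChartAt 𝓘(ℝ, E) x).left_inv hy
  refine ((isInvertible_mfderivWithin_extChartAt_symm hy').inverse_apply_eq).2 ?_
  have h := mfderivWithin_extChartAt_symm_comp_mfderiv_extChartAt (I := 𝓘(ℝ, E)) hy'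
  have h2 := congrArg (fun L => L (V ((extChartAt 𝓘(ℝ, E) x).symm (extChartAt 𝓘(ℝ, E) x y)))) h
  refine h2.symm.trans ?_
  -- The two sides differ only in the base point of `V`, which equals `y` propositionally;
  -- generalizing it avoids a dependent rewrite.
  have h3 : ∀ z, z = y → mfderivWithin 𝓘(ℝ, E) 𝓘(ℝ, E) (extChartAt 𝓘(ℝ, E) x).symm
      (range 𝓘(ℝ, E)) (extChartAt 𝓘(ℝ, E) x y)
      (mfderiv 𝓘(ℝ, E) 𝓘(ℝ, E) (extChartAt 𝓘(ℝ, E) x) z (V z)) =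
      mfderivWithin 𝓘(ℝ, E) 𝓘(ℝ, E) (extChartAt 𝓘(ℝ, E) x).symm
      (range 𝓘(ℝ, E)) (extChartAt 𝓘(ℝ, E) x y)
      (mfderiv 𝓘(ℝ, E) 𝓘(ℝ, E) (extChartAt 𝓘(ℝ, E) x) y (V y)) := by
    rintro z rfl
    rfl
  exact h3 _ hl

theorem differentiableAt_chartField [CompleteSpace E] {V : Π x : M, TangentSpace 𝓘(ℝ, E) x} {x : M}
    (hV : MDiffAt (T% V) x) :
    DifferentiableAt ℝ (chartField x V) (extChartAt 𝓘(ℝ, E) x x) := by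
  have : IsManifold 𝓘(ℝ, E) 2 M := .of_le (n := ∞) (by exact ENat.LEInfty.out)
  have h := (mdifferentiableWithinAt_univ.2 hV).differentiableWithinAt_mpullbackWithin_vectorField
  have hr : (extChartAt 𝓘(ℝ, E) x).symm ⁻¹' univ ∩ range 𝓘(ℝ, E) = univ := by simp
  rw [hr] at h
  exact differentiableWithinAt_univ.1 h

/-- The definition of the bracket on a manifold, with the inverse derivative of the chart moved to
the other side. -/
theorem mfderiv_extChartAt_mlieBracket (V W : Π x : M, TangentSpace 𝓘(ℝ, E) x) (x : M) :
    mfderiv 𝓘(ℝ, E) 𝓘(ℝ, E) (extChartAt 𝓘(ℝ, E) x) x (mlieBracket 𝓘(ℝ, E) V W x) =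
    lieBracket ℝ (chartField x V) (chartField x W) (extChartAt 𝓘(ℝ, E) x x) := by
  have : IsManifold 𝓘(ℝ, E) 1 M := .of_le (n := ∞) (by simp)
  have hr : (extChartAt 𝓘(ℝ, E) x).symm ⁻¹' univ ∩ range 𝓘(ℝ, E) = univ := by simp
  have h := mlieBracketWithin_apply (I := 𝓘(ℝ, E)) (V := V) (W := W) (s := univ) (x₀ := x)
  rw [hr] at h
  have h2 := ((isInvertible_mfderiv_extChartAt (mem_extChartAt_source x)).inverse_apply_eq).1 h.symm
  rw [← lieBracketWithin_univ]
  exact h2.symm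

/-- If `f` maps the vector fields `V, W` to `V', W'`, then it maps `[V, W]` to `[V', W']`. -/
theorem mfderiv_mlieBracket_of_related [CompleteSpace E] [CompleteSpace E'] {f : M → M'}
    {V W : Π x : M, TangentSpace 𝓘(ℝ, E) x} {V' W' : Π x : M', TangentSpace 𝓘(ℝ, E') x} {x : M}
    (hf : ContMDiff 𝓘(ℝ, E) 𝓘(ℝ, E') ∞ f)
    (hV : MDiffAt (T% V) x) (hW : MDiffAt (T% W) x)
    (hV' : MDiffAt (T% V') (f x)) (hW' : MDiffAt (T% W') (f x))
    (hfV : ∀ y, mfderiv 𝓘(ℝ, E) 𝓘(ℝ, E') f y (V y) = V' (f y))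
    (hfW : ∀ y, mfderiv 𝓘(ℝ, E) 𝓘(ℝ, E') f y (W y) = W' (f y)) :
    mfderiv 𝓘(ℝ, E) 𝓘(ℝ, E') f x (mlieBracket 𝓘(ℝ, E) V W x) =
      mlieBracket 𝓘(ℝ, E') V' W' (f x) := by
  have : IsManifold 𝓘(ℝ, E) 1 M := .of_le (n := ∞) (by simp)
  have : IsManifold 𝓘(ℝ, E') 1 M' := .of_le (n := ∞) (by simp)
  have : IsManifold 𝓘(ℝ, E) 2 M := .of_le (n := ∞) (by exact ENat.LEInfty.out)
  have : IsManifold 𝓘(ℝ, E') 2 M' := .of_le (n := ∞) (by exact ENat.LEInfty.out)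
  set φ := extChartAt 𝓘(ℝ, E) x
  set ψ := extChartAt 𝓘(ℝ, E') (f x)
  have hmf := hf.mdifferentiable (by simp)
  have hF : ContDiffAt ℝ ∞ (ψ ∘ f ∘ φ.symm) (φ x) := by
    have := (contMDiffAt_iff.1 (hf x)).2
    rwa [modelWithCornersSelf_coe, range_id, contDiffWithinAt_univ] at this
  have hFx : (ψ ∘ f ∘ φ.symm) (φ x) = ψ (f x) := by simp [φ]
  have hev : ∀ᶠ y in 𝓝 x, y ∈ φ.source ∧ f y ∈ ψ.source :=
    Filter.Eventually.and (extChartAt_source_mem_nhds x)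
      (hf.continuous.continuousAt (extChartAt_source_mem_nhds (f x)))
  -- The chain rule for the coordinate expression of `f`, at all points near `x`: it makes the chart
  -- fields related as soon as the fields are.
  have key : ∀ y, y ∈ φ.source → f y ∈ ψ.source → ∀ w : TangentSpace 𝓘(ℝ, E) y,
      DifferentiableAt ℝ (ψ ∘ f ∘ φ.symm) (φ y) →
      fderiv ℝ (ψ ∘ f ∘ φ.symm) (φ y) (mfderiv 𝓘(ℝ, E) 𝓘(ℝ, E) φ y w) =
      mfderiv 𝓘(ℝ, E') 𝓘(ℝ, E') ψ (f y) (mfderiv 𝓘(ℝ, E) 𝓘(ℝ, E') f y w) := by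
    intro y hy hfy w hd
    have hφd : MDifferentiableAt 𝓘(ℝ, E) 𝓘(ℝ, E) φ y :=
      mdifferentiableAt_extChartAt (by simpa [φ] using hy)
    have hψd : MDifferentiableAt 𝓘(ℝ, E') 𝓘(ℝ, E') ψ (f y) :=
      mdifferentiableAt_extChartAt (by simpa [ψ] using hfy)
    have h1 : ((ψ ∘ f ∘ φ.symm) ∘ φ) =ᶠ[𝓝 y] ψ ∘ f := by
      filter_upwards [(isOpen_extChartAt_source x).mem_nhds hy] with z hz
      exact congrArg (fun a => ψ (f a)) ((extChartAt 𝓘(ℝ, E) x).left_inv hz)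
    have h2 := h1.mfderiv_eq (I := 𝓘(ℝ, E)) (I' := 𝓘(ℝ, E'))
    rw [mfderiv_comp y hd.mdifferentiableAt hφd, mfderiv_comp y hψd (hmf y)] at h2
    have h3 := congrArg (fun L => L w) h2
    rw [mfderiv_eq_fderiv] at h3
    exact h3
  have hFd : ∀ᶠ y in 𝓝 (φ x), DifferentiableAt ℝ (ψ ∘ f ∘ φ.symm) y :=
    ((hF.of_le (m := 1) (by simp)).eventually (by simp)).mono
      fun y hy => hy.differentiableAt (by simp)
  have hrel : ∀ (V : Π x : M, TangentSpace 𝓘(ℝ, E) x) (V' : Π x : M', TangentSpace 𝓘(ℝ, E') x),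
      (∀ y, mfderiv 𝓘(ℝ, E) 𝓘(ℝ, E') f y (V y) = V' (f y)) → ∀ᶠ y in 𝓝 (φ x),
      fderiv ℝ (ψ ∘ f ∘ φ.symm) y
        (chartField x V y) =
      chartField (f x) V' ((ψ ∘ f ∘ φ.symm) y) := by
    intro V V' h
    have hc : ContinuousAt φ.symm (φ x) := continuousAt_extChartAt_symm x
    have hx : φ.symm (φ x) = x := by simp [φ]
    filter_upwards [hFd, hc (by rw [hx]; exact hev), extChartAt_target_mem_nhds x] with y hy hy2 hy3
    obtain ⟨z, hz, rfl⟩ : ∃ z ∈ φ.source, φ z = y := ⟨φ.symm y, φ.map_target hy3, φ.right_inv hy3⟩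
    have hz2 : f z ∈ ψ.source := by
      have := hy2.2
      rwa [φ.left_inv hz] at this
    have hz3 : (ψ ∘ f ∘ φ.symm) (φ z) = ψ (f z) := by simp [φ.left_inv hz]
    rw [hz3, chartField_apply V x hz,
      chartField_apply V' (f x) hz2, ← h]
    exact key z hz hz2 _ hy
  have main := fderiv_lieBracket_of_related (hF.of_le (by exact ENat.LEInfty.out)) (differentiableAt_chartField hV)
    (differentiableAt_chartField hW) (by rw [hFx]; exact differentiableAt_chartField hV') (by rw [hFx]; exact differentiableAt_chartField hW')
    (hrel V V' hfV) (hrel W W' hfW)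
  rw [hFx, ← mfderiv_extChartAt_mlieBracket, ← mfderiv_extChartAt_mlieBracket] at main
  rw [key x (mem_extChartAt_source x) (mem_extChartAt_source (f x)) _ hFd.self_of_nhds] at main
  exact (isInvertible_mfderiv_extChartAt (mem_extChartAt_source (f x))).injective main

end RelatedVectorFields

/-! ### Principal bundles: local sections and the division map -/

namespace IsPrincipalBundle

variable {EP : Type*} [NormedAddCommGroup EP] [NormedSpace ℝ EP]
  {EM : Type*} [NormedAddCommGroup EM] [NormedSpace ℝ EM]
  {EG : Type*} [NormedAddCommGroup EG] [NormedSpace ℝ EG]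
  {P : Type*} [TopologicalSpace P] [ChartedSpace EP P]
  {M : Type*} [TopologicalSpace M] [ChartedSpace EM M]
  {G : Type*} [TopologicalSpace G] [ChartedSpace EG G] [Group G] [MulAction Gᵐᵒᵖ P]
  {p : P → M} (hp : IsPrincipalBundle EP EM EG (G := G) p)
  {EN : Type*} [NormedAddCommGroup EN] [NormedSpace ℝ EN] {HN : Type*} [TopologicalSpace HN]
  {IN : ModelWithCorners ℝ EN HN} {N : Type*} [TopologicalSpace N] [ChartedSpace HN N]

include hp

/-- Smooth local sections of a principal bundle. -/
theorem exists_localSection (x : M) : ∃ U : Set M, IsOpen U ∧ x ∈ U ∧ ∃ σ : M → P,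
    ContMDiffOn 𝓘(ℝ, EM) 𝓘(ℝ, EP) ∞ σ U ∧ ∀ y ∈ U, p (σ y) = y := by
  obtain ⟨U, hU, hx, φ, hs, ht, -, hφ', hφp, -⟩ := hp.locally_trivial x
  have hm : ∀ y ∈ U, (y, (1 : G)) ∈ φ.target := fun y hy => by simp [ht, hy]
  refine ⟨U, hU, hx, fun y => φ.symm (y, 1), ?_, fun y hy => ?_⟩
  · exact hφ'.comp (contMDiffOn_id.prodMk contMDiffOn_const) hm
  · rw [← hφp _ (φ.map_target (hm y hy)), φ.right_inv (hm y hy)]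

theorem surjective : Function.Surjective p := fun x => by
  obtain ⟨U, -, hx, σ, -, hσ⟩ := hp.exists_localSection x
  exact ⟨σ x, hσ x hx⟩

theorem eq_of_smul_eq {u : P} {g h : G} (H : u <• g = u <• h) : g = h := by
  obtain ⟨U, -, hx, φ, hs, -, -, -, -, hφ⟩ := hp.locally_trivial (p u)
  have hu : u ∈ φ.source := by rw [hs]; exact hx
  have := (hφ u hu g).symm.trans ((congrArg φ H).trans (hφ u hu h))
  simpa using this

theorem eq_one_of_smul_eq {u : P} {g : G} (H : u <• g = u) : g = 1 :=
  hp.eq_of_smul_eq (u := u) (by simpa using H)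

/-- In a trivialization the translating element is the quotient of the two group coordinates. -/
theorem eq_smul_of_trivialization {u u' : P} (h : p u = p u') {U : Set M} (hu : p u ∈ U)
    {φ : OpenPartialHomeomorph P (M × G)} (hs : φ.source = p ⁻¹' U)
    (hφp : ∀ u ∈ φ.source, (φ u).1 = p u)
    (hφ : ∀ u ∈ φ.source, ∀ g : G, φ (u <• g) = (p u, (φ u).2 * g)) :
    u' = u <• ((φ u).2⁻¹ * (φ u').2) := by
  have hm : u ∈ φ.source := by rw [hs]; exact hu
  have hm' : u' ∈ φ.source := by rw [hs, mem_preimage, ← h]; exact hu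
  have hm'' : u <• ((φ u).2⁻¹ * (φ u').2) ∈ φ.source := by
    rw [hs, mem_preimage, hp.proj_act]; exact hu
  refine φ.injOn hm' hm'' ?_
  rw [hφ u hm]
  exact Prod.ext ((hφp u' hm').trans h.symm) (by simp)

theorem exists_eq_smul {u u' : P} (h : p u = p u') : ∃ g : G, u' = u <• g := by
  obtain ⟨U, -, hx, φ, hs, -, -, -, hφp, hφ⟩ := hp.locally_trivial (p u)
  exact ⟨_, hp.eq_smul_of_trivialization h hx hs hφp hφ⟩

omit hp in
variable (G) in
open Classical in
/-- The element of the structure group which takes `u` to `u'`. -/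
def div (u u' : P) : G :=
  if h : ∃ g : G, u' = u <• g then h.choose else 1

theorem smul_div {u u' : P} (h : p u = p u') : u <• div G u u' = u' := by
  have := hp.exists_eq_smul h
  rw [div, dif_pos this]
  exact this.choose_spec.symm

theorem div_smul (u : P) (g : G) : div G u (u <• g) = g :=
  hp.eq_of_smul_eq (hp.smul_div (hp.proj_act u g).symm)

/-- `div` is defined by choice, but freeness forces it to agree with the quotient of group
coordinates in any trivialization, and that quotient is smooth. -/
theorem contMDiffOn_div [LieGroup 𝓘(ℝ, EG) ∞ G] {a b : N → P} {s : Set N}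
    (ha : ContMDiffOn IN 𝓘(ℝ, EP) ∞ a s) (hb : ContMDiffOn IN 𝓘(ℝ, EP) ∞ b s)
    (hab : ∀ n ∈ s, p (a n) = p (b n)) :
    ContMDiffOn IN 𝓘(ℝ, EG) ∞ (fun n => div G (a n) (b n)) s := by
  intro n hn
  obtain ⟨U, hU, hx, φ, hs, -, hφc, -, hφp, hφ⟩ := hp.locally_trivial (p (a n))
  have hpre : IsOpen (p ⁻¹' U) := hU.preimage hp.smooth_proj.continuous
  have hφc' : ContMDiffOn 𝓘(ℝ, EP) 𝓘(ℝ, EG) ∞ (fun u => (φ u).2) φ.source :=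
    contMDiff_snd.comp_contMDiffOn hφc
  have hm : ∀ u, p u ∈ U → φ.source ∈ 𝓝 u := fun u hu => by
    rw [hs]; exact hpre.mem_nhds hu
  have h1 : ContMDiffWithinAt IN 𝓘(ℝ, EG) ∞ (fun n => (φ (a n)).2⁻¹ * (φ (b n)).2) s n :=
    ((hφc'.contMDiffAt (hm (a n) hx)).comp_contMDiffWithinAt n (ha n hn)).inv.mul
      ((hφc'.contMDiffAt (hm (b n) (by rwa [← hab n hn]))).comp_contMDiffWithinAt n (hb n hn))
  have key : ∀ m ∈ s, p (a m) ∈ U → div G (a m) (b m) = (φ (a m)).2⁻¹ * (φ (b m)).2 := by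
    intro m hm hU
    apply hp.eq_of_smul_eq (u := a m)
    rw [hp.smul_div (hab m hm)]
    exact hp.eq_smul_of_trivialization (hab m hm) hU hs hφp hφ
  refine h1.congr_of_eventuallyEq ?_ (key n hn hx)
  filter_upwards [self_mem_nhdsWithin,
    (ha n hn).continuousWithinAt (hpre.mem_nhds hx)] with m hm1 hm2
  exact key m hm1 hm2

theorem contMDiff_act_right (g : G) :
    ContMDiff 𝓘(ℝ, EP) 𝓘(ℝ, EP) ∞ (fun u : P => u <• g) :=
  hp.smooth_act.comp (contMDiff_id.prodMk contMDiff_const)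

theorem mfderiv_proj_smul (g : G) (u : P) (v : TangentSpace 𝓘(ℝ, EP) u) :
    mfderiv 𝓘(ℝ, EP) 𝓘(ℝ, EM) p (u <• g)
      (mfderiv 𝓘(ℝ, EP) 𝓘(ℝ, EP) (fun w : P => w <• g) u v) =
    mfderiv 𝓘(ℝ, EP) 𝓘(ℝ, EM) p u v := by
  have h := mfderiv_comp u (hp.smooth_proj.mdifferentiable (by simp) (u <• g))
    ((hp.contMDiff_act_right g).mdifferentiable (by simp) u)
  have h2 : p ∘ (fun w : P => w <• g) = p := funext fun w => hp.proj_act w g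
  rw [h2] at h
  exact (congrArg (fun L => L v) h).symm

/-- A local section need not pass through `u`, but a right translate of it does, and the derivative
of this translate is a right inverse of the derivative of `p`. -/
theorem surjective_mfderiv (u : P) :
    Function.Surjective (mfderiv 𝓘(ℝ, EP) 𝓘(ℝ, EM) p u) := by
  obtain ⟨U, hU, hx, σ, hσ, hpσ⟩ := hp.exists_localSection (p u)
  have h0 : p (σ (p u)) = p u := hpσ _ hx
  obtain ⟨g, hg⟩ := hp.exists_eq_smul h0
  intro w
  have hσd : MDifferentiableAt 𝓘(ℝ, EM) 𝓘(ℝ, EP) σ (p u) :=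
    ((hσ.contMDiffAt (hU.mem_nhds hx)).mdifferentiableAt (by simp))
  have hgd := (hp.contMDiff_act_right g).mdifferentiable (by simp) (σ (p u))
  have hd : HasMFDerivAt 𝓘(ℝ, EM) 𝓘(ℝ, EP) (fun y => σ y <• g) (p u) _ :=
    HasMFDerivAt.comp (p u) hgd.hasMFDerivAt hσd.hasMFDerivAt
  have hid : (p ∘ fun y => σ y <• g) =ᶠ[𝓝 (p u)] id := by
    filter_upwards [hU.mem_nhds hx] with y hy
    simp [hp.proj_act, hpσ y hy]
  have hpd : HasMFDerivAt 𝓘(ℝ, EP) 𝓘(ℝ, EM) p (σ (p u) <• g) _ :=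
    (hp.smooth_proj.mdifferentiable (by simp) _).hasMFDerivAt
  have h := (hasMFDerivAt_id (I := 𝓘(ℝ, EM)) (p u)).congr_of_eventuallyEq hid
  have h2 := hasMFDerivAt_unique h (HasMFDerivAt.comp (p u) hpd hd)
  have h3 := congrArg (fun L => L w) h2
  revert h3
  rw [← hg] 
  intro h3
  exact ⟨_, h3.symm⟩

end IsPrincipalBundle

/-! ### Vector bundles from local frames -/

section FrameData

variable {E : Type vE} [NormedAddCommGroup E] [NormedSpace ℝ E]
  {M : Type vM} [TopologicalSpace M] [ChartedSpace E M]
  {F : Type vF} [NormedAddCommGroup F] [NormedSpace ℝ F]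

/-- A smooth frame of a vector bundle over the open set `U`: a smooth family of linear
isomorphisms of the fibres over `U` with the model fibre. -/
structure LocalFrame (V : SmoothVectorBundle.{vE, vM, vF, vV} E M F) (U : Set M) where
  isOpen : IsOpen U
  /-- the coordinates of a vector -/
  coord : ∀ x, V.Fib x →ₗ[ℝ] F
  /-- the vector with given coordinates -/
  inv : ∀ x, F →ₗ[ℝ] V.Fib x
  coord_inv : ∀ x ∈ U, ∀ v, coord x (inv x v) = v
  inv_coord : ∀ x ∈ U, ∀ v, inv x (coord x v) = v
  smooth_coord : ContMDiffOn (𝓘(ℝ, E).prod 𝓘(ℝ, F)) 𝓘(ℝ, F) ∞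
    (fun z : V.Total => coord z.1 z.2) {z | z.1 ∈ U}
  smooth_inv : ContMDiffOn (𝓘(ℝ, E).prod 𝓘(ℝ, F)) (𝓘(ℝ, E).prod 𝓘(ℝ, F)) ∞
    (fun z : M × F => (⟨z.1, inv z.1 z.2⟩ : V.Total)) {z | z.1 ∈ U}

/-- The frame given by a trivialization in the atlas of the bundle. -/
def LocalFrame.ofTrivialization (V : SmoothVectorBundle.{vE, vM, vF, vV} E M F)
    (e : Trivialization F (π F V.Fib)) [MemTrivializationAtlas e] : LocalFrame V e.baseSet where
  isOpen := e.open_baseSet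
  coord := fun x => e.linearMapAt ℝ x
  inv := fun x => e.symmₗ ℝ x
  coord_inv := fun x hx v => e.linearMapAt_symmₗ hx v
  inv_coord := fun x hx v => e.symmₗ_linearMapAt hx v
  smooth_coord := by
    have h := (contMDiff_snd (I := 𝓘(ℝ, E)) (J := 𝓘(ℝ, F)) (M := M) (N := F)
      (n := ∞)).comp_contMDiffOn (e.contMDiffOn (IB := 𝓘(ℝ, E)) (n := ∞))
    have hs : {z : V.Total | z.1 ∈ e.baseSet} = e.source := by ext z; simp [e.mem_source]
    rw [hs]
    refine h.congr fun z hz => ?_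
    rw [e.mem_source] at hz
    rw [e.coe_linearMapAt_of_mem hz]
    rfl
  smooth_inv := by
    have h := e.contMDiffOn_symm (IB := 𝓘(ℝ, E)) (n := ∞)
    have hs : {z : M × F | z.1 ∈ e.baseSet} = e.target := by ext z; simp [e.mem_target]
    rw [hs]
    refine h.congr fun z hz => ?_
    rw [e.mem_target] at hz
    rw [e.symmₗ_apply hz]
    exact e.mk_symm hz z.2

theorem SmoothVectorBundle.exists_localFrame (V : SmoothVectorBundle.{vE, vM, vF, vV} E M F)
    (x : M) : ∃ U : Set M, x ∈ U ∧ Nonempty (LocalFrame V U) :=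
  ⟨_, FiberBundle.mem_baseSet_trivializationAt F V.Fib x,
    ⟨LocalFrame.ofTrivialization V (trivializationAt F V.Fib x)⟩⟩

variable (E F) in
/-- Linear frames of a family of vector spaces with smooth coordinate changes, from which a smooth
vector bundle can be built. -/
structure FrameData (Fib : M → Type vV) [∀ x, AddCommGroup (Fib x)] [∀ x, Module ℝ (Fib x)] where
  /-- the type of indices of the frames -/
  Idx : Type vI
  /-- the domain of a frame -/
  dom : Idx → Set M
  isOpen_dom : ∀ i, IsOpen (dom i)
  /-- the index of a frame around a point -/
  index : M → Idx
  mem_dom_index : ∀ x, x ∈ dom (index x)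
  /-- the coordinates of a vector -/
  coord : Idx → ∀ x, Fib x →ₗ[ℝ] F
  /-- the vector with given coordinates -/
  inv : Idx → ∀ x, F →ₗ[ℝ] Fib x
  coord_inv : ∀ i, ∀ x ∈ dom i, ∀ v, coord i x (inv i x v) = v
  inv_coord : ∀ i, ∀ x ∈ dom i, ∀ v, inv i x (coord i x v) = v
  smooth : ∀ i j v, ContMDiffOn 𝓘(ℝ, E) 𝓘(ℝ, F) ∞ (fun x => coord j x (inv i x v)) (dom i ∩ dom j)

/-- A family of linear maps from a finite-dimensional space which is pointwise smooth is smooth. -/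
theorem contMDiffOn_clm_of_apply [FiniteDimensional ℝ F] {F' : Type*} [NormedAddCommGroup F']
    [NormedSpace ℝ F'] {EN : Type*} [NormedAddCommGroup EN] [NormedSpace ℝ EN] {HN : Type*}
    [TopologicalSpace HN] {IN : ModelWithCorners ℝ EN HN} {N : Type*} [TopologicalSpace N]
    [ChartedSpace HN N] {n : WithTop ℕ∞} {f : N → F →L[ℝ] F'} {s : Set N}
    (hf : ∀ v, ContMDiffOn IN 𝓘(ℝ, F') n (fun x => f x v) s) :
    ContMDiffOn IN 𝓘(ℝ, F →L[ℝ] F') n f s := by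
  classical
  let b := Module.finBasis ℝ F
  have key : ∀ x, f x = ∑ i, (ContinuousLinearMap.smulRightL ℝ F F'
      (LinearMap.toContinuousLinearMap (b.coord i))) (f x (b i)) := by
    intro x
    ext v
    conv_lhs => rw [← b.sum_repr v, map_sum]
    simp
  rw [show f = fun x => _ from funext key]
  refine contMDiffOn_finsetSum fun i _ => ?_
  exact (ContinuousLinearMap.contMDiff _).comp_contMDiffOn (hf (b i))

namespace FrameData

variable {Fib : M → Type vV} [∀ x, AddCommGroup (Fib x)] [∀ x, Module ℝ (Fib x)]
  (D : FrameData.{vE, vM, vF, vV, vI} E F Fib)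

/-- The pretrivialization defined by a frame. -/
def pretrivialization (i : D.Idx) : Pretrivialization F (π F Fib) where
  toFun z := (z.1, D.coord i z.1 z.2)
  invFun z := ⟨z.1, D.inv i z.1 z.2⟩
  source := {z | z.1 ∈ D.dom i}
  target := D.dom i ×ˢ univ
  map_source' z hz := ⟨hz, mem_univ _⟩
  map_target' z hz := hz.1
  left_inv' z hz := by
    obtain ⟨x, v⟩ := z
    exact congrArg (TotalSpace.mk x) (D.inv_coord i x hz v)
  right_inv' z hz := Prod.ext rfl (D.coord_inv i z.1 hz.1 z.2)
  open_target := (D.isOpen_dom i).prod isOpen_univ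
  baseSet := D.dom i
  open_baseSet := D.isOpen_dom i
  source_eq := rfl
  target_eq := rfl
  proj_toFun z hz := rfl

theorem pretrivialization_symm (i : D.Idx) {x : M} (hx : x ∈ D.dom i) (v : F) :
    (D.pretrivialization i).symm x v = D.inv i x v := by
  have h := (D.pretrivialization i).apply_mk_symm (b := x) hx v
  have h2 : D.coord i x ((D.pretrivialization i).symm x v) = v := congrArg Prod.snd h
  rw [← D.inv_coord i x hx ((D.pretrivialization i).symm x v), h2]

variable [FiniteDimensional ℝ F]

theorem exists_coordChange (i j : D.Idx) : ∃ f : M → F →L[ℝ] F,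
    ContMDiffOn 𝓘(ℝ, E) 𝓘(ℝ, F →L[ℝ] F) ∞ f (D.dom i ∩ D.dom j) ∧
    ∀ x ∈ D.dom i ∩ D.dom j, ∀ v : F,
      f x v = (D.pretrivialization j ⟨x, (D.pretrivialization i).symm x v⟩).2 := by
  refine ⟨fun x => LinearMap.toContinuousLinearMap (D.coord j x ∘ₗ D.inv i x),
    contMDiffOn_clm_of_apply fun v => D.smooth i j v, fun x hx v => ?_⟩
  rw [D.pretrivialization_symm i hx.1]
  rfl

/-- The topology of the fibres. -/
@[reducible]
def topFib (x : M) : TopologicalSpace (Fib x) :=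
  TopologicalSpace.induced (D.coord (D.index x) x) inferInstance

/-- The vector prebundle with the given frames. -/
@[reducible]
def prebundle :
    letI := D.topFib
    VectorPrebundle ℝ F Fib :=
  letI := D.topFib
  { pretrivializationAtlas := range D.pretrivialization
    pretrivialization_linear' := by
      rintro _ ⟨i, rfl⟩
      exact ⟨fun x _ => (D.coord i x).isLinear⟩
    pretrivializationAt := fun x => D.pretrivialization (D.index x)
    mem_base_pretrivializationAt := D.mem_dom_index
    pretrivialization_mem_atlas := fun x => mem_range_self _
    exists_coordChange := by
      rintro _ ⟨i, rfl⟩ _ ⟨j, rfl⟩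
      obtain ⟨f, hf, hf'⟩ := D.exists_coordChange i j
      exact ⟨f, hf.continuousOn, hf'⟩
    totalSpaceMk_isInducing := fun x => by
      have h : IsInducing (fun v : F => (x, v)) := (isEmbedding_prodMkRight x).isInducing
      exact h.comp ⟨rfl⟩ }

theorem isContMDiff :
    letI := D.topFib
    D.prebundle.IsContMDiff 𝓘(ℝ, E) ∞ :=
  letI := D.topFib
  { exists_contMDiffCoordChange := by
      rintro _ ⟨i, rfl⟩ _ ⟨j, rfl⟩
      exact D.exists_coordChange i j }

/-- The smooth vector bundle with the given frames. -/
def toBundle : SmoothVectorBundle.{vE, vM, vF, vV} E M F :=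
  letI := D.topFib
  letI := D.prebundle.totalSpaceTopology
  letI := D.prebundle.toFiberBundle
  have := D.prebundle.toVectorBundle
  have := D.isContMDiff
  have := D.prebundle.contMDiffVectorBundle 𝓘(ℝ, E) (n := ∞)
  { Fib := Fib }

/-- The given frames are smooth frames of the bundle. -/
theorem exists_localFrame (i : D.Idx) : ∃ φ : LocalFrame D.toBundle (D.dom i),
    φ.coord = D.coord i ∧ φ.inv = D.inv i := by
  let e : Trivialization F (π F D.toBundle.Fib) :=
    letI := D.topFib
    D.prebundle.trivializationOfMemPretrivializationAtlas (mem_range_self i)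
  have : MemTrivializationAtlas e := ⟨⟨_, mem_range_self i, rfl⟩⟩
  have hc : ∀ x ∈ D.dom i, ∀ v, e.linearMapAt ℝ x v = D.coord i x v := by
    intro x hx v
    rw [e.coe_linearMapAt_of_mem hx]
    rfl
  have hi : ∀ x ∈ D.dom i, ∀ v, e.symmₗ ℝ x v = D.inv i x v := by
    intro x hx v
    rw [← D.inv_coord i x hx (e.symmₗ ℝ x v), ← hc x hx, e.linearMapAt_symmₗ hx]
  let φ := LocalFrame.ofTrivialization D.toBundle e
  exact ⟨{
    isOpen := D.isOpen_dom i
    coord := D.coord i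
    inv := D.inv i
    coord_inv := D.coord_inv i
    inv_coord := D.inv_coord i
    smooth_coord := φ.smooth_coord.congr fun z hz => (hc z.1 hz z.2).symm
    smooth_inv := φ.smooth_inv.congr fun z hz =>
      congrArg (TotalSpace.mk z.1) (hi z.1 hz z.2).symm }, rfl, rfl⟩

end FrameData

end FrameData

/-! ### Transport along orbits and frames of the quotient -/

section Quotient

variable {EP : Type*} [NormedAddCommGroup EP] [NormedSpace ℝ EP]
  {EM : Type*} [NormedAddCommGroup EM] [NormedSpace ℝ EM]
  {EG : Type*} [NormedAddCommGroup EG] [NormedSpace ℝ EG]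
  {P : Type*} [TopologicalSpace P] [ChartedSpace EP P]
  {M : Type*} [TopologicalSpace M] [ChartedSpace EM M]
  {G : Type*} [TopologicalSpace G] [ChartedSpace EG G] [Group G] [MulAction Gᵐᵒᵖ P]
  {F : Type*} [NormedAddCommGroup F] [NormedSpace ℝ F]
  {p : P → M} {V : SmoothVectorBundle.{_, _, _, vV} EP P F} (ρ : PBGAction EG G V)

namespace PBGAction

theorem act_inv_act (g : G) (z : V.Total) : ρ.act g⁻¹ (ρ.act g z) = z := by
  have h := ρ.act_mul g g⁻¹ z
  rw [mul_inv_cancel, ρ.act_one] at h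
  exact h.symm

theorem act_act (g h : G) (z : V.Total) : ρ.act h (ρ.act g z) = ρ.act (g * h) z :=
  (ρ.act_mul g h z).symm

theorem act_one' (z : V.Total) : ρ.act 1 z = z := ρ.act_one z

theorem contMDiff_act : ContMDiff ((𝓘(ℝ, EP).prod 𝓘(ℝ, F)).prod 𝓘(ℝ, EG))
    (𝓘(ℝ, EP).prod 𝓘(ℝ, F)) ∞ (fun z : V.Total × G => ρ.act z.2 z.1) := ρ.smooth

open Classical in
/-- The map between two fibres in the same orbit given by the action. -/
def transport (u u' : P) : V.Fib u →ₗ[ℝ] V.Fib u' :=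
  if h : u <• IsPrincipalBundle.div G u u' = u' then
    h ▸ ρ.R (IsPrincipalBundle.div G u u') u
  else 0

variable (hp : IsPrincipalBundle EP EM EG (G := G) p)

include hp

/-- In the total space the cast inside `transport` disappears and transport is the action of `div`;
later computations go through this identity. -/
theorem mk_transport {u u' : P} (h : p u = p u') (v : V.Fib u) :
    (⟨u', ρ.transport u u' v⟩ : V.Total) = ρ.act (IsPrincipalBundle.div G u u') ⟨u, v⟩ := by
  have h' := hp.smul_div h
  rw [transport, dif_pos h']
  generalize IsPrincipalBundle.div G u u' = g at *
  subst h'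
  rfl

/-- By freeness on `P`, any group element that takes `u` to `u'` is `div`, so any such element
computes the transport. -/
theorem transport_eq_of_act {u u' : P} {g : G} {v : V.Fib u} {v' : V.Fib u'}
    (h : ρ.act g ⟨u, v⟩ = ⟨u', v'⟩) : ρ.transport u u' v = v' := by
  have h0 : u <• g = u' := congrArg TotalSpace.proj h
  have h1 : IsPrincipalBundle.div G u u' = g := by rw [← h0]; exact hp.div_smul u g
  have h2 : p u = p u' := by rw [← h0]; exact (hp.proj_act u g).symm
  have h3 := ρ.mk_transport hp h2 v
  rw [h1, h] at h3
  exact TotalSpace.mk_injective _ h3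

theorem transport_transport {u u' u'' : P} (h : p u = p u') (h' : p u' = p u'') (v : V.Fib u) :
    ρ.transport u' u'' (ρ.transport u u' v) = ρ.transport u u'' v := by
  symm
  apply ρ.transport_eq_of_act hp
  rw [ρ.mk_transport hp h', ρ.mk_transport hp h, act_act]

theorem transport_self (u : P) (v : V.Fib u) : ρ.transport u u v = v :=
  ρ.transport_eq_of_act hp (ρ.act_one' _)

end PBGAction

namespace IsPrincipalBundle

variable (V) (hp : IsPrincipalBundle EP EM EG (G := G) p)

include hp

/-- The domain of the section is shrunk until its image lies in the domain of a frame of `V`;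
pulling this frame back along the section frames the quotient. -/
theorem exists_localSection_localFrame (x : M) : ∃ (U : Set M) (σ : M → P) (W : Set P)
    (_ : LocalFrame V W), IsOpen U ∧ x ∈ U ∧ ContMDiffOn 𝓘(ℝ, EM) 𝓘(ℝ, EP) ∞ σ U ∧
    (∀ y ∈ U, p (σ y) = y) ∧ ∀ y ∈ U, σ y ∈ W := by
  obtain ⟨U, hU, hx, σ, hσ, hpσ⟩ := hp.exists_localSection x
  obtain ⟨W, hxW, ⟨φ⟩⟩ := V.exists_localFrame (σ x)
  refine ⟨U ∩ σ ⁻¹' W, σ, W, φ, hσ.continuousOn.isOpen_inter_preimage hU φ.isOpen, ⟨hx, hxW⟩,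
    hσ.mono inter_subset_left, fun y hy => hpσ y hy.1, fun y hy => hy.2⟩

end IsPrincipalBundle

variable [LieGroup 𝓘(ℝ, EG) ∞ G] (hp : IsPrincipalBundle EP EM EG (G := G) p)

/-- The smooth frames of the quotient bundle, whose fibre over `x` is realized as the fibre of `V`
over a chosen point of `p⁻¹(x)`. -/
def quotientFrameData : FrameData.{_, _, _, vV, _} EM F
    (fun x : M => V.Fib (Function.surjInv hp.surjective x)) :=
  -- The section `s` is arbitrary and need not be continuous. It only names the fibres; smoothness
  -- comes from frames over the local sections `σ`, transported to `s`.
  let s := Function.surjInv hp.surjective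
  have hs : ∀ x, p (s x) = x := Function.surjInv_eq hp.surjective
  let U : M → Set M := fun x => (hp.exists_localSection_localFrame V x).choose
  let σ : M → M → P := fun x => (hp.exists_localSection_localFrame V x).choose_spec.choose
  let φ := fun x => (hp.exists_localSection_localFrame V x).choose_spec.choose_spec.choose_spec.choose
  have h := fun x =>
    (hp.exists_localSection_localFrame V x).choose_spec.choose_spec.choose_spec.choose_spec
  { Idx := M
    dom := U
    isOpen_dom := fun x => (h x).1
    index := id
    mem_dom_index := fun x => (h x).2.1
    coord := fun x y => (φ x).coord (σ x y) ∘ₗ ρ.transport (s y) (σ x y)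
    inv := fun x y => ρ.transport (σ x y) (s y) ∘ₗ (φ x).inv (σ x y)
    coord_inv := fun x y hy v => by
      have h1 := (h x).2.2.2.1 y hy
      simp only [LinearMap.comp_apply]
      rw [ρ.transport_transport hp (h1.trans (hs y).symm) ((hs y).trans h1.symm),
        ρ.transport_self hp, (φ x).coord_inv _ ((h x).2.2.2.2 y hy)]
    inv_coord := fun x y hy v => by
      have h1 := (h x).2.2.2.1 y hy
      simp only [LinearMap.comp_apply]
      rw [(φ x).inv_coord _ ((h x).2.2.2.2 y hy),
        ρ.transport_transport hp ((hs y).trans h1.symm) (h1.trans (hs y).symm),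
        ρ.transport_self hp]
    smooth := fun x x' v => by
      have hd : ContMDiffOn 𝓘(ℝ, EM) 𝓘(ℝ, EG) ∞
          (fun y => IsPrincipalBundle.div G (σ x y) (σ x' y)) (U x ∩ U x') :=
        hp.contMDiffOn_div ((h x).2.2.1.mono inter_subset_left)
          ((h x').2.2.1.mono inter_subset_right)
          fun y hy => ((h x).2.2.2.1 y hy.1).trans ((h x').2.2.2.1 y hy.2).symm
      have hi := (φ x).smooth_inv.comp
        (((h x).2.2.1.mono inter_subset_left : ContMDiffOn _ _ _ _ (U x ∩ U x')).prodMk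
          (contMDiffOn_const (c := v))) fun y hy => (h x).2.2.2.2 y hy.1
      -- The detour through the fibre over `s y` cancels: the change of frames is the action of
      -- `div`, smooth in `y`.
      have key : ∀ y ∈ U x ∩ U x', ρ.act (IsPrincipalBundle.div G (σ x y) (σ x' y))
          ⟨σ x y, (φ x).inv (σ x y) v⟩ = ⟨σ x' y, ρ.transport (s y) (σ x' y)
            (ρ.transport (σ x y) (s y) ((φ x).inv (σ x y) v))⟩ := by
        intro y hy
        have h1 := (h x).2.2.2.1 y hy.1
        have h2 := (h x').2.2.2.1 y hy.2
        rw [ρ.transport_transport hp (h1.trans (hs y).symm) ((hs y).trans h2.symm),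
          ρ.mk_transport hp (h1.trans h2.symm)]
      have ha := ρ.contMDiff_act.comp_contMDiffOn (hi.prodMk hd)
      refine ((φ x').smooth_coord.comp ha fun y hy => ?_).congr fun y hy => ?_
      · have h3 := congrArg TotalSpace.proj (key y hy)
        exact (congrArg (· ∈ _) h3).mpr ((h x').2.2.2.2 y hy.2)
      · exact (congrArg (fun z : V.Total => (φ x').coord z.1 z.2) (key y hy)).symm }

end Quotient

/-! ### Smooth fibrations -/

section SmoothFibration

variable {EG : Type*} [NormedAddCommGroup EG] [NormedSpace ℝ EG]
  {E₁ : Type*} [NormedAddCommGroup E₁] [NormedSpace ℝ E₁] {H₁ : Type*} [TopologicalSpace H₁]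
  (I₁ : ModelWithCorners ℝ E₁ H₁) {N₁ : Type*} [TopologicalSpace N₁] [ChartedSpace H₁ N₁]
  {E₂ : Type*} [NormedAddCommGroup E₂] [NormedSpace ℝ E₂] {H₂ : Type*} [TopologicalSpace H₂]
  (I₂ : ModelWithCorners ℝ E₂ H₂) {N₂ : Type*} [TopologicalSpace N₂] [ChartedSpace H₂ N₂]
  (G : Type*) [TopologicalSpace G] [ChartedSpace EG G]

variable (EG) in
/-- `f` is a smooth fibre bundle projection with typical fibre `G`. -/
def IsSmoothFibration (f : N₁ → N₂) : Prop :=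
  ∀ w : N₂, ∃ O : Set N₂, IsOpen O ∧ w ∈ O ∧ ∃ Θ : OpenPartialHomeomorph N₁ (N₂ × G),
    Θ.source = f ⁻¹' O ∧ Θ.target = O ×ˢ (univ : Set G) ∧
    ContMDiffOn I₁ (I₂.prod 𝓘(ℝ, EG)) ∞ Θ Θ.source ∧
    ContMDiffOn (I₂.prod 𝓘(ℝ, EG)) I₁ ∞ Θ.symm Θ.target ∧
    ∀ z ∈ Θ.source, (Θ z).1 = f z

namespace IsSmoothFibration

variable {G I₁ I₂} {f : N₁ → N₂} (hf : IsSmoothFibration EG I₁ I₂ G f)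

include hf

theorem contMDiff : ContMDiff I₁ I₂ ∞ f := by
  intro z
  obtain ⟨O, hO, hz, Θ, hs, ht, hΘ, -, hfst⟩ := hf (f z)
  have hz' : z ∈ Θ.source := by rw [hs]; exact hz
  refine ((contMDiff_fst.comp_contMDiffOn hΘ).contMDiffAt
    (Θ.open_source.mem_nhds hz')).congr_of_eventuallyEq ?_
  filter_upwards [Θ.open_source.mem_nhds hz'] with y hy
  exact (hfst y hy).symm

/-- Smooth local sections of a fibre bundle projection with nonempty fibres. -/
theorem exists_localSection [Nonempty G] (w : N₂) : ∃ O : Set N₂, IsOpen O ∧ w ∈ O ∧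
    ∃ S : N₂ → N₁, ContMDiffOn I₂ I₁ ∞ S O ∧ ∀ y ∈ O, f (S y) = y := by
  obtain ⟨O, hO, hw, Θ, hs, ht, -, hΘ, hfst⟩ := hf w
  obtain ⟨g⟩ := ‹Nonempty G›
  have hm : ∀ y ∈ O, (y, g) ∈ Θ.target := fun y hy => by simp [ht, hy]
  refine ⟨O, hO, hw, fun y => Θ.symm (y, g), hΘ.comp (contMDiffOn_id.prodMk contMDiffOn_const) hm,
    fun y hy => ?_⟩
  rw [← hfst _ (Θ.map_target (hm y hy)), Θ.right_inv (hm y hy)]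

theorem surjective [Nonempty G] : Function.Surjective f := fun w => by
  obtain ⟨O, -, hw, S, -, h⟩ := hf.exists_localSection w
  exact ⟨S w, h w hw⟩

theorem isOpenMap : IsOpenMap f := by
  rw [isOpenMap_iff_nhds_le]
  intro z
  obtain ⟨O, hO, hz, Θ, hs, ht, hΘ, -, hfst⟩ := hf (f z)
  have hz' : z ∈ Θ.source := by rw [hs]; exact hz
  have h1 : Filter.map f (𝓝 z) = Filter.map Prod.fst (Filter.map Θ (𝓝 z)) := by
    rw [Filter.map_map]
    refine Filter.map_congr ?_
    filter_upwards [Θ.open_source.mem_nhds hz'] with y hy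
    exact (hfst y hy).symm
  rw [h1, Θ.map_nhds_eq hz', map_fst_nhds, hfst z hz']

theorem isQuotientMap [Nonempty G] : IsQuotientMap f :=
  hf.isOpenMap.isQuotientMap hf.contMDiff.continuous hf.surjective

/-- A map on the base of a fibre bundle projection is smooth if it is smooth on the total space. -/
theorem contMDiff_of_comp [Nonempty G] {E₃ : Type*} [NormedAddCommGroup E₃] [NormedSpace ℝ E₃]
    {H₃ : Type*} [TopologicalSpace H₃] {I₃ : ModelWithCorners ℝ E₃ H₃} {N₃ : Type*}
    [TopologicalSpace N₃] [ChartedSpace H₃ N₃] {h : N₂ → N₃} (hh : ContMDiff I₁ I₃ ∞ (h ∘ f)) :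
    ContMDiff I₂ I₃ ∞ h := by
  intro w
  obtain ⟨O, hO, hw, S, hS, hfS⟩ := hf.exists_localSection w
  refine ((hh.comp_contMDiffOn hS).contMDiffAt (hO.mem_nhds hw)).congr_of_eventuallyEq ?_
  filter_upwards [hO.mem_nhds hw] with y hy
  simp [hfS y hy]

/-- The composition of a fibre bundle projection with a diffeomorphism of the base. -/
theorem comp_diffeomorph {E₃ : Type*} [NormedAddCommGroup E₃] [NormedSpace ℝ E₃]
    {H₃ : Type*} [TopologicalSpace H₃] {I₃ : ModelWithCorners ℝ E₃ H₃} {N₃ : Type*}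
    [TopologicalSpace N₃] [ChartedSpace H₃ N₃] (Ψ : Diffeomorph I₂ I₃ N₂ N₃ ∞) :
    IsSmoothFibration EG I₁ I₃ G (Ψ ∘ f) := by
  intro w
  obtain ⟨O, hO, hz, Θ, hs, ht, hΘ, hΘ', hfst⟩ := hf (Ψ.symm w)
  let Ξ := Ψ.toHomeomorph.prodCongr (Homeomorph.refl G)
  have hΞ : ContMDiff (I₂.prod 𝓘(ℝ, EG)) (I₃.prod 𝓘(ℝ, EG)) ∞ Ξ :=
    Ψ.contMDiff.prodMap contMDiff_id
  have hΞ' : ContMDiff (I₃.prod 𝓘(ℝ, EG)) (I₂.prod 𝓘(ℝ, EG)) ∞ Ξ.symm :=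
    Ψ.symm.contMDiff.prodMap contMDiff_id
  refine ⟨Ψ.symm ⁻¹' O, hO.preimage Ψ.symm.continuous, hz, Θ.transHomeomorph Ξ, ?_, ?_, ?_, ?_, ?_⟩
  · rw [Θ.transHomeomorph_source, hs]
    ext z
    simp
  · rw [Θ.transHomeomorph_target, ht]
    ext z
    simp [Ξ]
  · exact hΞ.comp_contMDiffOn hΘ
  · exact hΘ'.comp hΞ'.contMDiffOn fun z hz => hz
  · intro z hz
    exact congrArg Ψ (hfst z hz)

end IsSmoothFibration

end SmoothFibration

theorem IsPrincipalBundle.isSmoothFibration {EP : Type*} [NormedAddCommGroup EP] [NormedSpace ℝ EP]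
    {EM : Type*} [NormedAddCommGroup EM] [NormedSpace ℝ EM]
    {EG : Type*} [NormedAddCommGroup EG] [NormedSpace ℝ EG]
    {P : Type*} [TopologicalSpace P] [ChartedSpace EP P]
    {M : Type*} [TopologicalSpace M] [ChartedSpace EM M]
    {G : Type*} [TopologicalSpace G] [ChartedSpace EG G] [Group G] [MulAction Gᵐᵒᵖ P]
    {p : P → M} (hp : IsPrincipalBundle EP EM EG (G := G) p) :
    IsSmoothFibration EG 𝓘(ℝ, EP) 𝓘(ℝ, EM) G p := fun x => by
  obtain ⟨U, hU, hx, φ, hs, ht, h1, h2, h3, -⟩ := hp.locally_trivial x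
  exact ⟨U, hU, hx, φ, hs, ht, h1, h2, h3⟩

/-! ### Fibrations are submersions -/

section Submersion

variable {EP : Type*} [NormedAddCommGroup EP] [NormedSpace ℝ EP] [FiniteDimensional ℝ EP]
  {EM : Type*} [NormedAddCommGroup EM] [NormedSpace ℝ EM] [FiniteDimensional ℝ EM]
  {EG : Type*} [NormedAddCommGroup EG] [NormedSpace ℝ EG] [FiniteDimensional ℝ EG]
  {F : Type*} [NormedAddCommGroup F] [NormedSpace ℝ F] 
  {G : Type*} [TopologicalSpace G] [ChartedSpace EG G] [IsManifold 𝓘(ℝ, EG) ∞ G]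
  {N₁ : Type*} [TopologicalSpace N₁] [ChartedSpace (ModelProd EP F) N₁]
  {N₂ : Type*} [TopologicalSpace N₂] [ChartedSpace (ModelProd EM F) N₂]
  [IsManifold (𝓘(ℝ, EP).prod 𝓘(ℝ, F)) ∞ N₁] [IsManifold (𝓘(ℝ, EM).prod 𝓘(ℝ, F)) ∞ N₂]
  {f : N₁ → N₂}

/-- A local trivialization followed by product charts turns `f` into the projection `(EM × F) × EG →
EM × F`. Since `N₁` is modelled on `EP × F`, a linear identification of the model spaces is needed
as well, and the dimension count supplies it. -/
theorem IsSmoothFibration.isSubmersion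
    (hf : IsSmoothFibration EG (𝓘(ℝ, EP).prod 𝓘(ℝ, F)) (𝓘(ℝ, EM).prod 𝓘(ℝ, F)) G f)
    (hd : Nonempty N₁ → Module.finrank ℝ EP = Module.finrank ℝ EM + Module.finrank ℝ EG) :
    IsSubmersion (𝓘(ℝ, EP).prod 𝓘(ℝ, F)) (𝓘(ℝ, EM).prod 𝓘(ℝ, F)) ∞ f := by
  refine IsSubmersionOfComplement.isSubmersion (F := EG) fun z => ?_
  have hd' := hd ⟨z⟩
  rw [← Module.finrank_prod] at hd'
  -- Any linear isomorphism will do: it only relabels the model space.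
  let e : EP ≃L[ℝ] EM × EG := ContinuousLinearEquiv.ofFinrankEq hd'
  let l : (EP × F) ≃L[ℝ] (EM × F) × EG :=
    (e.prodCongr (.refl ℝ F)).trans
      ((ContinuousLinearEquiv.prodAssoc ℝ EM EG F).trans
        (((ContinuousLinearEquiv.refl ℝ EM).prodCongr (.prodComm ℝ EG F)).trans
          (ContinuousLinearEquiv.prodAssoc ℝ EM F EG).symm))
  let l' : ModelProd (ModelProd EM F) EG ≃ₜ ModelProd EP F := l.symm.toHomeomorph
  have hl : ContMDiff ((𝓘(ℝ, EM).prod 𝓘(ℝ, F)).prod 𝓘(ℝ, EG)) (𝓘(ℝ, EP).prod 𝓘(ℝ, F)) ∞ l' :=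
    contMDiff_iff.2 ⟨l'.continuous, fun _ _ => l.symm.contDiff.contDiffOn⟩
  have hl' : ContMDiff (𝓘(ℝ, EP).prod 𝓘(ℝ, F)) ((𝓘(ℝ, EM).prod 𝓘(ℝ, F)).prod 𝓘(ℝ, EG)) ∞
      l'.symm := contMDiff_iff.2 ⟨l'.symm.continuous, fun _ _ => l.contDiff.contDiffOn⟩
  obtain ⟨O, hO, hz, Θ, hs, ht, hΘ, hΘ', hfst⟩ := hf (f z)
  have hz' : z ∈ Θ.source := by rw [hs]; exact hz
  let c := chartAt (ModelProd EM F) (f z)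
  let d := chartAt EG (Θ z).2
  have hcd := IsManifold.mem_maximalAtlas_prod (n := ∞)
    (IsManifold.chart_mem_maximalAtlas (I := 𝓘(ℝ, EM).prod 𝓘(ℝ, F)) (n := ∞) (f z))
    (IsManifold.chart_mem_maximalAtlas (I := 𝓘(ℝ, EG)) (n := ∞) (Θ z).2)
  let Ξ : OpenPartialHomeomorph N₁ (ModelProd EP F) := (Θ.trans (c.prod d)).transHomeomorph l'
  refine IsSubmersionAtOfComplement.mk_of_continuousAt hf.contMDiff.continuous.continuousAt l Ξ c
    ?_ (mem_chart_source _ _) ?_ (IsManifold.chart_mem_maximalAtlas _) ?_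
  · refine ⟨hz', ?_, ?_⟩
    · exact (congrArg (· ∈ c.source) (hfst z hz')).mpr (mem_chart_source _ _)
    · exact mem_chart_source _ _
  · refine OpenPartialHomeomorph.mem_maximalAtlas_of_contMDiffOn _ ?_ ?_
    · exact hl.comp_contMDiffOn ((contMDiffOn_of_mem_maximalAtlas hcd).comp
        (hΘ.mono fun y hy => hy.1) fun y hy => hy.2)
    · exact hΘ'.comp ((contMDiffOn_symm_of_mem_maximalAtlas hcd).comp hl'.contMDiffOn
        fun y hy => hy.1) fun y hy => hy.2
  · intro y hy
    have hy' : y ∈ Ξ.target := hy.2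
    have h1 : l y ∈ (c.prod d).target := hy'.1
    have h2 : (c.prod d).symm (l y) ∈ Θ.target := hy'.2
    have h3 : f (Θ.symm ((c.prod d).symm (l y))) = ((c.prod d).symm (l y)).1 := by
      rw [← hfst _ (Θ.map_target h2), Θ.right_inv h2]
    have h4 : c (c.symm (l y).1) = (l y).1 := c.right_inv h1.1
    exact (congrArg c h3).trans h4

end Submersion

/-! ### The quotient vector bundle as a fibration -/

section Quotient

variable {EP : Type*} [NormedAddCommGroup EP] [NormedSpace ℝ EP]
  {EM : Type*} [NormedAddCommGroup EM] [NormedSpace ℝ EM]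
  {EG : Type*} [NormedAddCommGroup EG] [NormedSpace ℝ EG]
  {P : Type*} [TopologicalSpace P] [ChartedSpace EP P]
  {M : Type*} [TopologicalSpace M] [ChartedSpace EM M]
  {G : Type*} [TopologicalSpace G] [ChartedSpace EG G] [Group G] [MulAction Gᵐᵒᵖ P]
  [LieGroup 𝓘(ℝ, EG) ∞ G]
  {F : Type*} [NormedAddCommGroup F] [NormedSpace ℝ F]
  {p : P → M} {V : SmoothVectorBundle.{_, _, _, vV} EP P F} (ρ : PBGAction EG G V)
  (hp : IsPrincipalBundle EP EM EG (G := G) p)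

/-- Unpacks the choices behind a frame of the quotient: a local section of `P` and a frame of `V`
along it. -/
theorem quotientFrameData_spec (i : (quotientFrameData ρ hp).Idx) :
    ∃ (σ : M → P) (W : Set P) (φ : LocalFrame V W),
      ContMDiffOn 𝓘(ℝ, EM) 𝓘(ℝ, EP) ∞ σ ((quotientFrameData ρ hp).dom i) ∧
      (∀ y ∈ (quotientFrameData ρ hp).dom i, p (σ y) = y) ∧
      (∀ y ∈ (quotientFrameData ρ hp).dom i, σ y ∈ W) ∧
      (∀ y v, (quotientFrameData ρ hp).coord i y v =
        φ.coord (σ y) (ρ.transport (Function.surjInv hp.surjective y) (σ y) v)) ∧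
      ∀ y v, (quotientFrameData ρ hp).inv i y v =
        ρ.transport (σ y) (Function.surjInv hp.surjective y) (φ.inv (σ y) v) := by
  have h := (hp.exists_localSection_localFrame V i).choose_spec.choose_spec.choose_spec.choose_spec
  exact ⟨_, _, (hp.exists_localSection_localFrame V i).choose_spec.choose_spec.choose_spec.choose,
    h.2.2.1, h.2.2.2.1, h.2.2.2.2, fun _ _ => rfl, fun _ _ => rfl⟩

variable [FiniteDimensional ℝ F]

/-- The projection onto the quotient bundle. -/
def quotientProj (u : P) : V.Fib u →ₗ[ℝ] (quotientFrameData ρ hp).toBundle.Fib (p u) :=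
  ρ.transport u (Function.surjInv hp.surjective (p u))

/-- In a frame of the quotient, the projection moves a vector by `div` to the fibre over the local
section and takes its coordinates in the frame of `V` there; both operations are smooth. -/
theorem contMDiff_quotientProj : ContMDiff (𝓘(ℝ, EP).prod 𝓘(ℝ, F)) (𝓘(ℝ, EM).prod 𝓘(ℝ, F)) ∞
    (fun z : V.Total =>
      (⟨p z.1, quotientProj ρ hp z.1 z.2⟩ : (quotientFrameData ρ hp).toBundle.Total)) := by
  intro z₀
  set D := quotientFrameData ρ hp
  set i := D.index (p z₀.1)
  obtain ⟨σ, W, φ, hσ, hpσ, hσW, hc, -⟩ := quotientFrameData_spec ρ hp i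
  obtain ⟨ψ, hψc, hψi⟩ := D.exists_localFrame i
  have hproj : ContMDiff (𝓘(ℝ, EP).prod 𝓘(ℝ, F)) 𝓘(ℝ, EP) ∞ (fun z : V.Total => z.1) :=
    contMDiff_proj V.Fib
  have hpp : ContMDiff (𝓘(ℝ, EP).prod 𝓘(ℝ, F)) 𝓘(ℝ, EM) ∞ (fun z : V.Total => p z.1) :=
    hp.smooth_proj.comp hproj
  set O : Set V.Total := {z | p z.1 ∈ D.dom i}
  have hO : IsOpen O := (D.isOpen_dom i).preimage hpp.continuous
  have hσ' : ContMDiffOn (𝓘(ℝ, EP).prod 𝓘(ℝ, F)) 𝓘(ℝ, EP) ∞ (fun z : V.Total => σ (p z.1)) O :=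
    hσ.comp hpp.contMDiffOn fun z hz => hz
  have hd := hp.contMDiffOn_div hproj.contMDiffOn hσ' fun z hz => (hpσ _ hz).symm
  have ha := ρ.contMDiff_act.comp_contMDiffOn (contMDiffOn_id.prodMk hd)
  have key : ∀ z ∈ O, ρ.act (IsPrincipalBundle.div G z.1 (σ (p z.1))) z =
      ⟨σ (p z.1), ρ.transport (Function.surjInv hp.surjective (p z.1)) (σ (p z.1))
        (quotientProj ρ hp z.1 z.2)⟩ := by
    intro z hz
    have h1 := hpσ _ hz
    have h2 := Function.surjInv_eq hp.surjective (p z.1)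
    have h3 := ρ.transport_transport hp h2.symm (h2.trans h1.symm) z.2
    exact (ρ.mk_transport hp h1.symm z.2).symm.trans (congrArg (TotalSpace.mk _) h3.symm)
  have hco : ContMDiffOn (𝓘(ℝ, EP).prod 𝓘(ℝ, F)) 𝓘(ℝ, F) ∞
      (fun z : V.Total => ψ.coord (p z.1) (quotientProj ρ hp z.1 z.2)) O := by
    refine (φ.smooth_coord.comp ha fun z hz => ?_).congr fun z hz => ?_
    · have h3 := congrArg TotalSpace.proj (key z hz)
      exact (congrArg (· ∈ W) h3).mpr (hσW _ hz)
    · rw [hψc]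
      exact (hc _ _).trans (congrArg (fun z : V.Total => φ.coord z.1 z.2) (key z hz)).symm
  have hz₀ : z₀ ∈ O := D.mem_dom_index _
  refine ((ψ.smooth_inv.comp (hpp.contMDiffOn.prodMk hco) fun z hz => hz).congr
    fun z hz => ?_).contMDiffAt (hO.mem_nhds hz₀)
  exact congrArg (TotalSpace.mk (p z.1)) (ψ.inv_coord _ hz _).symm

/-- A local section `σ` of `P` gives a smooth section of the projection by representing each class
over `σ`. The frame at hand lives over another local section `τ`, and `div` passes from `τ` to `σ`.
-/
theorem contMDiffOn_quotient_lift {U : Set M} {σ : M → P}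
    (hσ : ContMDiffOn 𝓘(ℝ, EM) 𝓘(ℝ, EP) ∞ σ U) (hpσ : ∀ y ∈ U, p (σ y) = y) :
    ContMDiffOn (𝓘(ℝ, EM).prod 𝓘(ℝ, F)) (𝓘(ℝ, EP).prod 𝓘(ℝ, F)) ∞
      (fun w : (quotientFrameData ρ hp).toBundle.Total =>
        (⟨σ w.1, ρ.transport (Function.surjInv hp.surjective w.1) (σ w.1) w.2⟩ : V.Total))
      {w | w.1 ∈ U} := by
  set D := quotientFrameData ρ hp
  intro w₀ hw₀
  set i := D.index w₀.1
  obtain ⟨τ, W, φ, hτ, hpτ, hτW, hc, -⟩ := quotientFrameData_spec ρ hp i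
  obtain ⟨ψ, hψc, hψi⟩ := D.exists_localFrame i
  have hproj : ContMDiff (𝓘(ℝ, EM).prod 𝓘(ℝ, F)) 𝓘(ℝ, EM) ∞ (fun w : D.toBundle.Total => w.1) :=
    contMDiff_proj D.toBundle.Fib
  have hO : IsOpen {w : D.toBundle.Total | w.1 ∈ D.dom i} :=
    (D.isOpen_dom i).preimage hproj.continuous
  set O : Set D.toBundle.Total := {w | w.1 ∈ U} ∩ {w | w.1 ∈ D.dom i}
  have hσ' : ContMDiffOn (𝓘(ℝ, EM).prod 𝓘(ℝ, F)) 𝓘(ℝ, EP) ∞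
      (fun w : D.toBundle.Total => σ w.1) O := hσ.comp hproj.contMDiffOn fun w hw => hw.1
  have hτ' : ContMDiffOn (𝓘(ℝ, EM).prod 𝓘(ℝ, F)) 𝓘(ℝ, EP) ∞
      (fun w : D.toBundle.Total => τ w.1) O := hτ.comp hproj.contMDiffOn fun w hw => hw.2
  have hd := hp.contMDiffOn_div hτ' hσ' fun w hw => (hpτ _ hw.2).trans (hpσ _ hw.1).symm
  have hi := φ.smooth_inv.comp (hτ'.prodMk (ψ.smooth_coord.mono fun w hw => hw.2))
    fun w hw => hτW _ hw.2
  have ha := ρ.contMDiff_act.comp_contMDiffOn (hi.prodMk hd)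
  have hw : ContMDiffWithinAt (𝓘(ℝ, EM).prod 𝓘(ℝ, F)) (𝓘(ℝ, EP).prod 𝓘(ℝ, F)) ∞
      (fun w : D.toBundle.Total =>
        (⟨σ w.1, ρ.transport (Function.surjInv hp.surjective w.1) (σ w.1) w.2⟩ : V.Total))
      O w₀ := by
    refine ha.congr (fun w hw => ?_) w₀ ⟨hw₀, D.mem_dom_index _⟩
    have h1 := hpσ _ hw.1
    have h2 := hpτ _ hw.2
    have h3 := Function.surjInv_eq hp.surjective w.1
    have h4 : φ.inv (τ w.1) (ψ.coord w.1 w.2) =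
        ρ.transport (Function.surjInv hp.surjective w.1) (τ w.1) w.2 := by
      rw [hψc]
      refine (congrArg _ (hc _ _)).trans ?_
      exact φ.inv_coord _ (hτW _ hw.2) _
    have h5 := ρ.mk_transport hp (h2.trans h1.symm) (φ.inv (τ w.1) (ψ.coord w.1 w.2))
    refine Eq.trans (congrArg (TotalSpace.mk _) ?_) h5
    refine Eq.trans ?_ (congrArg (ρ.transport (τ w.1) (σ w.1)) h4).symm
    exact (ρ.transport_transport hp (h3.trans h2.symm) (h2.trans h1.symm) w.2).symm
  exact (contMDiffWithinAt_inter (hO.mem_nhds (D.mem_dom_index _))).1 hw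

include hp in
-- Over the domain of a trivialization `φ` of `P`, a vector corresponds to the pair of its class and
-- the group coordinate of its base point. Conversely, the class is represented over `σ = φ⁻¹(·, 1)`
-- and then translated by the group coordinate.
theorem exists_quotientBundle_aux :
    ∃ (W : SmoothVectorBundle.{_, _, _, vV} EM M F) (nat : ∀ u : P, V.Fib u →ₗ[ℝ] W.Fib (p u)),
      IsSmoothFibration EG (𝓘(ℝ, EP).prod 𝓘(ℝ, F)) (𝓘(ℝ, EM).prod 𝓘(ℝ, F)) G
        (fun z : V.Total => (⟨p z.1, nat z.1 z.2⟩ : W.Total)) ∧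
      ∀ z w : V.Total, (⟨p z.1, nat z.1 z.2⟩ : W.Total) = ⟨p w.1, nat w.1 w.2⟩ ↔
        ∃ g : G, w = ρ.act g z := by
  set s := Function.surjInv hp.surjective
  have hs : ∀ x, p (s x) = x := Function.surjInv_eq hp.surjective
  have hnat := contMDiff_quotientProj ρ hp
  -- Replaces `p u` by a variable `x`, so that fibres over points such as `p (u <• g)` and `p u` can
  -- be compared in the total space.
  have hmk : ∀ (u : P) (x : M) (h : p u = x) (v : V.Fib u),
      (⟨p u, quotientProj ρ hp u v⟩ : (quotientFrameData ρ hp).toBundle.Total) =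
        ⟨x, ρ.transport u (s x) v⟩ := by
    rintro u _ rfl v
    rfl
  refine ⟨(quotientFrameData ρ hp).toBundle, quotientProj ρ hp, fun w₀ => ?_, fun z w => ?_⟩
  · obtain ⟨U, hU, hx, φ, hs', ht, h1, h2, hφp, hφ⟩ := hp.locally_trivial w₀.1
    have hm : ∀ y ∈ U, (y, (1 : G)) ∈ φ.target := fun y hy => by simp [ht, hy]
    let σ : M → P := fun y => φ.symm (y, 1)
    have hσ : ContMDiffOn 𝓘(ℝ, EM) 𝓘(ℝ, EP) ∞ σ U :=
      h2.comp (contMDiffOn_id.prodMk contMDiffOn_const) hm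
    have hpσ : ∀ y ∈ U, p (σ y) = y := fun y hy => by
      rw [← hφp _ (φ.map_target (hm y hy)), φ.right_inv (hm y hy)]
    have hφσ : ∀ y ∈ U, (φ (σ y)).2 = 1 := fun y hy => by
      simp only [σ]
      rw [φ.right_inv (hm y hy)]
    have hlift := contMDiffOn_quotient_lift ρ hp hσ hpσ
    have hproj : ContMDiff (𝓘(ℝ, EM).prod 𝓘(ℝ, F)) 𝓘(ℝ, EM) ∞
        (fun w : (quotientFrameData ρ hp).toBundle.Total => w.1) := contMDiff_proj _
    have hprojV : ContMDiff (𝓘(ℝ, EP).prod 𝓘(ℝ, F)) 𝓘(ℝ, EP) ∞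
        (fun z : V.Total => z.1) := contMDiff_proj _
    let Q : V.Total → (quotientFrameData ρ hp).toBundle.Total := fun z =>
      ⟨p z.1, quotientProj ρ hp z.1 z.2⟩
    let S : (quotientFrameData ρ hp).toBundle.Total → V.Total := fun w =>
      ⟨σ w.1, ρ.transport (s w.1) (σ w.1) w.2⟩
    have hO : IsOpen {w : (quotientFrameData ρ hp).toBundle.Total | w.1 ∈ U} :=
      hU.preimage hproj.continuous
    have hto : ContMDiffOn (𝓘(ℝ, EP).prod 𝓘(ℝ, F)) ((𝓘(ℝ, EM).prod 𝓘(ℝ, F)).prod 𝓘(ℝ, EG)) ∞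
        (fun z : V.Total => (Q z, (φ z.1).2)) {z | p z.1 ∈ U} := by
      refine hnat.contMDiffOn.prodMk (contMDiff_snd.comp_contMDiffOn
        (h1.comp hprojV.contMDiffOn fun z hz => ?_))
      rw [hs']
      exact hz
    have hinv : ContMDiffOn ((𝓘(ℝ, EM).prod 𝓘(ℝ, F)).prod 𝓘(ℝ, EG)) (𝓘(ℝ, EP).prod 𝓘(ℝ, F)) ∞
        (fun y : (quotientFrameData ρ hp).toBundle.Total × G => ρ.act y.2 (S y.1))
        ({w | w.1 ∈ U} ×ˢ univ) :=
      ρ.contMDiff_act.comp_contMDiffOn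
        ((hlift.comp contMDiffOn_fst fun y hy => hy.1).prodMk contMDiffOn_snd)
    have hpa : ∀ (g : G) (z : V.Total), p (ρ.act g z).1 = p z.1 := fun g z => hp.proj_act _ _
    have hQa : ∀ (g : G) (z : V.Total), Q (ρ.act g z) = Q z := fun g z => by
      refine (hmk _ (p z.1) (hpa g z) _).trans (congrArg (TotalSpace.mk _) ?_)
      -- The translate is moved back to `z` by `g⁻¹`, and from there to the chosen fibre.
      refine ρ.transport_eq_of_act hp (g := g⁻¹ * IsPrincipalBundle.div G z.1 (s (p z.1))) ?_
      refine ((ρ.act_act _ _ _).symm.trans (congrArg _ (ρ.act_inv_act g z))).trans ?_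
      exact (ρ.mk_transport hp (hs (p z.1)).symm z.2).symm
    have hQS : ∀ w, w.1 ∈ U → Q (S w) = w := fun w hw => by
      refine (hmk _ w.1 (hpσ _ hw) _).trans (congrArg (TotalSpace.mk _) ?_)
      exact (ρ.transport_transport hp ((hs w.1).trans (hpσ _ hw).symm)
        ((hpσ _ hw).trans (hs w.1).symm) w.2).trans (ρ.transport_self hp _ _)
    refine ⟨{w | w.1 ∈ U}, hO, hx,
      { toFun := fun z => (Q z, (φ z.1).2)
        invFun := fun y => ρ.act y.2 (S y.1)
        source := {z | p z.1 ∈ U}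
        target := {w : (quotientFrameData ρ hp).toBundle.Total | w.1 ∈ U} ×ˢ univ
        map_source' := fun z hz => ⟨hz, mem_univ _⟩
        map_target' := fun y hy => ?_
        left_inv' := fun z hz => ?_
        right_inv' := fun y hy => ?_
        open_source := hU.preimage (hp.smooth_proj.comp hprojV).continuous
        open_target := hO.prod isOpen_univ
        continuousOn_toFun := hto.continuousOn
        continuousOn_invFun := hinv.continuousOn }, rfl, rfl, hto, hinv, fun z _ => rfl⟩
    · change p (ρ.act y.2 (S y.1)).1 ∈ U
      rw [hpa]
      exact (congrArg (· ∈ U) (hpσ _ hy.1)).mpr hy.1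
    · have hpz := hpσ (p z.1) hz
      have h3 : S (Q z) = ρ.act (IsPrincipalBundle.div G z.1 (σ (p z.1))) z := by
        refine Eq.trans ?_ (ρ.mk_transport hp hpz.symm z.2)
        exact congrArg (TotalSpace.mk _)
          (ρ.transport_transport hp (hs (p z.1)).symm ((hs (p z.1)).trans hpz.symm) z.2)
      have h4 : z.1 <• IsPrincipalBundle.div G z.1 (σ (p z.1)) = σ (p z.1) := hp.smul_div hpz.symm
      have h5 := hφ z.1 (by rw [hs']; exact hz) (IsPrincipalBundle.div G z.1 (σ (p z.1)))
      rw [h4] at h5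
      -- The section has group coordinate `1`, so reaching it from `z` means dividing by the group
      -- coordinate of `z`; acting with that coordinate returns to `z`.
      have h6 := (congrArg Prod.snd h5).symm.trans (hφσ _ hz)
      have h7 : IsPrincipalBundle.div G z.1 (σ (p z.1)) = (φ z.1).2⁻¹ :=
        eq_inv_of_mul_eq_one_right h6
      change ρ.act (φ z.1).2 (S (Q z)) = z
      rw [h3, h7, ρ.act_act, inv_mul_cancel, ρ.act_one']
    · refine Prod.ext ?_ ?_
      · change Q (ρ.act y.2 (S y.1)) = y.1
        rw [hQa, hQS _ hy.1]
      · have h3 : σ y.1.1 ∈ φ.source := φ.map_target (hm _ hy.1)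
        have h4 := congrArg Prod.snd (hφ (σ y.1.1) h3 y.2)
        refine h4.trans ?_
        change (φ (σ y.1.1)).2 * y.2 = y.2
        rw [hφσ _ hy.1, one_mul]
  · constructor
    · intro h
      have h1 : p z.1 = p w.1 := congrArg TotalSpace.proj h
      have h2 := (hmk z.1 (p w.1) h1 z.2).symm.trans h
      have h3 : ρ.transport z.1 (s (p w.1)) z.2 = ρ.transport w.1 (s (p w.1)) w.2 :=
        TotalSpace.mk_injective (F := F) (E := (quotientFrameData ρ hp).toBundle.Fib) (p w.1) h2
      have h4 := congrArg (ρ.transport (s (p w.1)) w.1) h3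
      rw [ρ.transport_transport hp (h1.trans (hs _).symm) (hs _),
        ρ.transport_transport hp (hs _).symm (hs _), ρ.transport_self hp] at h4
      have h5 := ρ.mk_transport hp h1 z.2
      rw [h4] at h5
      exact ⟨_, h5⟩
    · rintro ⟨g, rfl⟩
      refine Eq.symm ((hmk _ (p z.1) (hp.proj_act _ _) _).trans (congrArg (TotalSpace.mk _) ?_))
      refine ρ.transport_eq_of_act hp (g := g⁻¹ * IsPrincipalBundle.div G z.1 (s (p z.1))) ?_
      refine ((ρ.act_act _ _ _).symm.trans (congrArg _ (ρ.act_inv_act g z))).trans ?_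
      exact (ρ.mk_transport hp (hs (p z.1)).symm z.2).symm

omit [LieGroup 𝓘(ℝ, EG) ∞ G] in
include hp in
theorem IsPrincipalBundle.finrank_eq [FiniteDimensional ℝ EM] [FiniteDimensional ℝ EG] (u : P) :
    Module.finrank ℝ EP = Module.finrank ℝ EM + Module.finrank ℝ EG := by
  obtain ⟨U, hU, hx, φ, hs, ht, h1, h2, -⟩ := hp.locally_trivial (p u)
  have hφ : φ.MDifferentiable 𝓘(ℝ, EP) (𝓘(ℝ, EM).prod 𝓘(ℝ, EG)) :=
    ⟨h1.mdifferentiableOn (by simp), h2.mdifferentiableOn (by simp)⟩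
  let e : EP ≃ₗ[ℝ] EM × EG := (hφ.mfderiv (x := u) (by rw [hs]; exact hx)).toLinearEquiv
  rw [e.finrank_eq, Module.finrank_prod]

include hp in
/-- The quotient of a vector bundle by an action of the structure group. -/
theorem exists_quotientBundle [FiniteDimensional ℝ EP] [FiniteDimensional ℝ EM]
    [FiniteDimensional ℝ EG] [IsManifold 𝓘(ℝ, EP) ∞ P] [IsManifold 𝓘(ℝ, EM) ∞ M] :
    ∃ (W : SmoothVectorBundle.{_, _, _, vV} EM M F) (nat : ∀ u : P, V.Fib u →ₗ[ℝ] W.Fib (p u)),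
      IsQuotientBundle EG p ρ W nat ∧
      IsSmoothFibration EG (𝓘(ℝ, EP).prod 𝓘(ℝ, F)) (𝓘(ℝ, EM).prod 𝓘(ℝ, F)) G
        (fun z : V.Total => (⟨p z.1, nat z.1 z.2⟩ : W.Total)) := by
  obtain ⟨W, nat, h1, h2⟩ := exists_quotientBundle_aux ρ hp
  exact ⟨W, nat, ⟨h1.isSubmersion fun ⟨z⟩ => hp.finrank_eq z.1, h1.surjective, h2⟩, h1⟩

end Quotient

/-! ### Equivariant sections and the quotient Lie algebroid -/

section Quotient

variable {EP : Type*} [NormedAddCommGroup EP] [NormedSpace ℝ EP]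
  {EM : Type*} [NormedAddCommGroup EM] [NormedSpace ℝ EM]
  {EG : Type*} [NormedAddCommGroup EG] [NormedSpace ℝ EG]
  {P : Type*} [TopologicalSpace P] [ChartedSpace EP P]
  {M : Type*} [TopologicalSpace M] [ChartedSpace EM M]
  {G : Type*} [TopologicalSpace G] [ChartedSpace EG G] [Group G] [MulAction Gᵐᵒᵖ P]
  {F : Type*} [NormedAddCommGroup F] [NormedSpace ℝ F]
  {p : P → M} {V : SmoothVectorBundle EP P F} {ρ : PBGAction EG G V}
  {W : SmoothVectorBundle EM M F} {nat : ∀ u : P, V.Fib u →ₗ[ℝ] W.Fib (p u)}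

theorem SmoothVectorBundle.mk_inj {x : P} {v w : V.Fib x} (h : (⟨x, v⟩ : V.Total) = ⟨x, w⟩) :
    v = w :=
  TotalSpace.mk_injective x h

/-- Descent of invariant families along a principal bundle. -/
theorem IsPrincipalBundle.exists_descent (hp : IsPrincipalBundle EP EM EG (G := G) p)
    (F' : Type*) {T : M → Type*} (f : ∀ u, T (p u))
    (hf : ∀ (g : G) u, (⟨p (u <• g), f (u <• g)⟩ : TotalSpace F' T) = ⟨p u, f u⟩) :
    ∃ f' : ∀ x, T x, ∀ u, f' (p u) = f u := by
  have h : ∀ x, ∃ t : T x, ∀ u, p u = x → (⟨p u, f u⟩ : TotalSpace F' T) = ⟨x, t⟩ := by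
    intro x
    obtain ⟨u₀, rfl⟩ := hp.surjective x
    refine ⟨f u₀, fun u hu => ?_⟩
    obtain ⟨g, rfl⟩ := hp.exists_eq_smul hu.symm
    exact hf g u₀
  choose f' hf' using h
  exact ⟨f', fun u => (TotalSpace.mk_injective (F := F') (E := T) _ (hf' _ u rfl)).symm⟩

namespace IsQuotientBundle

variable (hQ : IsQuotientBundle EG p ρ W nat)

include hQ

theorem mk_nat_act (g : G) (z : V.Total) :
    (⟨p (ρ.act g z).1, nat (ρ.act g z).1 (ρ.act g z).2⟩ : W.Total) = ⟨p z.1, nat z.1 z.2⟩ :=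
  ((hQ.orbits z _).2 ⟨g, rfl⟩).symm

variable (hp : IsPrincipalBundle EP EM EG (G := G) p)

include hp

/-- Two vectors over `u` with the same class differ by a group element that fixes `u`, and this
element is `1` by freeness. -/
theorem injective_nat (u : P) : Function.Injective (nat u) := by
  intro v v' h
  obtain ⟨g, hg⟩ := (hQ.orbits ⟨u, v⟩ ⟨u, v'⟩).1 (congrArg (TotalSpace.mk _) h)
  have h1 : u = u <• g := congrArg TotalSpace.proj hg
  have h2 := hp.eq_one_of_smul_eq h1.symm
  rw [h2, ρ.act_one'] at hg
  exact (V.mk_inj hg).symm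

/-- A representative may lie over another point of the orbit of `u`; a translation brings it over
`u`. -/
theorem surjective_nat (u : P) : Function.Surjective (nat u) := by
  intro w
  obtain ⟨z, hz⟩ := hQ.surjective ⟨p u, w⟩
  have h1 : p z.1 = p u := congrArg TotalSpace.proj hz
  obtain ⟨g, rfl⟩ := hp.exists_eq_smul h1
  exact ⟨ρ.R g z.1 z.2, W.mk_inj ((hQ.mk_nat_act g z).trans hz)⟩

/-- The projection onto the quotient bundle identifies the fibre over `u` with that over `p u`. -/
def equiv (u : P) : V.Fib u ≃ₗ[ℝ] W.Fib (p u) :=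
  LinearEquiv.ofBijective (nat u) ⟨hQ.injective_nat hp u, hQ.surjective_nat hp u⟩

theorem nat_equiv_symm (u : P) (w : W.Fib (p u)) : nat u ((hQ.equiv hp u).symm w) = w :=
  (hQ.equiv hp u).apply_symm_apply w

/-- Descent of invariant fibrewise linear maps to a quotient bundle. -/
theorem exists_descent (F' : Type*) {T : M → Type*} [∀ x, AddCommGroup (T x)]
    [∀ x, Module ℝ (T x)] (ψ : ∀ u, V.Fib u →ₗ[ℝ] T (p u))
    (hψ : ∀ (g : G) u v, (⟨p (u <• g), ψ (u <• g) (ρ.R g u v)⟩ : TotalSpace F' T) =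
      ⟨p u, ψ u v⟩) :
    ∃ ψ' : ∀ x, W.Fib x →ₗ[ℝ] T x, ∀ u v, ψ' (p u) (nat u v) = ψ u v := by
  -- `L` is built from a single point `u₀` over `x`; its characterization by all representatives of
  -- a class removes this choice.
  have h : ∀ x, ∃ L : W.Fib x →ₗ[ℝ] T x, ∀ u v w, (⟨p u, nat u v⟩ : W.Total) = ⟨x, w⟩ →
      (⟨p u, ψ u v⟩ : TotalSpace F' T) = ⟨x, L w⟩ := by
    intro x
    obtain ⟨u₀, rfl⟩ := hp.surjective x
    refine ⟨ψ u₀ ∘ₗ (hQ.equiv hp u₀).symm.toLinearMap, fun u v w h => ?_⟩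
    obtain ⟨v₀, rfl⟩ := hQ.surjective_nat hp u₀ w
    obtain ⟨g, hg⟩ := (hQ.orbits ⟨u, v⟩ ⟨u₀, v₀⟩).1 h
    have h1 := congrArg (fun z : V.Total => (⟨p z.1, ψ z.1 z.2⟩ : TotalSpace F' T)) hg
    refine (hψ g u v).symm.trans (h1.symm.trans ?_)
    exact congrArg (fun v => (⟨p u₀, ψ u₀ v⟩ : TotalSpace F' T))
      ((hQ.equiv hp u₀).symm_apply_apply v₀).symm
  choose ψ' hψ' using h
  exact ⟨ψ', fun u v => (TotalSpace.mk_injective (F := F') (E := T) _ (hψ' _ u v _ rfl)).symm⟩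

omit hQ in
theorem eq_of_pull {X' Y' : W.Sections} (h : ∀ u, X' (p u) = Y' (p u)) : X' = Y' := by
  ext x
  obtain ⟨u, rfl⟩ := hp.surjective x
  exact h u

/-- Both sides are vectors over `u <• g` with the same class, and `nat` is injective on fibres. -/
theorem equivariant_of_pull {X : ∀ u, V.Fib u} {X' : ∀ x, W.Fib x}
    (h : ∀ u, nat u (X u) = X' (p u)) (g : G) (u : P) : X (u <• g) = ρ.R g u (X u) := by
  apply hQ.injective_nat hp
  rw [h]
  refine W.mk_inj (Eq.trans ?_ (hQ.mk_nat_act g ⟨u, X u⟩).symm)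
  refine Eq.trans ?_ (congrArg (TotalSpace.mk (p u)) (h u)).symm
  exact congrArg (fun x => (⟨x, X' x⟩ : W.Total)) (hp.proj_act u g)

variable [LieGroup 𝓘(ℝ, EG) ∞ G]
  (hfib : IsSmoothFibration EG (𝓘(ℝ, EP).prod 𝓘(ℝ, F)) (𝓘(ℝ, EM).prod 𝓘(ℝ, F)) G
  (fun z : V.Total => (⟨p z.1, nat z.1 z.2⟩ : W.Total)))

include hfib

/-- The inverse of `nat` is taken pointwise, so smoothness needs an argument: a local section of the
fibration gives a smooth representative over some point of the orbit of `u`, and `div` moves it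
smoothly to `u`. -/
theorem contMDiff_pull {X' : ∀ x, W.Fib x}
    (hX' : ContMDiff 𝓘(ℝ, EM) (𝓘(ℝ, EM).prod 𝓘(ℝ, F)) ∞ (fun x => (⟨x, X' x⟩ : W.Total))) :
    ContMDiff 𝓘(ℝ, EP) (𝓘(ℝ, EP).prod 𝓘(ℝ, F)) ∞
      (fun u => (⟨u, (hQ.equiv hp u).symm (X' (p u))⟩ : V.Total)) := by
  intro u₀
  have : Nonempty G := ⟨1⟩
  obtain ⟨O, hO, hw, S, hS, hQS⟩ := hfib.exists_localSection ⟨p u₀, X' (p u₀)⟩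
  have hX := hX'.comp hp.smooth_proj
  set U : Set P := (fun u => (⟨p u, X' (p u)⟩ : W.Total)) ⁻¹' O
  have hU : IsOpen U := hO.preimage hX.continuous
  have hSX : ContMDiffOn 𝓘(ℝ, EP) (𝓘(ℝ, EP).prod 𝓘(ℝ, F)) ∞
      (fun u => S ⟨p u, X' (p u)⟩) U := hS.comp hX.contMDiffOn fun u hu => hu
  have h1 : ∀ u ∈ U, p (S ⟨p u, X' (p u)⟩).1 = p u := fun u hu =>
    congrArg TotalSpace.proj (hQS _ hu)
  have hd := hp.contMDiffOn_div ((contMDiff_proj V.Fib).comp_contMDiffOn hSX) contMDiffOn_id h1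
  refine ((ρ.contMDiff_act.comp_contMDiffOn (hSX.prodMk hd)).congr fun u hu => ?_).contMDiffAt
    (hU.mem_nhds hw)
  have h2 := hQS _ hu
  refine (Eq.trans ?_ (ρ.mk_transport hp (h1 u hu) _)).trans rfl
  refine congrArg (TotalSpace.mk u) (hQ.injective_nat hp u ?_)
  rw [hQ.nat_equiv_symm]
  refine W.mk_inj (h2.symm.trans ?_)
  refine (hQ.mk_nat_act (IsPrincipalBundle.div G (S ⟨p u, X' (p u)⟩).1 u) _).symm.trans ?_
  exact congrArg (fun z : V.Total => (⟨p z.1, nat z.1 z.2⟩ : W.Total))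
    (ρ.mk_transport hp (h1 u hu) _).symm

/-- The invariant section of `V` which corresponds to a section of the quotient bundle. -/
def pull : W.Sections →ₗ[ℝ] V.Sections where
  toFun X' := ⟨fun u => (hQ.equiv hp u).symm (X' (p u)), hQ.contMDiff_pull hp hfib X'.contMDiff⟩
  map_add' X' Y' := by
    ext u
    exact map_add (hQ.equiv hp u).symm _ _
  map_smul' c X' := by
    ext u
    exact map_smul (hQ.equiv hp u).symm _ _

theorem nat_pull (X' : W.Sections) (u : P) : nat u (hQ.pull hp hfib X' u) = X' (p u) :=
  hQ.nat_equiv_symm hp u _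

omit hQ [LieGroup 𝓘(ℝ, EG) ∞ G] in
-- The converse of `pull`: values of an equivariant section have a class depending only on `p u`,
-- and smoothness on `M` is tested after composing with `p`.
theorem exists_push (hQ : IsQuotientBundle EG p ρ W nat) (X : V.Sections)
    (hX : ∀ (g : G) u, X (u <• g) = ρ.R g u (X u)) :
    ∃ X' : W.Sections, ∀ u, X' (p u) = nat u (X u) := by
  obtain ⟨X', hX'⟩ := hp.exists_descent F (T := W.Fib) (fun u => nat u (X u)) fun g u => by
    rw [hX]
    exact hQ.mk_nat_act g ⟨u, X u⟩
  refine ⟨⟨X', ?_⟩, hX'⟩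
  have : Nonempty G := ⟨1⟩
  refine hp.isSmoothFibration.contMDiff_of_comp ((hfib.contMDiff.comp X.contMDiff).congr fun u => ?_)
  exact congrArg (TotalSpace.mk (p u)) (hX' u)

end IsQuotientBundle

variable [LieGroup 𝓘(ℝ, EG) ∞ G]
variable [IsManifold 𝓘(ℝ, EP) ∞ P] [IsManifold 𝓘(ℝ, EM) ∞ M]
  [FiniteDimensional ℝ EP] [FiniteDimensional ℝ EM] [FiniteDimensional ℝ EG]
  [FiniteDimensional ℝ F]

/-- The quotient Lie algebroid of a PBG-algebroid. -/
theorem exists_quotientLieAlgebroid (hp : IsPrincipalBundle EP EM EG (G := G) p)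
    {A : LieAlgebroid.{_, _, _, vV} EP P F} {ρ : PBGAction EG G A.toSmoothVectorBundle}
    (hA : IsPBGAlgebroid EG A ρ) :
    ∃ (B : LieAlgebroid.{_, _, _, vV} EM M F) (nat : ∀ u : P, A.Fib u →ₗ[ℝ] B.Fib (p u)),
      IsQuotientLieAlgebroid EG p A ρ B nat ∧
      IsSmoothFibration EG (𝓘(ℝ, EP).prod 𝓘(ℝ, F)) (𝓘(ℝ, EM).prod 𝓘(ℝ, F)) G
        (fun z : A.Total => (⟨p z.1, nat z.1 z.2⟩ : B.Total)) := by
  have := FiniteDimensional.complete ℝ EP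
  have := FiniteDimensional.complete ℝ EM
  have : Nonempty G := ⟨1⟩
  obtain ⟨W, nat, hQ, hfib⟩ := exists_quotientBundle ρ hp
  have hTp : ContMDiff 𝓘(ℝ, EP).tangent 𝓘(ℝ, EM).tangent ∞ (tangentMap 𝓘(ℝ, EP) 𝓘(ℝ, EM) p) :=
    hp.smooth_proj.contMDiff_tangentMap (by simp)
  obtain ⟨r, hr⟩ := hQ.exists_descent hp EM (T := fun x : M => TangentSpace 𝓘(ℝ, EM) x)
    (fun u => (mfderiv 𝓘(ℝ, EP) 𝓘(ℝ, EM) p u).toLinearMap ∘ₗ A.anchor u) fun g u v => by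
      refine TotalSpace.ext (hp.proj_act u g) (heq_of_eq ?_)
      exact (congrArg (mfderiv 𝓘(ℝ, EP) 𝓘(ℝ, EM) p (u <• g)) (hA.anchor g u v)).trans
        (hp.mfderiv_proj_smul g u (A.anchor u v))
  have hrs : ContMDiff (𝓘(ℝ, EM).prod 𝓘(ℝ, F)) 𝓘(ℝ, EM).tangent ∞
      (fun z : W.Total => (⟨z.1, r z.1 z.2⟩ : TangentBundle 𝓘(ℝ, EM) M)) := by
    refine hfib.contMDiff_of_comp ((hTp.comp A.smooth_anchor).congr fun z => ?_)
    exact congrArg (TotalSpace.mk (p z.1)) (hr z.1 z.2)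
  -- Pulled back sections are equivariant, hence so is their bracket, which therefore descends.
  have hbr : ∀ X' Y' : W.Sections, ∃ Z' : W.Sections, ∀ u, Z' (p u) =
      nat u (A.bracket (hQ.pull hp hfib X') (hQ.pull hp hfib Y') u) := fun X' Y' =>
    IsQuotientBundle.exists_push hp hfib hQ _ fun g u => hA.bracket g _ _ _ _
      (hQ.equivariant_of_pull hp (hQ.nat_pull hp hfib X') g)
      (hQ.equivariant_of_pull hp (hQ.nat_pull hp hfib Y') g) u
  choose br hbr using hbr
  have hrel : ∀ (X' : W.Sections) (u : P), mfderiv 𝓘(ℝ, EP) 𝓘(ℝ, EM) p u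
      (A.anchor u (hQ.pull hp hfib X' u)) = r (p u) (X' (p u)) := fun X' u =>
    (hr u _).symm.trans (congrArg (r (p u)) (hQ.nat_pull hp hfib X' u))
  -- `pull` respects brackets and is injective, so bilinearity, alternation and Jacobi are inherited
  -- from `A`.
  have hbp : ∀ X' Y', hQ.pull hp hfib (br X' Y') =
      A.bracket (hQ.pull hp hfib X') (hQ.pull hp hfib Y') := by
    intro X' Y'
    ext u
    apply hQ.injective_nat hp
    rw [hQ.nat_pull hp hfib]
    exact hbr X' Y' u
  have hinj : ∀ X' Y', hQ.pull hp hfib X' = hQ.pull hp hfib Y' → X' = Y' := fun X' Y' h =>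
    IsQuotientBundle.eq_of_pull hp fun u => by
      rw [← hQ.nat_pull hp hfib X' u, ← hQ.nat_pull hp hfib Y' u, h]
  let B : LieAlgebroid.{_, _, _, vV} EM M F :=
    { toSmoothVectorBundle := W
      anchor := r
      smooth_anchor := hrs
      bracket := LinearMap.mk₂ ℝ br
        (fun X X' Y => hinj _ _ (by simp [hbp])) (fun c X Y => hinj _ _ (by simp [hbp]))
        (fun X Y Y' => hinj _ _ (by simp [hbp])) (fun c X Y => hinj _ _ (by simp [hbp]))
      bracket_self := fun X => hinj _ _ (by simp [hbp, A.bracket_self])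
      jacobi := fun X Y Z => hinj _ _ (by simp [hbp, A.jacobi])
      anchor_bracket := fun X Y x => by
        obtain ⟨u, rfl⟩ := hp.surjective x
        have hs : ∀ (Z : A.Sections), MDiffAt (T% fun y => A.anchor y (Z y)) u := fun Z =>
          (A.smooth_anchor.comp Z.contMDiff).mdifferentiable (by simp) u
        have hs' : ∀ (Z : W.Sections), MDiffAt (T% fun y => r y (Z y)) (p u) := fun Z =>
          (hrs.comp Z.contMDiff).mdifferentiable (by simp) (p u)
        -- By `hrel` the anchors of pulled back sections are `p`-related to the anchors downstairs,
        -- so their brackets are as well.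
        refine Eq.trans ?_ (mfderiv_mlieBracket_of_related hp.smooth_proj
          (hs (hQ.pull hp hfib X)) (hs (hQ.pull hp hfib Y)) (hs' X) (hs' Y) (hrel X) (hrel Y))
        refine (congrArg (r (p u)) (hbr X Y u)).trans ((hr u _).trans ?_)
        exact congrArg (mfderiv 𝓘(ℝ, EP) 𝓘(ℝ, EM) p u) (A.anchor_bracket _ _ u)
      leibniz := fun X Y f x => by
        obtain ⟨u, rfl⟩ := hp.surjective x
        -- Upstairs `f` becomes `f ∘ p`; by the chain rule its derivative along the anchor of `A` is
        -- that of `f` along `r`.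
        have h1 : hQ.pull hp hfib (W.smulSection f Y) = A.smulSection
            (f.comp ⟨p, hp.smooth_proj⟩) (hQ.pull hp hfib Y) := by
          ext u
          exact map_smul (hQ.equiv hp u).symm _ _
        have h2 := congrArg (nat u) (A.leibniz (hQ.pull hp hfib X) (hQ.pull hp hfib Y)
          (f.comp ⟨p, hp.smooth_proj⟩) u)
        rw [← h1, ← hbr, map_add, map_smul, map_smul, ← hbr, hQ.nat_pull hp hfib] at h2
        refine h2.trans ?_
        have h3 := mvfderiv_comp_apply (𝕜 := ℝ) (g := f) (f := p) u
          (f.contMDiff.mdifferentiable (by simp) _)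
          (hp.smooth_proj.mdifferentiable (by simp) _) (A.anchor u (hQ.pull hp hfib X u))
        exact congrArg (fun c : ℝ => f (p u) • br X Y (p u) + c • Y (p u))
          (h3.trans (congrArg _ (hrel X u))) }
  refine ⟨B, nat, ⟨hQ, hr, fun X Y X' Y' hX hY u => ?_⟩, hfib⟩
  have hX' : hQ.pull hp hfib X' = X := by
    ext u
    exact hQ.injective_nat hp u ((hQ.nat_pull hp hfib X' u).trans (hX u).symm)
  have hY' : hQ.pull hp hfib Y' = Y := by
    ext u
    exact hQ.injective_nat hp u ((hQ.nat_pull hp hfib Y' u).trans (hY u).symm)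
  refine Eq.trans ?_ (hbr X' Y' u).symm
  rw [hX', hY']

end Quotient

/-! ### Transported manifold structures -/

section Transfer

variable {E : Type*} [NormedAddCommGroup E] [NormedSpace ℝ E] {H : Type*} [TopologicalSpace H]
  (I : ModelWithCorners ℝ E H) {N : Type*} [TopologicalSpace N] [ChartedSpace H N]
  {X : Type*} [TopologicalSpace X]

/-- The charted space structure transported along a homeomorphism. -/
abbrev transferChartedSpace (e : X ≃ₜ N) : ChartedSpace H X where
  atlas := (fun c : OpenPartialHomeomorph N H => e.transOpenPartialHomeomorph c) '' atlas H N
  chartAt x := e.transOpenPartialHomeomorph (chartAt H (e x))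
  mem_chart_source x := mem_chart_source H (e x)
  chart_mem_atlas x := mem_image_of_mem _ (chart_mem_atlas H (e x))

/-- A manifold structure can be transported along a homeomorphism, which becomes a
diffeomorphism. -/
theorem exists_diffeomorph_of_homeomorph [IsManifold I ∞ N] (e : X ≃ₜ N) :
    ∃ _ : ChartedSpace H X, IsManifold I ∞ X ∧ ∃ Ψ : Diffeomorph I I X N ∞, ∀ x, Ψ x = e x := by
  let cs : ChartedSpace H X := transferChartedSpace e
  -- The transported atlas has the same chart changes as the original one.
  have hc : ∀ c c' : OpenPartialHomeomorph N H,
      (e.transOpenPartialHomeomorph c).symm.trans (e.transOpenPartialHomeomorph c') =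
        c.symm.trans c' := by
    intro c c'
    refine OpenPartialHomeomorph.ext _ _ (fun x => ?_) (fun x => ?_) ?_
    · simp
    · simp
    · ext x
      simp
  have : HasGroupoid X (contDiffGroupoid ∞ I) := ⟨by
    rintro _ _ ⟨c, hc1, rfl⟩ ⟨c', hc2, rfl⟩
    rw [hc]
    exact HasGroupoid.compatible hc1 hc2⟩
  have hm : IsManifold I ∞ X := ⟨⟩
  refine ⟨cs, hm, ⟨e.toEquiv, fun x => ?_, fun y => ?_⟩, fun x => rfl⟩
  · have h1 : ContMDiffOn I I ∞ _ (chartAt H x).source := contMDiffOn_chart (x := x)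
    have h2 : ContMDiffOn I I ∞ _ (chartAt H (e x)).target := contMDiffOn_chart_symm (x := e x)
    refine ((h2.comp h1 fun z hz => (chartAt H x).map_source hz).congr fun z hz => ?_).contMDiffAt
      ((chartAt H x).open_source.mem_nhds (mem_chart_source H x))
    exact ((chartAt H (e x)).left_inv hz).symm
  · obtain ⟨x, rfl⟩ := e.surjective y
    have h1 : ContMDiffOn I I ∞ _ (chartAt H (e x)).source := contMDiffOn_chart (x := e x)
    have h2 : ContMDiffOn I I ∞ _ (chartAt H x).target := contMDiffOn_chart_symm (x := x)
    refine ((h2.comp h1 fun z hz => (chartAt H (e x)).map_source hz).congr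
      fun z hz => ?_).contMDiffAt
      ((chartAt H (e x)).open_source.mem_nhds (mem_chart_source H (e x)))
    exact (congrArg e.symm ((chartAt H (e x)).left_inv hz)).symm

end Transfer

/-! ### Topology of total spaces -/

section Total

variable {B : Type*} [TopologicalSpace B] {F : Type*} [TopologicalSpace F] {V : B → Type*}
  [TopologicalSpace (TotalSpace F V)] [∀ x, TopologicalSpace (V x)] [FiberBundle F V]

/-- Points of one fibre are separated in a trivialization, points of different fibres in the base.
-/
theorem t2Space_totalSpace [T2Space B] [T2Space F] : T2Space (TotalSpace F V) := by
  refine ⟨fun z w hzw => ?_⟩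
  have hcont : Continuous (TotalSpace.proj : TotalSpace F V → B) := FiberBundle.continuous_proj F V
  by_cases h : z.1 = w.1
  · set e := trivializationAt F V z.1
    have hz : z ∈ e.source := FiberBundle.mem_trivializationAt_proj_source
    have hw : w ∈ e.source := by
      rw [e.mem_source, ← h]
      exact FiberBundle.mem_baseSet_trivializationAt F V z.1
    have hne : e z ≠ e w := fun h' => hzw (e.injOn hz hw h')
    obtain ⟨O, O', hO, hO', h1, h2, hd⟩ := t2_separation hne
    refine ⟨_, _, e.continuousOn.isOpen_inter_preimage e.open_source hO,
      e.continuousOn.isOpen_inter_preimage e.open_source hO', ⟨hz, h1⟩, ⟨hw, h2⟩, ?_⟩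
    exact (hd.preimage e).mono inter_subset_right inter_subset_right
  · obtain ⟨O, O', hO, hO', h1, h2, hd⟩ := t2_separation h
    exact ⟨_, _, hO.preimage hcont, hO'.preimage hcont, h1, h2, hd.preimage _⟩

theorem secondCountableTopology_totalSpace [SecondCountableTopology B]
    [SecondCountableTopology F] : SecondCountableTopology (TotalSpace F V) := by
  obtain ⟨s, hs, hU⟩ := TopologicalSpace.countable_cover_nhds fun x : B =>
    (trivializationAt F V x).open_baseSet.mem_nhds (FiberBundle.mem_baseSet_trivializationAt F V x)
  have := hs.toEncodable
  have : ∀ x : s, SecondCountableTopology (trivializationAt F V (x : B)).source := fun x =>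
    (trivializationAt F V (x : B)).toOpenPartialHomeomorph.secondCountableTopology_source
  refine TopologicalSpace.secondCountableTopology_of_countable_cover
    (U := fun x : s => (trivializationAt F V (x : B)).source)
    (fun x => (trivializationAt F V (x : B)).open_source) ?_
  refine eq_univ_of_forall fun z => ?_
  have hz : z.1 ∈ ⋃ x ∈ s, (trivializationAt F V x).baseSet := by
    rw [hU]
    exact mem_univ _
  simp only [mem_iUnion] at hz ⊢
  obtain ⟨x, hx, hzx⟩ := hz
  exact ⟨⟨x, hx⟩, (trivializationAt F V x).mem_source.2 hzx⟩

end Total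

/-! ### The orbit space as a manifold, and the action on `TP` -/

section Orbit

variable {EP : Type*} [NormedAddCommGroup EP] [NormedSpace ℝ EP]
  {EM : Type*} [NormedAddCommGroup EM] [NormedSpace ℝ EM]
  {EG : Type*} [NormedAddCommGroup EG] [NormedSpace ℝ EG]
  {P : Type*} [TopologicalSpace P] [ChartedSpace EP P]
  {M : Type*} [TopologicalSpace M] [ChartedSpace EM M]
  {G : Type*} [TopologicalSpace G] [ChartedSpace EG G] [Group G] [MulAction Gᵐᵒᵖ P]
  [LieGroup 𝓘(ℝ, EG) ∞ G] [IsManifold 𝓘(ℝ, EP) ∞ P] [IsManifold 𝓘(ℝ, EM) ∞ M]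
  [FiniteDimensional ℝ EP] [FiniteDimensional ℝ EM] [FiniteDimensional ℝ EG]
  {F : Type*} [NormedAddCommGroup F] [NormedSpace ℝ F] [FiniteDimensional ℝ F]
  {p : P → M} {V : SmoothVectorBundle EP P F} {ρ : PBGAction EG G V}
  {W : SmoothVectorBundle EM M F} {nat : ∀ u : P, V.Fib u →ₗ[ℝ] W.Fib (p u)}

/-- The manifold structure of the orbit space. -/
theorem IsQuotientBundle.exists_orbitSpace_manifold [T2Space M] [SecondCountableTopology M]
    (hQ : IsQuotientBundle EG p ρ W nat) (hp : IsPrincipalBundle EP EM EG (G := G) p)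
    (hfib : IsSmoothFibration EG (𝓘(ℝ, EP).prod 𝓘(ℝ, F)) (𝓘(ℝ, EM).prod 𝓘(ℝ, F)) G
      (fun z : V.Total => (⟨p z.1, nat z.1 z.2⟩ : W.Total))) :
    ∃ _ : ChartedSpace (ModelProd EM F) ρ.OrbitSpace,
      IsManifold (𝓘(ℝ, EM).prod 𝓘(ℝ, F)) ∞ ρ.OrbitSpace ∧
      T2Space ρ.OrbitSpace ∧ SecondCountableTopology ρ.OrbitSpace ∧
      IsSubmersion (𝓘(ℝ, EP).prod 𝓘(ℝ, F)) (𝓘(ℝ, EM).prod 𝓘(ℝ, F)) ∞ ρ.toOrbit ∧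
      ∃ Ψ : Diffeomorph (𝓘(ℝ, EM).prod 𝓘(ℝ, F)) (𝓘(ℝ, EM).prod 𝓘(ℝ, F))
          ρ.OrbitSpace W.Total ∞, ∀ z : V.Total, Ψ (ρ.toOrbit z) = ⟨p z.1, nat z.1 z.2⟩ := by
  have : Nonempty G := ⟨1⟩
  have : ProperSpace F := FiniteDimensional.proper ℝ F
  let f : ρ.OrbitSpace → W.Total := Quotient.lift
    (fun z : V.Total => (⟨p z.1, nat z.1 z.2⟩ : W.Total)) fun z w h => (hQ.orbits z w).2 h
  have hf : Function.Bijective f := by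
    refine ⟨?_, fun w => ?_⟩
    · rintro ⟨z⟩ ⟨w⟩ h
      exact Quotient.sound ((hQ.orbits z w).1 h)
    · obtain ⟨z, hz⟩ := hQ.surjective w
      exact ⟨ρ.toOrbit z, hz⟩
  let e : ρ.OrbitSpace ≃ₜ W.Total :=
    { Equiv.ofBijective f hf with
      continuous_toFun := hfib.contMDiff.continuous.quotient_lift _
      continuous_invFun := by
        -- The bundle projection is a topological quotient map, so the quotient topology on orbits
        -- is the bundle topology.
        refine hfib.isQuotientMap.continuous_iff.2 ?_
        refine (continuous_quotient_mk' (s := ρ.orbitSetoid)).congr fun z => ?_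
        exact ((Equiv.ofBijective f hf).symm_apply_apply (ρ.toOrbit z)).symm }
  obtain ⟨cs, hm, Ψ, hΨ⟩ := exists_diffeomorph_of_homeomorph (𝓘(ℝ, EM).prod 𝓘(ℝ, F)) e
  have hΨ' : ∀ z : V.Total, Ψ (ρ.toOrbit z) = ⟨p z.1, nat z.1 z.2⟩ := fun z => hΨ _
  have : T2Space W.Total := t2Space_totalSpace
  have : SecondCountableTopology W.Total := secondCountableTopology_totalSpace
  refine ⟨cs, hm, e.symm.t2Space, e.secondCountableTopology, ?_, Ψ, hΨ'⟩
  have h1 : IsSmoothFibration EG (𝓘(ℝ, EP).prod 𝓘(ℝ, F)) (𝓘(ℝ, EM).prod 𝓘(ℝ, F)) G ρ.toOrbit := by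
    have h2 : ρ.toOrbit = Ψ.symm ∘ fun z : V.Total => (⟨p z.1, nat z.1 z.2⟩ : W.Total) := by
      funext z
      rw [Function.comp_apply, ← hΨ', Ψ.symm_apply_apply]
    rw [h2]
    exact hfib.comp_diffeomorph Ψ.symm
  exact h1.isSubmersion fun ⟨z⟩ => hp.finrank_eq z.1

omit [FiniteDimensional ℝ EG] in
/-- The tangent bundle of a principal bundle is a PBG-algebroid. -/
theorem isPBGAlgebroid_tangentAction
    (hact : ContMDiff (𝓘(ℝ, EP).prod 𝓘(ℝ, EG)) 𝓘(ℝ, EP) ∞ (fun z : P × G => z.1 <• z.2)) :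
    IsPBGAlgebroid EG (tangentLieAlgebroid EP P) (tangentAction EG hact) := by
  have := FiniteDimensional.complete ℝ EP
  refine ⟨fun g u v => rfl, fun g X Y X' Y' hX hY u => ?_⟩
  have hs : ContMDiff 𝓘(ℝ, EP) 𝓘(ℝ, EP) ∞ (fun w : P => w <• g) :=
    hact.comp (contMDiff_id.prodMk contMDiff_const)
  exact (mfderiv_mlieBracket_of_related hs (X.contMDiff.mdifferentiable (by simp) u)
    (Y.contMDiff.mdifferentiable (by simp) u) (X'.contMDiff.mdifferentiable (by simp) _)
    (Y'.contMDiff.mdifferentiable (by simp) _) (fun y => (hX y).symm) (fun y => (hY y).symm)).symm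

end Orbit

/-! ### Kernels of surjective bundle morphisms -/

section Kernel

variable {E : Type*} [NormedAddCommGroup E] [NormedSpace ℝ E]
  {M : Type*} [TopologicalSpace M] [ChartedSpace E M]
  {F' : Type*} [NormedAddCommGroup F'] [NormedSpace ℝ F']
  {F : Type*} [NormedAddCommGroup F] [NormedSpace ℝ F]

/-- A smooth family of surjections has, locally, right inverses of the form `s ∘ R y` with `R y`
inverse to `Q y ∘ s`. -/
theorem exists_smooth_rightInverse [FiniteDimensional ℝ F'] {Q : M → F →L[ℝ] F'} {U : Set M}
    (hU : IsOpen U) (hQ : ContMDiffOn 𝓘(ℝ, E) 𝓘(ℝ, F →L[ℝ] F') ∞ Q U) {x₀ : M} (hx₀ : x₀ ∈ U)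
    (hs : Function.Surjective (Q x₀)) :
    ∃ (U' : Set M) (s : F' →L[ℝ] F) (R : M → F' →L[ℝ] F'), IsOpen U' ∧ x₀ ∈ U' ∧ U' ⊆ U ∧
      ContMDiffOn 𝓘(ℝ, E) 𝓘(ℝ, F' →L[ℝ] F') ∞ R U' ∧
      (∀ y ∈ U', ∀ w, Q y (s (R y w)) = w) ∧ ∀ y ∈ U', ∀ w, R y (Q y (s w)) = w := by
  have := FiniteDimensional.complete ℝ F'
  obtain ⟨s₀, hs₀⟩ := (Q x₀).toLinearMap.exists_rightInverse_of_surjective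
    (LinearMap.range_eq_top.2 hs)
  let s : F' →L[ℝ] F := LinearMap.toContinuousLinearMap s₀
  have hQs : ContMDiffOn 𝓘(ℝ, E) 𝓘(ℝ, F' →L[ℝ] F') ∞ (fun y => (Q y).comp s) U :=
    hQ.clm_comp contMDiffOn_const
  -- Here `s` is a right inverse at `x₀` only. Invertibility is an open condition, so `Q y ∘ s`
  -- stays invertible near `x₀`, and `R y` is its inverse.
  let O : Set (F' →L[ℝ] F') := range ((↑) : (F' ≃L[ℝ] F') → F' →L[ℝ] F')
  have hO : IsOpen O := ContinuousLinearEquiv.isOpen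
  have h0 : (Q x₀).comp s = ContinuousLinearEquiv.refl ℝ F' := by
    ext w
    exact LinearMap.congr_fun hs₀ w
  have hinv : ∀ y ∈ U ∩ (fun y => (Q y).comp s) ⁻¹' O, ∃ e : F' ≃L[ℝ] F', (Q y).comp s = e :=
    fun y hy => hy.2.imp fun e he => he.symm
  refine ⟨U ∩ (fun y => (Q y).comp s) ⁻¹' O, s, fun y => ContinuousLinearMap.inverse ((Q y).comp s),
    hQs.continuousOn.isOpen_inter_preimage hU hO, ⟨hx₀, ⟨_, h0.symm⟩⟩, inter_subset_left,
    fun y hy => ?_, fun y hy w => ?_, fun y hy w => ?_⟩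
  · obtain ⟨e, he⟩ := hinv y hy
    have h1 : ContDiffAt ℝ ∞ ContinuousLinearMap.inverse ((Q y).comp s) := by
      rw [he]
      exact contDiffAt_map_inverse e
    exact h1.contMDiffAt.comp_contMDiffWithinAt y ((hQs.mono inter_subset_left) y hy)
  · obtain ⟨e, he⟩ := hinv y hy
    simp only [he, ContinuousLinearMap.inverse_equiv]
    exact (DFunLike.congr_fun he _).trans (e.apply_symm_apply w)
  · obtain ⟨e, he⟩ := hinv y hy
    simp only [he, ContinuousLinearMap.inverse_equiv]
    exact (congrArg e.symm (DFunLike.congr_fun he w)).trans (e.symm_apply_apply w)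

variable {W : SmoothVectorBundle E M F'} {V : SmoothVectorBundle.{_, _, _, vV} E M F}

/-- A smooth frame over `U` of the kernel of a fibrewise linear map, with coordinates which extend
to the whole bundle. -/
structure KernelFrame {T : M → Type*} [∀ x, AddCommGroup (T x)] [∀ x, Module ℝ (T x)]
    (V : SmoothVectorBundle.{_, _, _, vV} E M F) (q : ∀ x, V.Fib x →ₗ[ℝ] T x)
    (K : Type*) [NormedAddCommGroup K] [NormedSpace ℝ K] (U : Set M) where
  isOpen : IsOpen U
  /-- the coordinates of the projection of a vector to the kernel -/
  coord : ∀ x, V.Fib x →ₗ[ℝ] K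
  /-- the element of the kernel with given coordinates -/
  inv : ∀ x, K →ₗ[ℝ] V.Fib x
  map_inv : ∀ x v, q x (inv x v) = 0
  coord_inv : ∀ x ∈ U, ∀ v, coord x (inv x v) = v
  inv_coord : ∀ x ∈ U, ∀ v, q x v = 0 → inv x (coord x v) = v
  smooth_coord : ContMDiffOn (𝓘(ℝ, E).prod 𝓘(ℝ, F)) 𝓘(ℝ, K) ∞
    (fun z : V.Total => coord z.1 z.2) {z | z.1 ∈ U}
  smooth_inv : ContMDiffOn (𝓘(ℝ, E).prod 𝓘(ℝ, K)) (𝓘(ℝ, E).prod 𝓘(ℝ, F)) ∞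
    (fun z : M × K => (⟨z.1, inv z.1 z.2⟩ : V.Total)) {z | z.1 ∈ U}

variable {q : ∀ x, V.Fib x →ₗ[ℝ] W.Fib x}

theorem LocalFrame.contMDiffOn_matrix [FiniteDimensional ℝ F] (hq : IsBundleMorphism V W q)
    {U U' : Set M} (φ : LocalFrame V U) (ψ : LocalFrame W U') :
    ContMDiffOn 𝓘(ℝ, E) 𝓘(ℝ, F →L[ℝ] F') ∞
      (fun y => LinearMap.toContinuousLinearMap (ψ.coord y ∘ₗ q y ∘ₗ φ.inv y)) (U ∩ U') :=
  contMDiffOn_clm_of_apply fun _ => ψ.smooth_coord.comp (hq.comp_contMDiffOn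
    (φ.smooth_inv.comp (contMDiffOn_id.prodMk contMDiffOn_const) fun _ hy => hy.1)) fun _ hy => hy.2

/-- The maps `π' y = 1 - s R(y) Q(y)` are projections onto `ker Q(y)` which all have the kernel
`range s`. Hence `π' x₀` and `π' y` restrict to mutually inverse isomorphisms between `ker Q(y)` and
`ker Q(x₀)`, and an identification of `K` with `ker Q(x₀)` gives a smooth frame. -/
theorem exists_kernelFrame [FiniteDimensional ℝ F] [FiniteDimensional ℝ F']
    (hq : IsBundleMorphism V W q) (hs : ∀ x, Function.Surjective (q x)) {K : Type*}
    [NormedAddCommGroup K] [NormedSpace ℝ K] [FiniteDimensional ℝ K]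
    (hK : Module.finrank ℝ F = Module.finrank ℝ F' + Module.finrank ℝ K) (x₀ : M) :
    ∃ U : Set M, x₀ ∈ U ∧ Nonempty (KernelFrame V q K U) := by
  classical
  obtain ⟨U₁, hx₁, ⟨φ⟩⟩ := V.exists_localFrame x₀
  obtain ⟨U₂, hx₂, ⟨ψ⟩⟩ := W.exists_localFrame x₀
  let Q : M → F →L[ℝ] F' := fun y =>
    LinearMap.toContinuousLinearMap (ψ.coord y ∘ₗ q y ∘ₗ φ.inv y)
  have hQd : ∀ y v, Q y v = ψ.coord y (q y (φ.inv y v)) := fun y v => rfl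
  have hQ : ContMDiffOn 𝓘(ℝ, E) 𝓘(ℝ, F →L[ℝ] F') ∞ Q (U₁ ∩ U₂) := φ.contMDiffOn_matrix hq ψ
  have hQs : Function.Surjective (Q x₀) := by
    intro w
    obtain ⟨v, hv⟩ := hs x₀ (ψ.inv x₀ w)
    refine ⟨φ.coord x₀ v, ?_⟩
    rw [hQd, φ.inv_coord _ hx₁, hv, ψ.coord_inv _ hx₂]
  obtain ⟨U, s, R, hU, hx, hUU, hR, hQR, hRQ⟩ :=
    exists_smooth_rightInverse (φ.isOpen.inter ψ.isOpen) hQ ⟨hx₁, hx₂⟩ hQs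
  let π' : M → F →L[ℝ] F := fun y => .id ℝ F - s.comp ((R y).comp (Q y))
  have hπ : ContMDiffOn 𝓘(ℝ, E) 𝓘(ℝ, F →L[ℝ] F) ∞ π' U :=
    contMDiffOn_const.sub (contMDiffOn_const.clm_comp (hR.clm_comp (hQ.mono hUU)))
  have hπd : ∀ y v, π' y v = v - s (R y (Q y v)) := fun y v => rfl
  have hQπ : ∀ y ∈ U, ∀ v, Q y (π' y v) = 0 := fun y hy v => by
    rw [hπd, map_sub, hQR y hy, sub_self]
  have hπs : ∀ y ∈ U, ∀ w, π' y (s w) = 0 := fun y hy w => by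
    rw [hπd, hRQ y hy, sub_self]
  have hπQ : ∀ y v, Q y v = 0 → π' y v = v := fun y v h => by simp [hπd, h]
  let P₀ : F →ₗ[ℝ] (Q x₀).toLinearMap.ker :=
    (π' x₀).toLinearMap.codRestrict _ fun v => LinearMap.mem_ker.2 (hQπ x₀ hx v)
  have hfr : Module.finrank ℝ K = Module.finrank ℝ (Q x₀).toLinearMap.ker := by
    have h1 := (Q x₀).toLinearMap.finrank_range_add_finrank_ker
    rw [LinearMap.range_eq_top.2 hQs, finrank_top, hK] at h1
    omega
  let ε : K ≃ₗ[ℝ] (Q x₀).toLinearMap.ker := LinearEquiv.ofFinrankEq _ _ hfr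
  have hεQ : ∀ v, Q x₀ (ε v : F) = 0 := fun v => (ε v).2
  let ε₁ : K →L[ℝ] F := LinearMap.toContinuousLinearMap ((Submodule.subtype _) ∘ₗ ε.toLinearMap)
  let ε₂ : F →L[ℝ] K := LinearMap.toContinuousLinearMap (ε.symm.toLinearMap ∘ₗ P₀)
  have h12 : ∀ v, ε₁ (ε₂ v) = π' x₀ v := fun v =>
    congrArg Subtype.val (ε.apply_symm_apply (P₀ v))
  have h21 : ∀ v, π' x₀ v = 0 → ε₂ v = 0 := fun v h => by
    have : P₀ v = 0 := Subtype.ext h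
    exact (congrArg ε.symm this).trans (map_zero _)
  have h22 : ∀ v, ε₂ (ε₁ v) = v := fun v => by
    have : P₀ (ε v) = ε v := Subtype.ext (hπQ x₀ _ (hεQ v))
    exact (congrArg ε.symm this).trans (ε.symm_apply_apply v)
  have hproj : ContMDiff (𝓘(ℝ, E).prod 𝓘(ℝ, F)) 𝓘(ℝ, E) ∞ (fun z : V.Total => z.1) :=
    contMDiff_proj V.Fib
  refine ⟨U, hx, ⟨{
    isOpen := hU
    coord := fun y => ε₂.toLinearMap ∘ₗ φ.coord y
    -- The value `0` off `U` makes `map_inv` hold at every point, so that `inv` can be restricted to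
    -- the kernel everywhere.
    inv := fun y => if y ∈ U then φ.inv y ∘ₗ (π' y).toLinearMap ∘ₗ ε₁.toLinearMap else 0
    map_inv := fun y v => ?_
    coord_inv := fun y hy v => ?_
    inv_coord := fun y hy v hv => ?_
    smooth_coord := ?_
    smooth_inv := ?_ }⟩⟩
  · split_ifs with hy
    · have h := hQπ y hy (ε₁ v)
      rw [hQd] at h
      change q y (φ.inv y (π' y (ε₁ v))) = 0
      rw [← ψ.inv_coord y (hUU hy).2 (q y _), h, map_zero]
    · exact map_zero _
  · rw [if_pos hy]
    change ε₂ (φ.coord y (φ.inv y (π' y (ε₁ v)))) = v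
    rw [φ.coord_inv y (hUU hy).1, hπd, map_sub, h22, h21 _ (hπs x₀ hx _), sub_zero]
  · rw [if_pos hy]
    change φ.inv y (π' y (ε₁ (ε₂ (φ.coord y v)))) = v
    have h1 : Q y (φ.coord y v) = 0 := by
      rw [hQd, φ.inv_coord y (hUU hy).1, hv, map_zero]
    rw [h12, hπd x₀, map_sub, hπs y hy, hπQ y _ h1, sub_zero, φ.inv_coord y (hUU hy).1]
  · exact ε₂.contMDiff.comp_contMDiffOn (φ.smooth_coord.mono fun z hz => (hUU hz).1)
  · refine (φ.smooth_inv.comp (contMDiffOn_fst.prodMk ((hπ.comp contMDiffOn_fst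
      fun z hz => hz).clm_apply (ε₁.contMDiff.comp_contMDiffOn contMDiffOn_snd)))
      fun z hz => (hUU hz).1).congr fun z hz => ?_
    have h : z.1 ∈ U := hz
    simp only [if_pos h]
    rfl

/-- `j : L → V` is, as a map of smooth vector bundles, the kernel of `q`: it is smooth, with a
smooth retraction locally, injective, and has the kernel of `q` as its image. -/
structure IsBundleKernel {K : Type*} [NormedAddCommGroup K] [NormedSpace ℝ K] {T : M → Type*}
    [∀ x, AddCommGroup (T x)] [∀ x, Module ℝ (T x)] (L : SmoothVectorBundle E M K)
    (q : ∀ x, V.Fib x →ₗ[ℝ] T x) (j : ∀ x, L.Fib x →ₗ[ℝ] V.Fib x) : Prop where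
  smooth : IsBundleMorphism L V j
  injective : ∀ x, Function.Injective (j x)
  exact : ∀ x, LinearMap.range (j x) = LinearMap.ker (q x)
  exists_retraction : ∀ x, ∃ (U : Set M) (r : ∀ y, V.Fib y →ₗ[ℝ] L.Fib y), IsOpen U ∧ x ∈ U ∧
    (∀ y ∈ U, ∀ v, r y (j y v) = v) ∧
    ContMDiffOn (𝓘(ℝ, E).prod 𝓘(ℝ, F)) (𝓘(ℝ, E).prod 𝓘(ℝ, K)) ∞
      (fun z : V.Total => (⟨z.1, r z.1 z.2⟩ : L.Total)) {z | z.1 ∈ U}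

/-- The kernel of a surjective morphism of smooth vector bundles. -/
theorem exists_bundleKernel [FiniteDimensional ℝ F] [FiniteDimensional ℝ F']
    (hq : IsBundleMorphism V W q) (hs : ∀ x, Function.Surjective (q x)) {K : Type*}
    [NormedAddCommGroup K] [NormedSpace ℝ K] [FiniteDimensional ℝ K]
    (hK : Nonempty M → Module.finrank ℝ F = Module.finrank ℝ F' + Module.finrank ℝ K) :
    ∃ (L : SmoothVectorBundle.{_, _, _, vV} E M K) (j : ∀ x, L.Fib x →ₗ[ℝ] V.Fib x),
      IsBundleKernel L q j := by
  choose U hU hφ using fun x : M => exists_kernelFrame hq hs (hK ⟨x⟩) x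
  let φ := fun x => (hφ x).some
  let D : FrameData E K (fun x => (q x).ker) :=
    { Idx := M
      dom := U
      isOpen_dom := fun x => (φ x).isOpen
      index := id
      mem_dom_index := hU
      coord := fun x y => (φ x).coord y ∘ₗ Submodule.subtype _
      inv := fun x y => ((φ x).inv y).codRestrict _ fun v => LinearMap.mem_ker.2 ((φ x).map_inv y v)
      coord_inv := fun x y hy v => (φ x).coord_inv y hy v
      inv_coord := fun x y hy v => Subtype.ext ((φ x).inv_coord y hy v v.2)
      smooth := fun x x' v => (φ x').smooth_coord.comp ((φ x).smooth_inv.comp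
        (contMDiffOn_id.prodMk (contMDiffOn_const (c := v))) fun y hy => hy.1) fun y hy => hy.2 }
  refine ⟨D.toBundle, fun x => (q x).ker.subtype, fun z₀ => ?_, fun x => Subtype.val_injective,
    fun x => Submodule.range_subtype _, fun x => ?_⟩
  · obtain ⟨χ, hχc, hχi⟩ := D.exists_localFrame z₀.1
    have hproj : ContMDiff (𝓘(ℝ, E).prod 𝓘(ℝ, K)) 𝓘(ℝ, E) ∞ (fun z : D.toBundle.Total => z.1) :=
      contMDiff_proj D.toBundle.Fib
    refine (((φ z₀.1).smooth_inv.comp (hproj.contMDiffOn.prodMk χ.smooth_coord)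
      fun z hz => hz).congr fun z hz => ?_).contMDiffAt
      (((φ z₀.1).isOpen.preimage hproj.continuous).mem_nhds (hU z₀.1))
    refine congrArg (TotalSpace.mk z.1) ?_
    rw [hχc]
    exact ((φ z₀.1).inv_coord z.1 hz z.2.1 z.2.2).symm
  · obtain ⟨χ, hχc, hχi⟩ := D.exists_localFrame x
    have hproj : ContMDiff (𝓘(ℝ, E).prod 𝓘(ℝ, F)) 𝓘(ℝ, E) ∞ (fun z : V.Total => z.1) :=
      contMDiff_proj V.Fib
    refine ⟨U x, fun y => χ.inv y ∘ₗ (φ x).coord y, (φ x).isOpen, hU x, fun y hy v => ?_, ?_⟩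
    · have h := χ.inv_coord y hy v
      rw [hχc] at h
      exact h
    · exact χ.smooth_inv.comp (hproj.contMDiffOn.prodMk (φ x).smooth_coord) fun z hz => hz

/-- A local smooth retraction recovers `f` from `j ∘ f`; continuity of the base point is also read
off from `j ∘ f`. -/
theorem IsBundleKernel.contMDiff_of_comp {K : Type*} [NormedAddCommGroup K] [NormedSpace ℝ K]
    {T : M → Type*} [∀ x, AddCommGroup (T x)] [∀ x, Module ℝ (T x)] {L : SmoothVectorBundle E M K}
    {q : ∀ x, V.Fib x →ₗ[ℝ] T x} {j : ∀ x, L.Fib x →ₗ[ℝ] V.Fib x} (hj : IsBundleKernel L q j)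
    {EN : Type*} [NormedAddCommGroup EN] [NormedSpace ℝ EN] {HN : Type*}
    [TopologicalSpace HN] {IN : ModelWithCorners ℝ EN HN} {N : Type*} [TopologicalSpace N]
    [ChartedSpace HN N] {f : N → L.Total}
    (hf : ContMDiff IN (𝓘(ℝ, E).prod 𝓘(ℝ, F)) ∞ (fun z => (⟨(f z).1, j (f z).1 (f z).2⟩ : V.Total))) :
    ContMDiff IN (𝓘(ℝ, E).prod 𝓘(ℝ, K)) ∞ f := by
  intro z₀
  obtain ⟨U, r, hU, hz, hr, hrs⟩ := hj.exists_retraction (f z₀).1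
  have h1 : Continuous fun z => (f z).1 := ((contMDiff_proj V.Fib).comp hf).continuous
  refine ((hrs.comp hf.contMDiffOn fun z hz => hz).congr fun z hz => ?_).contMDiffAt
    ((hU.preimage h1).mem_nhds hz)
  exact congrArg (TotalSpace.mk (f z).1) (hr _ hz _).symm

end Kernel

/-! ### Derivations of sections: locality and local formula -/

section Derivations

variable {E : Type*} [NormedAddCommGroup E] [NormedSpace ℝ E]
  {M : Type*} [TopologicalSpace M] [ChartedSpace E M]
  {F : Type*} [NormedAddCommGroup F] [NormedSpace ℝ F]
  {V : SmoothVectorBundle E M F}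

/-- The restriction of a frame to a smaller open set. -/
def LocalFrame.restrict {U U' : Set M} (φ : LocalFrame V U) (hU' : IsOpen U') (h : U' ⊆ U) :
    LocalFrame V U' where
  isOpen := hU'
  coord := φ.coord
  inv := φ.inv
  coord_inv x hx := φ.coord_inv x (h hx)
  inv_coord x hx := φ.inv_coord x (h hx)
  smooth_coord := φ.smooth_coord.mono fun _ hz => h hz
  smooth_inv := φ.smooth_inv.mono fun _ hz => h hz

theorem exists_bump [FiniteDimensional ℝ E] [IsManifold 𝓘(ℝ, E) ∞ M] [T2Space M] {U : Set M}
    (hU : IsOpen U) {x : M} (hx : x ∈ U) :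
    ∃ χ : C^∞⟮𝓘(ℝ, E), M; ℝ⟯, (χ : M → ℝ) =ᶠ[𝓝 x] 1 ∧ tsupport χ ⊆ U := by
  obtain ⟨f, -, hf⟩ := (SmoothBumpFunction.nhds_basis_tsupport (I := 𝓘(ℝ, E)) x).mem_iff.1
    (hU.mem_nhds hx)
  exact ⟨⟨f, f.contMDiff⟩, f.eventuallyEq_one, hf⟩

/-- The global section which is the product of a cutoff function and of the section with constant
coordinates in a local frame. -/
def LocalFrame.extend {U : Set M} (φ : LocalFrame V U) (χ : C^∞⟮𝓘(ℝ, E), M; ℝ⟯)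
    (hχ : tsupport χ ⊆ U) : F →ₗ[ℝ] V.Sections where
  toFun v := ⟨fun y => χ y • φ.inv y v, ContMDiffOn.smul_section_of_tsupport
    χ.contMDiff.contMDiffOn φ.isOpen hχ
    (φ.smooth_inv.comp (contMDiffOn_id.prodMk contMDiffOn_const) fun _ hy => hy)⟩
  map_add' v w := by
    ext y
    exact (congrArg (χ y • ·) (map_add _ v w)).trans (smul_add _ _ _)
  map_smul' c v := by
    ext y
    exact (congrArg (χ y • ·) (map_smul _ c v)).trans (smul_comm _ _ _)

theorem LocalFrame.extend_apply {U : Set M} (φ : LocalFrame V U) {χ : C^∞⟮𝓘(ℝ, E), M; ℝ⟯}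
    (hχ : tsupport χ ⊆ U) (v : F) (y : M) : φ.extend χ hχ v y = χ y • φ.inv y v := rfl

theorem LocalFrame.contMDiffOn_coord {U : Set M} (φ : LocalFrame V U) (Z : V.Sections) :
    ContMDiffOn 𝓘(ℝ, E) 𝓘(ℝ, F) ∞ (fun y => φ.coord y (Z y)) U :=
  φ.smooth_coord.comp Z.contMDiff.contMDiffOn fun _ hy => hy

variable [IsManifold 𝓘(ℝ, E) ∞ M]

/-- `D` is a derivation of the sections of `V` over the vector field `ξ`. -/
def IsDerivationOver (D : V.Sections →ₗ[ℝ] V.Sections) (ξ : ∀ x : M, TangentSpace 𝓘(ℝ, E) x) :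
    Prop :=
  ∀ (Y : V.Sections) (u : C^∞⟮𝓘(ℝ, E), M; ℝ⟯) (x : M),
    D (V.smulSection u Y) x = u x • D Y x + mvfderiv 𝓘(ℝ, E) u x (ξ x) • Y x

variable {D : V.Sections →ₗ[ℝ] V.Sections} {ξ : ∀ x : M, TangentSpace 𝓘(ℝ, E) x}

omit [IsManifold 𝓘(ℝ, E) ∞ M] in
theorem mvfderiv_congr {f g : M → F} {x : M} (h : f =ᶠ[𝓝 x] g) (v : TangentSpace 𝓘(ℝ, E) x) :
    mvfderiv 𝓘(ℝ, E) f x v = mvfderiv 𝓘(ℝ, E) g x v :=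
  DFunLike.congr_fun (h.mfderiv_eq (I := 𝓘(ℝ, E)) (I' := 𝓘(ℝ, F))) v



variable [FiniteDimensional ℝ E] [T2Space M]

/-- Derivations are local operators. -/
theorem IsDerivationOver.congr_of_eventuallyEq (hD : IsDerivationOver D ξ) {Y Y' : V.Sections}
    {x : M} (h : ∀ᶠ y in 𝓝 x, Y y = Y' y) : D Y x = D Y' x := by
  obtain ⟨U, hUs, hU, hx⟩ := mem_nhds_iff.1 h
  obtain ⟨χ, h1, hχ⟩ := exists_bump (E := E) hU hx
  -- With `χ = 1` near `x` and support where `Y = Y'`, the difference equals `(1 - χ)(Y - Y')`. Both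
  -- factors vanish at `x`, so both Leibniz terms do.
  have h2 : Y - Y' = V.smulSection (1 - χ) (Y - Y') := by
    ext y
    change Y y - Y' y = (1 - χ y) • (Y y - Y' y)
    by_cases hy : y ∈ U
    · rw [show Y y = Y' y from hUs hy, sub_self, smul_zero]
    · rw [show χ y = 0 from image_eq_zero_of_notMem_tsupport fun h => hy (hχ h), sub_zero, one_smul]
  have h3 := hD (Y - Y') (1 - χ) x
  rw [← h2, map_sub] at h3
  have h4 : (Y - Y') x = 0 := sub_eq_zero.2 (show Y x = Y' x from hUs hx)
  have h5 : (1 - χ : C^∞⟮𝓘(ℝ, E), M; ℝ⟯) x = 0 := sub_eq_zero.2 h1.eq_of_nhds.symm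
  rw [h4, h5, zero_smul, smul_zero, add_zero] at h3
  exact sub_eq_zero.1 h3

/-- The coordinates of a derivative in a local frame. -/
theorem IsDerivationOver.coord_apply [FiniteDimensional ℝ F] (hD : IsDerivationOver D ξ)
    {U : Set M} (φ : LocalFrame V U) {χ : C^∞⟮𝓘(ℝ, E), M; ℝ⟯} (hχ : tsupport χ ⊆ U) {x : M}
    (hx : (χ : M → ℝ) =ᶠ[𝓝 x] 1) (Y : V.Sections) :
    φ.coord x (D Y x) = mvfderiv 𝓘(ℝ, E) (fun y => φ.coord y (Y y)) x (ξ x) +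
      φ.coord x (D (φ.extend χ hχ (φ.coord x (Y x))) x) := by
  have hxχ : χ x = 1 := hx.eq_of_nhds
  have hxU : x ∈ U := by
    by_contra h
    rw [image_eq_zero_of_notMem_tsupport fun h' => h (hχ h')] at hxχ
    exact zero_ne_one hxχ
  let b := Module.finBasis ℝ F
  have hb : ∀ i, ContMDiffOn 𝓘(ℝ, E) 𝓘(ℝ, ℝ) ∞ (fun y => b.coord i (φ.coord y (Y y))) U := fun i =>
    (LinearMap.toContinuousLinearMap (b.coord i)).contMDiff.comp_contMDiffOn
      (φ.contMDiffOn_coord Y)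
  let f : Fin (Module.finrank ℝ F) → C^∞⟮𝓘(ℝ, E), M; ℝ⟯ := fun i =>
    ⟨fun y => χ y • b.coord i (φ.coord y (Y y)), contMDiff_of_tsupport fun y hy => by
      have hy' : y ∈ U := hχ (tsupport_smul_subset_left _ _ hy)
      exact χ.contMDiff.contMDiffAt.smul ((hb i).contMDiffAt (φ.isOpen.mem_nhds hy'))⟩
  have hf : ∀ i, (f i : M → ℝ) =ᶠ[𝓝 x] fun y => b.coord i (φ.coord y (Y y)) := fun i => by
    filter_upwards [hx] with y hy
    exact (congrArg (· * b.coord i (φ.coord y (Y y))) hy).trans (one_mul _)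
  -- Near `x`, `Y` is a combination of globally extended frame sections with cut off coefficients.
  -- Locality replaces `Y` by this sum, and Leibniz splits `D Y` into the derivative of the
  -- coefficients and a zeroth order term.
  let Y' : V.Sections := ∑ i, V.smulSection (f i) (φ.extend χ hχ (b i))
  have hY' : ∀ y, Y' y = ∑ i, f i y • φ.extend χ hχ (b i) y := fun y => by
    have h := map_sum (ContMDiffSection.coeAddHom 𝓘(ℝ, E) F ∞ V.Fib)
      (fun i => V.smulSection (f i) (φ.extend χ hχ (b i))) Finset.univ
    exact (congrFun h y).trans (Finset.sum_apply _ _ _)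
  have hYY' : ∀ᶠ y in 𝓝 x, Y y = Y' y := by
    filter_upwards [hx, φ.isOpen.mem_nhds hxU] with y hy hyU
    have hy : χ y = 1 := hy
    rw [hY']
    conv_lhs => rw [← φ.inv_coord y hyU (Y y), ← b.sum_repr (φ.coord y (Y y)), map_sum]
    refine Finset.sum_congr rfl fun i _ => ?_
    rw [map_smul, φ.extend_apply hχ, hy, one_smul]
    exact congrArg (· • φ.inv y (b i))
      ((congrArg (· * b.coord i (φ.coord y (Y y))) hy).trans (one_mul _)).symm
  have hext : ∀ v, φ.coord x (φ.extend χ hχ v x) = v := fun v => by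
    rw [φ.extend_apply hχ, hxχ, one_smul, φ.coord_inv x hxU]
  have h1 : D Y x = ∑ i, (f i x • D (φ.extend χ hχ (b i)) x +
      mvfderiv 𝓘(ℝ, E) (f i) x (ξ x) • φ.extend χ hχ (b i) x) := by
    rw [hD.congr_of_eventuallyEq hYY', map_sum]
    have h := map_sum (ContMDiffSection.coeAddHom 𝓘(ℝ, E) F ∞ V.Fib)
      (fun i => D (V.smulSection (f i) (φ.extend χ hχ (b i)))) Finset.univ
    refine (congrFun h x).trans ((Finset.sum_apply _ _ _).trans ?_)
    exact Finset.sum_congr rfl fun i _ => hD _ _ _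
  have h2 : ∑ i, f i x • D (φ.extend χ hχ (b i)) x = D (φ.extend χ hχ (φ.coord x (Y x))) x := by
    conv_rhs => rw [← b.sum_repr (φ.coord x (Y x)), map_sum, map_sum]
    have h := map_sum (ContMDiffSection.coeAddHom 𝓘(ℝ, E) F ∞ V.Fib)
      (fun i => D (φ.extend χ hχ (b.repr (φ.coord x (Y x)) i • b i))) Finset.univ
    refine Eq.symm ((congrFun h x).trans ((Finset.sum_apply _ _ _).trans ?_))
    refine Finset.sum_congr rfl fun i _ => ?_
    rw [map_smul, map_smul, (hf i).eq_of_nhds]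
    rfl
  have h3 : ∀ i, mvfderiv 𝓘(ℝ, E) (f i) x (ξ x) =
      b.coord i (mvfderiv 𝓘(ℝ, E) (fun y => φ.coord y (Y y)) x (ξ x)) := fun i => by
    refine (mvfderiv_congr (hf i) _).trans ?_
    have hd := ((φ.contMDiffOn_coord Y).contMDiffAt (φ.isOpen.mem_nhds hxU)).mdifferentiableAt
      (by simp)
    let l : F →L[ℝ] ℝ := LinearMap.toContinuousLinearMap (b.coord i)
    have h := mfderiv_comp_apply (I := 𝓘(ℝ, E)) (I' := 𝓘(ℝ, F)) (I'' := 𝓘(ℝ, ℝ)) x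
      (l.mdifferentiableAt) hd (ξ x)
    refine h.trans ?_
    rw [ContinuousLinearMap.mfderiv_eq]
    rfl
  rw [h1, Finset.sum_add_distrib, h2, map_add, add_comm, map_sum]
  refine congrArg (· + _) ?_
  conv_rhs => rw [← b.sum_repr (mvfderiv 𝓘(ℝ, E) (fun y => φ.coord y (Y y)) x (ξ x))]
  refine Finset.sum_congr rfl fun i _ => ?_
  rw [map_smul, hext, h3]
  rfl

/-- A derivation over a vector field which vanishes at `x` is tensorial at `x`. -/
theorem IsDerivationOver.apply_eq_zero [FiniteDimensional ℝ F] (hD : IsDerivationOver D ξ)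
    {Y : V.Sections} {x : M} (hξ : ξ x = 0) (hY : Y x = 0) : D Y x = 0 := by
  obtain ⟨U, hx, ⟨φ⟩⟩ := V.exists_localFrame x
  obtain ⟨χ, h1, hχ⟩ := exists_bump (E := E) φ.isOpen hx
  have h := hD.coord_apply φ hχ h1 Y
  rw [hξ, map_zero, hY, map_zero, map_zero, map_zero] at h
  have h0 : φ.coord x ((0 : V.Sections) x) = 0 := map_zero (φ.coord x)
  rw [h0, add_zero] at h
  rw [← φ.inv_coord x hx (D Y x), h, map_zero]

end Derivations

/-! ### The fibre bracket on the kernel and its structure functions -/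

section KernelAlgebra

variable {E : Type*} [NormedAddCommGroup E] [NormedSpace ℝ E]
  {M : Type*} [TopologicalSpace M] [ChartedSpace E M]
  {F : Type*} [NormedAddCommGroup F] [NormedSpace ℝ F]
  {K : Type*} [NormedAddCommGroup K] [NormedSpace ℝ K]

/-- The action of a morphism of vector bundles on sections. -/
def mapSections {V : SmoothVectorBundle E M F} {W : SmoothVectorBundle E M K}
    {φ : ∀ x, V.Fib x →ₗ[ℝ] W.Fib x} (hφ : IsBundleMorphism V W φ) :
    V.Sections →ₗ[ℝ] W.Sections where
  toFun X := ⟨fun x => φ x (X x), hφ.comp X.contMDiff⟩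
  map_add' X Y := by
    ext x
    exact map_add (φ x) _ _
  map_smul' c X := by
    ext x
    exact map_smul (φ x) _ _

/-- The evaluation of sections at a point. -/
def evalSection (V : SmoothVectorBundle E M F) (x : M) : V.Sections →ₗ[ℝ] V.Fib x where
  toFun X := X x
  map_add' _ _ := rfl
  map_smul' _ _ := rfl

/-- A bilinear map between finite-dimensional spaces as a continuous bilinear map. -/
def toBilinCLM {F' : Type*} [NormedAddCommGroup F'] [NormedSpace ℝ F'] [FiniteDimensional ℝ F]
    [FiniteDimensional ℝ K] (B : F →ₗ[ℝ] K →ₗ[ℝ] F') : F →L[ℝ] K →L[ℝ] F' :=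
  LinearMap.toContinuousLinearMap
    ((LinearMap.toContinuousLinearMap : (K →ₗ[ℝ] F') ≃ₗ[ℝ] (K →L[ℝ] F')).toLinearMap ∘ₗ B)

variable [IsManifold 𝓘(ℝ, E) ∞ M] {A : LieAlgebroid E M F}

theorem LieAlgebroid.bracket_swap (X Y : A.Sections) : A.bracket X Y = -A.bracket Y X := by
  have h := A.bracket_self (X + Y)
  simp only [map_add, LinearMap.add_apply, A.bracket_self, zero_add, add_zero] at h
  exact eq_neg_of_add_eq_zero_right h

variable {L : SmoothVectorBundle E M K} {j : ∀ x, L.Fib x →ₗ[ℝ] A.Fib x}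

namespace IsBundleKernel

variable (hj : IsBundleKernel L A.anchor j)

include hj in
theorem anchor_eq_zero (x : M) (v : L.Fib x) : A.anchor x (j x v) = 0 := by
  have h : j x v ∈ LinearMap.ker (A.anchor x) := by
    rw [← hj.exact]
    exact LinearMap.mem_range_self _ _
  exact h

include hj in
theorem exists_section {X : A.Sections} (hX : ∀ x, A.anchor x (X x) = 0) :
    ∃ Z : L.Sections, mapSections hj.smooth Z = X := by
  have h : ∀ x, ∃ v, j x v = X x := fun x => by
    have h : X x ∈ LinearMap.range (j x) := by
      rw [hj.exact]
      exact hX x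
    exact h
  choose Z hZ using h
  refine ⟨⟨Z, hj.contMDiff_of_comp (X.contMDiff.congr fun x => ?_)⟩, ?_⟩
  · exact congrArg (TotalSpace.mk x) (hZ x)
  · ext x
    exact hZ x

theorem injective_mapSections : Function.Injective (mapSections hj.smooth) := by
  intro Y Z h
  ext x
  exact hj.injective x (congrArg (fun X : A.Sections => X x) h)

/-- The anchor preserves brackets and a bracket with the zero field vanishes: sections of the kernel
form an ideal, on which `A` acts by `ad`. -/
theorem anchor_bracket_mapSections (X : A.Sections) (Z : L.Sections) (x : M) :
    A.anchor x (A.bracket X (mapSections hj.smooth Z) x) = 0 := by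
  rw [A.anchor_bracket]
  have h : (fun y => A.anchor y (mapSections hj.smooth Z y)) = 0 :=
    funext fun y => hj.anchor_eq_zero y _
  rw [h, VectorField.mlieBracket_zero_right]
  rfl

theorem exists_ad : ∃ D : A.Sections →ₗ[ℝ] L.Sections →ₗ[ℝ] L.Sections, ∀ X Z,
    mapSections hj.smooth (D X Z) = A.bracket X (mapSections hj.smooth Z) := by
  have h := fun X Z => hj.exists_section (hj.anchor_bracket_mapSections X Z)
  choose D h using h
  exact ⟨LinearMap.mk₂ ℝ D
    (fun X X' Z => hj.injective_mapSections (by simp [h]))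
    (fun c X Z => hj.injective_mapSections (by simp [h]))
    (fun X Z Z' => hj.injective_mapSections (by simp [h]))
    (fun c X Z => hj.injective_mapSections (by simp [h])), h⟩

/-- The action of the sections of a Lie algebroid on the sections of the kernel of the anchor. -/
def ad : A.Sections →ₗ[ℝ] L.Sections →ₗ[ℝ] L.Sections := hj.exists_ad.choose

theorem mapSections_ad (X : A.Sections) (Z : L.Sections) :
    mapSections hj.smooth (hj.ad X Z) = A.bracket X (mapSections hj.smooth Z) :=
  hj.exists_ad.choose_spec X Z

theorem isDerivationOver_ad (X : A.Sections) :
    IsDerivationOver (hj.ad X) (fun x => A.anchor x (X x)) := by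
  intro Z u x
  apply hj.injective x
  have h1 : mapSections hj.smooth (L.smulSection u Z) =
      A.smulSection u (mapSections hj.smooth Z) := by
    ext y
    exact map_smul (j y) _ _
  have h2 := A.leibniz X (mapSections hj.smooth Z) u x
  rw [← h1, ← hj.mapSections_ad, ← hj.mapSections_ad] at h2
  rw [map_add, map_smul, map_smul]
  exact h2

theorem ad_swap (Y Z : L.Sections) :
    hj.ad (mapSections hj.smooth Y) Z = -hj.ad (mapSections hj.smooth Z) Y :=
  hj.injective_mapSections (by rw [map_neg, mapSections_ad, mapSections_ad, A.bracket_swap])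

/-- Jacobi read as a derivation property: `ad X` is a derivation of the bracket of kernel sections.
In frames this becomes the differential equation for the structure functions. -/
theorem ad_ad (X : A.Sections) (Y Z : L.Sections) :
    hj.ad X (hj.ad (mapSections hj.smooth Y) Z) =
      hj.ad (mapSections hj.smooth (hj.ad X Y)) Z +
        hj.ad (mapSections hj.smooth Y) (hj.ad X Z) := by
  apply hj.injective_mapSections
  have h := A.jacobi X (mapSections hj.smooth Y) (mapSections hj.smooth Z)
  rw [A.bracket_swap (mapSections hj.smooth Z) X, map_neg,
    A.bracket_swap (mapSections hj.smooth Z) (A.bracket _ _)] at h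
  simp only [map_add, mapSections_ad]
  rw [add_comm (A.bracket (A.bracket _ _) _), ← sub_eq_zero, ← h]
  abel

variable [FiniteDimensional ℝ E] [T2Space M] [FiniteDimensional ℝ K]

include hj in
-- For `Y` in the kernel, `ad Y` is a derivation over the zero vector field, hence tensorial. Skew
-- symmetry gives the same in the other slot.
theorem ad_congr_right (Y : L.Sections) {Z Z' : L.Sections} {x : M} (h : Z x = Z' x) :
    hj.ad (mapSections hj.smooth Y) Z x = hj.ad (mapSections hj.smooth Y) Z' x := by
  have h1 := (hj.isDerivationOver_ad (mapSections hj.smooth Y)).apply_eq_zero (Y := Z - Z')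
    (hj.anchor_eq_zero x _) (sub_eq_zero.2 h)
  rw [map_sub] at h1
  exact sub_eq_zero.1 h1

theorem ad_congr {Y Y' Z Z' : L.Sections} {x : M} (h : Y x = Y' x) (h' : Z x = Z' x) :
    hj.ad (mapSections hj.smooth Y) Z x = hj.ad (mapSections hj.smooth Y') Z' x := by
  rw [hj.ad_congr_right Y h', hj.ad_swap, hj.ad_swap Y']
  exact congrArg Neg.neg (hj.ad_congr_right Z' h)

omit [FiniteDimensional ℝ K] in
-- The extension is linear in the vector, so a fibre bracket defined through it is bilinear by
-- construction.
theorem _root_.PBG.exists_sectionExtension (V : SmoothVectorBundle E M F) (x : M) :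
    ∃ e : V.Fib x →ₗ[ℝ] V.Sections, ∀ v, e v x = v := by
  obtain ⟨U, hx, ⟨φ⟩⟩ := V.exists_localFrame x
  obtain ⟨χ, h1, hχ⟩ := exists_bump (E := E) φ.isOpen hx
  refine ⟨φ.extend χ hχ ∘ₗ φ.coord x, fun v => ?_⟩
  have h2 : χ x = 1 := h1.eq_of_nhds
  exact (congrArg (· • φ.inv x (φ.coord x v)) h2).trans
    ((one_smul _ _).trans (φ.inv_coord x hx v))

/-- The Lie bracket of a fibre of the kernel of the anchor. -/
def lie (x : M) : L.Fib x →ₗ[ℝ] L.Fib x →ₗ[ℝ] L.Fib x :=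
  let e := (exists_sectionExtension L x).choose
  ((hj.ad.compr₂ (evalSection L x)) ∘ₗ mapSections hj.smooth ∘ₗ e).compl₂ e

theorem lie_apply (x : M) (Y Z : L.Sections) :
    hj.lie x (Y x) (Z x) = hj.ad (mapSections hj.smooth Y) Z x :=
  have h := (exists_sectionExtension L x).choose_spec
  hj.ad_congr (h _) (h _)

theorem lie_self (x : M) (v : L.Fib x) : hj.lie x v v = 0 := by
  obtain ⟨e, he⟩ := exists_sectionExtension L x
  have h : hj.ad (mapSections hj.smooth (e v)) (e v) = 0 :=
    hj.injective_mapSections (by rw [mapSections_ad, A.bracket_self, map_zero])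
  have h1 := hj.lie_apply x (e v) (e v)
  rw [he, h] at h1
  exact h1

theorem lie_jacobi (x : M) (u v w : L.Fib x) : hj.lie x u (hj.lie x v w) +
    hj.lie x v (hj.lie x w u) + hj.lie x w (hj.lie x u v) = 0 := by
  obtain ⟨e, he⟩ := exists_sectionExtension L x
  have key : ∀ u v w, hj.lie x u (hj.lie x v w) = hj.ad (mapSections hj.smooth (e u))
      (hj.ad (mapSections hj.smooth (e v)) (e w)) x := by
    intro u v w
    rw [← hj.lie_apply, ← hj.lie_apply, he, he, he]
  have h : hj.ad (mapSections hj.smooth (e u)) (hj.ad (mapSections hj.smooth (e v)) (e w)) +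
      hj.ad (mapSections hj.smooth (e v)) (hj.ad (mapSections hj.smooth (e w)) (e u)) +
      hj.ad (mapSections hj.smooth (e w)) (hj.ad (mapSections hj.smooth (e u)) (e v)) = 0 :=
    hj.injective_mapSections (by simp only [map_add, mapSections_ad, A.jacobi, map_zero])
  rw [key, key, key]
  exact congrArg (fun Z : L.Sections => Z x) h

/-- The structure functions of the bracket of the kernel of the anchor are related by the Jacobi
identity to the coefficients of the action of the Lie algebroid on this kernel. -/
theorem exists_structureFunctions [FiniteDimensional ℝ F] (x₀ : M) :
    ∃ (U : Set M) (φ : LocalFrame L U) (ψ : LocalFrame A.toSmoothVectorBundle U)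
      (c : M → K →L[ℝ] K →L[ℝ] K) (Γ : M → F →L[ℝ] K →L[ℝ] K), x₀ ∈ U ∧
      ContMDiffOn 𝓘(ℝ, E) 𝓘(ℝ, K →L[ℝ] K →L[ℝ] K) ∞ c U ∧
      ContMDiffOn 𝓘(ℝ, E) 𝓘(ℝ, F →L[ℝ] K →L[ℝ] K) ∞ Γ U ∧
      (∀ y ∈ U, ∀ v w, c y v w = φ.coord y (hj.lie y (φ.inv y v) (φ.inv y w))) ∧
      ∀ y ∈ U, ∀ a v w, mvfderiv 𝓘(ℝ, E) (fun y => c y v w) y (A.anchor y (ψ.inv y a)) =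
        c y (Γ y a v) w + c y v (Γ y a w) - Γ y a (c y v w) := by
  obtain ⟨U₁, hx₁, ⟨φ⟩⟩ := L.exists_localFrame x₀
  obtain ⟨U₂, hx₂, ⟨ψ⟩⟩ := A.exists_localFrame x₀
  obtain ⟨χ, hx, hχ⟩ := exists_bump (E := E) (φ.isOpen.inter ψ.isOpen) ⟨hx₁, hx₂⟩
  have hχ₁ := hχ.trans inter_subset_left
  have hχ₂ := hχ.trans inter_subset_right
  have hone : ∀ y ∈ interior {y | χ y = 1}, (χ : M → ℝ) =ᶠ[𝓝 y] 1 := fun y hy =>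
    mem_interior_iff_mem_nhds.1 hy
  have hsub : interior {y | χ y = 1} ⊆ U₁ ∩ U₂ := fun y hy => by
    by_contra h
    have h1 : χ y = 1 := (hone y hy).eq_of_nhds
    rw [image_eq_zero_of_notMem_tsupport fun h' => h (hχ h')] at h1
    exact zero_ne_one h1
  -- On this set the extended sections coincide with the frames, and `χ` is `1` near each point, as
  -- the local formula for derivations requires.
  set U : Set M := interior {y | χ y = 1}
  have hU : IsOpen U := isOpen_interior
  let e := φ.extend χ hχ₁
  let b := ψ.extend χ hχ₂
  have he : ∀ y ∈ U, ∀ v, e v y = φ.inv y v := fun y hy v =>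
    (congrArg (· • φ.inv y v) (hone y hy).eq_of_nhds).trans (one_smul _ _)
  have hb : ∀ y ∈ U, ∀ v, b v y = ψ.inv y v := fun y hy v =>
    (congrArg (· • ψ.inv y v) (hone y hy).eq_of_nhds).trans (one_smul _ _)
  -- One expression serves twice: evaluated on kernel sections it gives the structure functions `c`,
  -- on frame sections of `A` the coefficients `Γ`.
  let S (y : M) : A.Sections →ₗ[ℝ] K →ₗ[ℝ] K :=
    (hj.ad.compr₂ (φ.coord y ∘ₗ evalSection L y)).compl₂ e
  let c : M → K →L[ℝ] K →L[ℝ] K := fun y => toBilinCLM (S y ∘ₗ mapSections hj.smooth ∘ₗ e)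
  let Γ : M → F →L[ℝ] K →L[ℝ] K := fun y => toBilinCLM (S y ∘ₗ b)
  have hc : ∀ y v w, c y v w = φ.coord y (hj.ad (mapSections hj.smooth (e v)) (e w) y) :=
    fun y v w => rfl
  have hcoord : ∀ Z : L.Sections, ContMDiffOn 𝓘(ℝ, E) 𝓘(ℝ, K) ∞ (fun y => φ.coord y (Z y)) U :=
    fun Z => (φ.contMDiffOn_coord Z).mono fun y hy => (hsub hy).1
  have hlie : ∀ y ∈ U, ∀ Y Z : L.Sections, φ.coord y (hj.ad (mapSections hj.smooth Y) Z y) =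
      c y (φ.coord y (Y y)) (φ.coord y (Z y)) := by
    intro y hy Y Z
    have h1 : ∀ Y : L.Sections, Y y = e (φ.coord y (Y y)) y := fun Y => by
      rw [he y hy, φ.inv_coord y (hsub hy).1]
    rw [hc, hj.ad_congr (h1 Y) (h1 Z)]
  refine ⟨U, φ.restrict hU fun y hy => (hsub hy).1, ψ.restrict hU fun y hy => (hsub hy).2, c, Γ,
    mem_interior_iff_mem_nhds.2 hx,
    contMDiffOn_clm_of_apply fun v => contMDiffOn_clm_of_apply fun w => hcoord _,
    contMDiffOn_clm_of_apply fun v => contMDiffOn_clm_of_apply fun w => hcoord _,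
    fun y hy v w => ?_, fun y hy a v w => ?_⟩
  · rw [hc, ← hj.lie_apply, he y hy, he y hy]
    rfl
  -- The coordinates of `ad (b a) [e v, e w]` are computed twice: by the local formula for
  -- derivations, and by Jacobi.
  · have h1 := (hj.isDerivationOver_ad (b a)).coord_apply φ hχ₁ (hone y hy)
      (hj.ad (mapSections hj.smooth (e v)) (e w))
    have h2 := congrArg (fun Z : L.Sections => φ.coord y (Z y)) (hj.ad_ad (b a) (e v) (e w))
    have h4 : ∀ v, φ.coord y (e v y) = v := fun v => by
      rw [he y hy, φ.coord_inv y (hsub hy).1]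
    have h5 := (h1.symm.trans h2).trans (map_add (φ.coord y) _ _)
    rw [hlie y hy, hlie y hy, hlie y hy, h4 v, h4 w] at h5
    refine Eq.trans ?_ (eq_sub_of_add_eq h5)
    exact congrArg (fun t => mvfderiv 𝓘(ℝ, E) (fun y => c y v w) y (A.anchor y t))
      (hb y hy a).symm

end IsBundleKernel

end KernelAlgebra

/-! ### Parallel families of bilinear operations -/

section Analysis

set_option maxSynthPendingDepth 3

variable {E : Type*} [NormedAddCommGroup E] [NormedSpace ℝ E]
  {K : Type*} [NormedAddCommGroup K] [NormedSpace ℝ K]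

/-- A function which vanishes at the centre of a ball and whose derivative is bounded by a multiple
of the function vanishes on the ball. -/
theorem eq_zero_of_norm_fderiv_le {n : E → K} {x₀ : E} {ε C : ℝ}
    (hd : ∀ y ∈ Metric.ball x₀ ε, DifferentiableAt ℝ n y) (h0 : n x₀ = 0)
    (hC : ∀ y ∈ Metric.ball x₀ ε, ∀ h, ‖fderiv ℝ n y h‖ ≤ C * ‖n y‖ * ‖h‖) {x : E}
    (hx : x ∈ Metric.ball x₀ ε) : n x = 0 := by
  let γ : ℝ → E := fun t => x₀ + t • (x - x₀)
  have hγd : ∀ t, HasDerivAt γ (x - x₀) t := fun t => by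
    have h := ((hasDerivAt_id t).smul_const (x - x₀)).const_add x₀
    rwa [one_smul] at h
  have hγ : ∀ t ∈ Icc (0 : ℝ) 1, γ t ∈ Metric.ball x₀ ε := fun t ht => by
    rw [mem_ball_iff_norm] at hx ⊢
    simp only [γ, add_sub_cancel_left, norm_smul, Real.norm_eq_abs, abs_of_nonneg ht.1]
    exact (mul_le_of_le_one_left (norm_nonneg _) ht.2).trans_lt hx
  have hn : ∀ t ∈ Icc (0 : ℝ) 1, HasDerivAt (n ∘ γ) (fderiv ℝ n (γ t) (x - x₀)) t := fun t ht =>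
    (hd _ (hγ t ht)).hasFDerivAt.comp_hasDerivAt t (hγd t)
  -- Grönwall on the segment from `x₀` to `x`, whose velocity `x - x₀` enters the constant.
  have h1 := eq_zero_of_abs_deriv_le_mul_abs_self_of_eq_zero_right (f := n ∘ γ)
    (f' := fun t => fderiv ℝ n (γ t) (x - x₀)) (K := C * ‖x - x₀‖) (a := 0) (b := 1)
    (fun t ht => (hn t ht).continuousAt.continuousWithinAt)
    (fun t ht => (hn t (Ico_subset_Icc_self ht)).hasDerivWithinAt) (by simp [γ, h0])
    (fun t ht => (hC _ (hγ t (Ico_subset_Icc_self ht)) _).trans_eq (by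
      simp only [Function.comp_apply]; ring)) 1 (by simp)
  simpa [γ] using h1

/-- A smooth implicit function theorem with smoothness in a neighbourhood. -/
theorem exists_implicit_function [CompleteSpace E] [CompleteSpace K] {G : E × K → K}
    {O : Set (E × K)} (hO : IsOpen O) (hG : ContDiffOn ℝ ∞ G O) {x₀ : E} (hx₀ : (x₀, 0) ∈ O)
    (h0 : G (x₀, 0) = 0) (hd : HasFDerivAt (fun ξ => G (x₀, ξ)) (.id ℝ K) 0) :
    ∃ (U : Set E) (ξ : E → K), IsOpen U ∧ x₀ ∈ U ∧ ContDiffOn ℝ ∞ ξ U ∧ ξ x₀ = 0 ∧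
      ∀ x ∈ U, (x, ξ x) ∈ O ∧ G (x, ξ x) = 0 := by
  -- The inverse function theorem is applied to `H`, whose derivative at the base point is
  -- triangular with identities on the diagonal.
  let H : E × K → E × K := fun z => (z.1, G z)
  have hH : ContDiffOn ℝ ∞ H O := contDiffOn_fst.prodMk hG
  have hH0 : ContDiffAt ℝ ∞ H (x₀, 0) := hH.contDiffAt (hO.mem_nhds hx₀)
  have hG0 := ((hG.contDiffAt (hO.mem_nhds hx₀)).differentiableAt (by simp)).hasFDerivAt
  let e : (E × K) ≃L[ℝ] (E × K) := (ContinuousLinearEquiv.refl ℝ E).skewProd (.refl ℝ K)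
    ((fderiv ℝ G (x₀, 0)).comp (.inl ℝ E K))
  have h1 : (fderiv ℝ G (x₀, 0)).comp (.inr ℝ E K) = .id ℝ K :=
    (hG0.comp (0 : K) (hasFDerivAt_prodMk_right x₀ 0)).unique hd
  have he : HasFDerivAt H (e : (E × K) →L[ℝ] (E × K)) (x₀, 0) := by
    refine (hasFDerivAt_fst.prodMk hG0).congr_fderiv ?_
    ext v
    · rfl
    · change fderiv ℝ G (x₀, 0) (v, 0) = 0 + fderiv ℝ G (x₀, 0) (v, 0)
      rw [zero_add]
    · rfl
    · change fderiv ℝ G (x₀, 0) (0, v) = v + fderiv ℝ G (x₀, 0) (0, 0)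
      rw [Prod.mk_zero_zero, map_zero, add_zero]
      exact DFunLike.congr_fun h1 v
  let h := hH0.toOpenPartialHomeomorph H he (by simp)
  -- The points where the derivative of `H` is invertible: there the local inverse is smooth, which
  -- gives smoothness on an open set instead of only at `x₀`.
  let O' : Set (E × K) := O ∩ fderiv ℝ H ⁻¹' range ((↑) : ((E × K) ≃L[ℝ] (E × K)) → _)
  have hO' : IsOpen O' :=
    (hH.continuousOn_fderiv_of_isOpen hO (by simp)).isOpen_inter_preimage hO
      ContinuousLinearEquiv.isOpen
  have hm : (x₀, 0) ∈ h.source := hH0.mem_toOpenPartialHomeomorph_source he (by simp)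
  have hHx : h (x₀, 0) = (x₀, 0) := Prod.ext rfl h0
  have hm' : (x₀, (0 : K)) ∈ h.target := by
    rw [← hHx]
    exact h.map_source hm
  have hs0 : h.symm (x₀, 0) = (x₀, 0) := by
    conv_lhs => rw [← hHx]
    exact h.left_inv hm
  have hT : IsOpen (h.target ∩ h.symm ⁻¹' O') := h.isOpen_inter_preimage_symm hO'
  have hc : Continuous fun x : E => (x, (0 : K)) := by fun_prop
  have hsm : ∀ y ∈ h.target ∩ h.symm ⁻¹' O', ContDiffAt ℝ ∞ h.symm y := by
    rintro y ⟨hy, hyO, e', he'⟩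
    have h2 : ContDiffAt ℝ ∞ H (h.symm y) := hH.contDiffAt (hO.mem_nhds hyO)
    refine h.contDiffAt_symm (f₀' := e') hy ?_ h2
    rw [he']
    exact (h2.differentiableAt (by simp)).hasFDerivAt
  have hfst : ∀ x, (x, (0 : K)) ∈ h.target → h.symm (x, 0) = (x, (h.symm (x, 0)).2) ∧
      G (h.symm (x, 0)) = 0 := fun x hx => by
    have h2 : H (h.symm (x, 0)) = (x, 0) := h.right_inv hx
    exact ⟨Prod.ext (show (H (h.symm (x, 0))).1 = x by rw [h2]) rfl, congrArg Prod.snd h2⟩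
  refine ⟨(fun x => (x, (0 : K))) ⁻¹' (h.target ∩ h.symm ⁻¹' O'), fun x => (h.symm (x, 0)).2,
    hT.preimage hc, ⟨hm', ?_⟩, fun x hx => ?_, ?_, fun x hx => ?_⟩
  · rw [mem_preimage, hs0]
    exact ⟨hx₀, e, he.fderiv.symm⟩
  · refine (contDiffAt_snd.comp x ((hsm _ hx).comp x ?_)).contDiffWithinAt
    exact contDiffAt_id.prodMk contDiffAt_const
  · exact congrArg Prod.snd hs0
  · obtain ⟨h2, h3⟩ := hfst x hx.1
    have h4 := hx.2.1
    rw [← h2]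
    exact ⟨h4, h3⟩

/-- Project `W` onto the range of `D`, then apply a linear section of `D` over its range. Thus `D r`
is a projection onto the range of `D`, and `r` stands in for `D⁻¹` when `D` is neither injective nor
surjective. -/
theorem exists_generalizedInverse {V W : Type*} [AddCommGroup V] [Module ℝ V] [AddCommGroup W]
    [Module ℝ W] (D : V →ₗ[ℝ] W) : ∃ r : W →ₗ[ℝ] V, ∀ a, D (r (D a)) = D a := by
  obtain ⟨s, hs⟩ := D.rangeRestrict.exists_rightInverse_of_surjective D.range_rangeRestrict
  obtain ⟨π', hπ⟩ := (LinearMap.range D).subtype.exists_leftInverse_of_injective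
    (Submodule.ker_subtype _)
  refine ⟨s ∘ₗ π', fun a => ?_⟩
  have h1 : π' (D a) = D.rangeRestrict a := LinearMap.congr_fun hπ (D.rangeRestrict a)
  have h2 := congrArg Subtype.val (LinearMap.congr_fun hs (D.rangeRestrict a))
  rw [LinearMap.comp_apply, h1]
  exact h2

/-- The infinitesimal action of an endomorphism `a` of `K` on a bilinear operation. -/
def bilinActAux (b : K →L[ℝ] K →L[ℝ] K) (a : K →L[ℝ] K) : K →L[ℝ] K →L[ℝ] K :=
  b.comp a + (b.flip.comp a).flip - (ContinuousLinearMap.compL ℝ K K K a).comp b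

theorem bilinActAux_apply (b : K →L[ℝ] K →L[ℝ] K) (a : K →L[ℝ] K) (v w : K) :
    bilinActAux b a v w = b (a v) w + b v (a w) - a (b v w) := rfl

theorem norm_bilinActAux_le (b : K →L[ℝ] K →L[ℝ] K) (a : K →L[ℝ] K) :
    ‖bilinActAux b a‖ ≤ 3 * ‖b‖ * ‖a‖ := by
  refine ContinuousLinearMap.opNorm_le_bound₂ _ (by positivity) fun v w => ?_
  rw [bilinActAux_apply]
  have h1 : ‖b (a v) w‖ ≤ ‖b‖ * (‖a‖ * ‖v‖) * ‖w‖ := (b.le_opNorm₂ _ _).trans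
    (by gcongr; exact a.le_opNorm v)
  have h2 : ‖b v (a w)‖ ≤ ‖b‖ * ‖v‖ * (‖a‖ * ‖w‖) := (b.le_opNorm₂ _ _).trans
    (by gcongr; exact a.le_opNorm w)
  have h3 : ‖a (b v w)‖ ≤ ‖a‖ * (‖b‖ * ‖v‖ * ‖w‖) := (a.le_opNorm _).trans
    (by gcongr; exact b.le_opNorm₂ v w)
  calc _ ≤ ‖b (a v) w‖ + ‖b v (a w)‖ + ‖a (b v w)‖ :=
        (norm_sub_le _ _).trans (by gcongr; exact norm_add_le _ _)
    _ ≤ _ := by linarith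

/-- The infinitesimal action of the endomorphisms of `K` on a bilinear operation. -/
def bilinAct (b : K →L[ℝ] K →L[ℝ] K) : (K →L[ℝ] K) →L[ℝ] (K →L[ℝ] K →L[ℝ] K) :=
  LinearMap.mkContinuous
    { toFun := bilinActAux b
      map_add' := fun a a' => by
        ext v w
        simp only [bilinActAux_apply, add_apply, map_add]
        abel
      map_smul' := fun r a => by
        ext v w
        simp [bilinActAux_apply, smul_sub] } (3 * ‖b‖) (norm_bilinActAux_le b)

theorem bilinAct_apply (b : K →L[ℝ] K →L[ℝ] K) (a : K →L[ℝ] K) (v w : K) :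
    bilinAct b a v w = b (a v) w + b v (a w) - a (b v w) := rfl

theorem norm_bilinAct_apply_le (b : K →L[ℝ] K →L[ℝ] K) (a : K →L[ℝ] K) :
    ‖bilinAct b a‖ ≤ 3 * ‖b‖ * ‖a‖ := norm_bilinActAux_le b a

/-- The transform of a bilinear operation on `K` by an automorphism of `K`. -/
def gauge (Ψ : K →L[ℝ] K) (b : K →L[ℝ] K →L[ℝ] K) : K →L[ℝ] K →L[ℝ] K :=
  (ContinuousLinearMap.compL ℝ K K K (Ring.inverse Ψ)).comp (b.bilinearComp Ψ Ψ)

theorem gauge_apply (Ψ : K →L[ℝ] K) (b : K →L[ℝ] K →L[ℝ] K) (v w : K) :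
    gauge Ψ b v w = Ring.inverse Ψ (b (Ψ v) (Ψ w)) := rfl

theorem apply_gauge {Ψ : K →L[ℝ] K} (hΨ : IsUnit Ψ) (b : K →L[ℝ] K →L[ℝ] K) (v w : K) :
    Ψ (gauge Ψ b v w) = b (Ψ v) (Ψ w) := by
  rw [gauge_apply]
  exact DFunLike.congr_fun (Ring.mul_inverse_cancel Ψ hΨ) _

theorem gauge_one (b : K →L[ℝ] K →L[ℝ] K) : gauge 1 b = b := by
  ext v w
  rw [gauge_apply, Ring.inverse_one]
  rfl

variable [FiniteDimensional ℝ K]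

theorem contDiffOn_gauge {X : Type*} [NormedAddCommGroup X] [NormedSpace ℝ X] {s : Set X}
    {Ψ : X → K →L[ℝ] K} {b : X → K →L[ℝ] K →L[ℝ] K} (hΨ : ContDiffOn ℝ ∞ Ψ s)
    (hb : ContDiffOn ℝ ∞ b s) (hu : ∀ x ∈ s, IsUnit (Ψ x)) :
    ContDiffOn ℝ ∞ (fun x => gauge (Ψ x) (b x)) s := by
  have := FiniteDimensional.complete ℝ K
  refine contDiffOn_clm_apply.2 fun v => contDiffOn_clm_apply.2 fun w => ?_
  have hi : ContDiffOn ℝ ∞ (fun x => Ring.inverse (Ψ x)) s := fun x hx => by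
    obtain ⟨u, hu⟩ := hu x hx
    have h := contDiffAt_ringInverse ℝ u (n := ∞)
    rw [hu] at h
    exact h.comp_contDiffWithinAt x (hΨ x hx)
  exact hi.clm_apply ((hb.clm_apply (hΨ.clm_apply contDiffOn_const)).clm_apply
    (hΨ.clm_apply contDiffOn_const))

/-- Product rule for `Ψ⁻¹ b(Ψ·, Ψ·)` at `Ψ = 1`, where inversion has derivative `-1`. So `bilinAct
b` is the linearization of the orbit map of `b`. -/
theorem hasFDerivAt_gauge_one (b : K →L[ℝ] K →L[ℝ] K) :
    HasFDerivAt (fun ξ : K →L[ℝ] K => gauge (1 + ξ) b) (bilinAct b) 0 := by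
  have := FiniteDimensional.complete ℝ K
  have hone : HasFDerivAt (fun ξ : K →L[ℝ] K => 1 + ξ) (.id ℝ (K →L[ℝ] K)) 0 :=
    (hasFDerivAt_id 0).const_add 1
  have hO : IsOpen {ξ : K →L[ℝ] K | IsUnit (1 + ξ)} :=
    Units.isOpen.preimage (continuous_const.add continuous_id)
  have h0 : (0 : K →L[ℝ] K) ∈ {ξ : K →L[ℝ] K | IsUnit (1 + ξ)} := by simp
  have h1 : DifferentiableAt ℝ (fun ξ : K →L[ℝ] K => gauge (1 + ξ) b) 0 :=
    ((contDiffOn_gauge (contDiffOn_const.add contDiffOn_id) contDiffOn_const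
      fun ξ hξ => hξ).contDiffAt (hO.mem_nhds h0)).differentiableAt (by simp)
  refine h1.hasFDerivAt.congr_fderiv ?_
  ext a v w
  have happ : ∀ v : K, HasFDerivAt (fun ξ : K →L[ℝ] K => (1 + ξ) v)
      (ContinuousLinearMap.apply ℝ K v) 0 := fun v => by
    have h := hone.clm_apply (hasFDerivAt_const v (0 : K →L[ℝ] K))
    refine h.congr_fderiv ?_
    ext a
    simp
  have hinv : HasFDerivAt (fun ξ : K →L[ℝ] K => Ring.inverse (1 + ξ))
      (-ContinuousLinearMap.id ℝ (K →L[ℝ] K)) 0 := by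
    have h := hasFDerivAt_ringInverse (𝕜 := ℝ) (1 : (K →L[ℝ] K)ˣ)
    have h' : HasFDerivAt Ring.inverse (-ContinuousLinearMap.mulLeftRight ℝ (K →L[ℝ] K)
      ↑(1 : (K →L[ℝ] K)ˣ)⁻¹ ↑(1 : (K →L[ℝ] K)ˣ)⁻¹) ((1 : K →L[ℝ] K) + 0) := by simpa using h
    refine (h'.comp (0 : K →L[ℝ] K) hone).congr_fderiv ?_
    ext a v
    simp
  have h2 := hinv.clm_apply (((hasFDerivAt_const b (0 : K →L[ℝ] K)).clm_apply (happ v)).clm_apply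
    (happ w))
  have h3 := (h1.hasFDerivAt.clm_apply (hasFDerivAt_const v (0 : K →L[ℝ] K))).clm_apply
    (hasFDerivAt_const w (0 : K →L[ℝ] K))
  have h4 := DFunLike.congr_fun (h3.unique h2) a
  simp only [add_zero, Ring.inverse_one, ContinuousLinearMap.comp_zero, zero_add] at h4
  rw [bilinAct_apply]
  refine h4.trans ?_
  change b v (a w) + (b (a v) w + 0) + -a (b v w) = _
  abel

/-- The equation `dc = c · Γ` is gauge covariant, with `Γ` changing like a connection form to
`Ψ⁻¹(ΓΨ + dΨ)`. It is obtained by differentiating `Ψ(c'(v, w)) = c(Ψv, Ψw)`, which avoids the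
derivative of `Ψ⁻¹`. -/
theorem fderiv_gauge {U : Set E} (hU : IsOpen U) {c : E → K →L[ℝ] K →L[ℝ] K}
    (hc : ContDiffOn ℝ ∞ c U) {Ψ : E → K →L[ℝ] K} (hΨ : ContDiffOn ℝ ∞ Ψ U)
    (hu : ∀ y ∈ U, IsUnit (Ψ y)) {y : E} (hy : y ∈ U) {h : E} {Γ : K →L[ℝ] K}
    (hΓ : fderiv ℝ c y h = bilinAct (c y) Γ) :
    fderiv ℝ (fun y => gauge (Ψ y) (c y)) y h = bilinAct (gauge (Ψ y) (c y))
      (Ring.inverse (Ψ y) * (Γ * Ψ y + fderiv ℝ Ψ y h)) := by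
  have hd : ∀ {X : Type _} [NormedAddCommGroup X] [NormedSpace ℝ X] {f : E → X},
      ContDiffOn ℝ ∞ f U → HasFDerivAt f (fderiv ℝ f y) y := fun hf =>
    ((hf.contDiffAt (hU.mem_nhds hy)).differentiableAt (by simp)).hasFDerivAt
  have h1 := hd (contDiffOn_gauge hΨ hc hu)
  have h2 := hd hΨ
  have h3 := hd hc
  set c' : E → K →L[ℝ] K →L[ℝ] K := fun y => gauge (Ψ y) (c y)
  set A := Ring.inverse (Ψ y) * (Γ * Ψ y + fderiv ℝ Ψ y h)
  have hA : ∀ v, Ψ y (A v) = Γ (Ψ y v) + fderiv ℝ Ψ y h v := fun v =>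
    DFunLike.congr_fun (Ring.mul_inverse_cancel_left (Ψ y) (Γ * Ψ y + fderiv ℝ Ψ y h) (hu y hy)) v
  ext v w
  have hv : ∀ v : K, HasFDerivAt (fun _ : E => v) (0 : E →L[ℝ] K) y := fun v =>
    hasFDerivAt_const v y
  have e1 := h2.clm_apply ((h1.clm_apply (hv v)).clm_apply (hv w))
  have e2 := (h3.clm_apply (h2.clm_apply (hv v))).clm_apply (h2.clm_apply (hv w))
  have heq : (fun y => Ψ y (c' y v w)) =ᶠ[𝓝 y] fun y => c y (Ψ y v) (Ψ y w) := by
    filter_upwards [hU.mem_nhds hy] with z hz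
    exact apply_gauge (hu z hz) _ _ _
  have e3 := DFunLike.congr_fun (e1.unique (e2.congr_of_eventuallyEq heq)) h
  simp only [ContinuousLinearMap.comp_zero, zero_add, add_apply,
    ContinuousLinearMap.comp_apply, ContinuousLinearMap.flip_apply, hΓ, bilinAct_apply] at e3
  have hinj : Function.Injective (Ψ y) := fun a b hab => by
    have hi : ∀ a, Ring.inverse (Ψ y) (Ψ y a) = a := fun a =>
      DFunLike.congr_fun (Ring.inverse_mul_cancel _ (hu y hy)) a
    rw [← hi a, ← hi b, hab]
  apply hinj
  have hg : ∀ v w, Ψ y (c' y v w) = c y (Ψ y v) (Ψ y w) := apply_gauge (hu y hy) _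
  rw [bilinAct_apply, map_sub, map_add, hg, hg, hA, hA, hA, hg, map_add, map_add, add_apply]
  rw [eq_sub_iff_add_eq]
  rw [← sub_eq_zero] at e3 ⊢
  rw [← e3]
  abel

/-- If the derivative of a family of bilinear operations on `K` is given by the infinitesimal
action of endomorphisms of `K`, then the family is locally constant up to automorphisms of `K`. -/
theorem exists_trivialization_of_parallel [FiniteDimensional ℝ E] {U : Set E} (hU : IsOpen U)
    {x₀ : E} (hx₀ : x₀ ∈ U) {c : E → K →L[ℝ] K →L[ℝ] K} (hc : ContDiffOn ℝ ∞ c U)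
    {Γ : E → E →L[ℝ] K →L[ℝ] K} (hΓ : ContinuousOn Γ U)
    (hpar : ∀ y ∈ U, ∀ h, fderiv ℝ c y h = bilinAct (c y) (Γ y h)) :
    ∃ (U' : Set E) (Ψ : E → K →L[ℝ] K), IsOpen U' ∧ x₀ ∈ U' ∧ U' ⊆ U ∧ ContDiffOn ℝ ∞ Ψ U' ∧
      (∀ y ∈ U', IsUnit (Ψ y)) ∧
      ∀ y ∈ U', ∀ v w, Ψ y (c x₀ v w) = c y (Ψ y v) (Ψ y w) := by
  have := FiniteDimensional.complete ℝ E
  have := FiniteDimensional.complete ℝ K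
  set D : (K →L[ℝ] K) →L[ℝ] (K →L[ℝ] K →L[ℝ] K) := bilinAct (c x₀) with hDdef
  obtain ⟨r₀, hr₀⟩ := exists_generalizedInverse D.toLinearMap
  let r : (K →L[ℝ] K →L[ℝ] K) →L[ℝ] (K →L[ℝ] K) := LinearMap.toContinuousLinearMap r₀
  have hr : ∀ a, D (r (D a)) = D a := hr₀
  -- The full equation `gauge (1 + ξ) (c y) = c x₀` is replaced by its image under `r`. The
  -- correction `ξ - r D ξ` makes the derivative in `ξ` equal to `r D + (1 - r D) = 1`.
  let G : E × (K →L[ℝ] K) → (K →L[ℝ] K) := fun z =>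
    r (gauge (1 + z.2) (c z.1) - c x₀) + (z.2 - (r.comp D) z.2)
  let O : Set (E × (K →L[ℝ] K)) := Prod.fst ⁻¹' U ∩ {z | IsUnit (1 + z.2)}
  have hO : IsOpen O := (hU.preimage continuous_fst).inter
    (Units.isOpen.preimage (continuous_const.add continuous_snd))
  have hG : ContDiffOn ℝ ∞ G O := by
    refine (r.contDiff.comp_contDiffOn ((contDiffOn_gauge (contDiffOn_const.add contDiffOn_snd)
      (hc.comp contDiffOn_fst fun z hz => hz.1) fun z hz => hz.2).sub contDiffOn_const)).add ?_
    exact contDiffOn_snd.sub ((r.comp D).contDiff.comp_contDiffOn contDiffOn_snd)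
  have hG0 : G (x₀, 0) = 0 := by
    simp only [G, add_zero, gauge_one, sub_self, map_zero]
  have hGd : HasFDerivAt (fun ξ => G (x₀, ξ)) (.id ℝ (K →L[ℝ] K)) 0 := by
    have h1 := r.hasFDerivAt.comp (0 : K →L[ℝ] K)
      ((hasFDerivAt_gauge_one (c x₀)).sub_const (c x₀))
    have h2 := (hasFDerivAt_id (𝕜 := ℝ) (0 : K →L[ℝ] K)).sub (r.comp D).hasFDerivAt
    refine (h1.add h2).congr_fderiv ?_
    exact add_sub_cancel _ _
  obtain ⟨U₁, ξ, hU₁, hx₁, hξ, hξ0, hGξ⟩ := exists_implicit_function hO hG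
    (x₀ := x₀) ⟨hx₀, by simp⟩ hG0 hGd
  let Ψ : E → K →L[ℝ] K := fun y => 1 + ξ y
  have hΨ : ContDiffOn ℝ ∞ Ψ U₁ := contDiffOn_const.add hξ
  have hU₁U : U₁ ⊆ U := fun y hy => (hGξ y hy).1.1
  have hu : ∀ y ∈ U₁, IsUnit (Ψ y) := fun y hy => (hGξ y hy).1.2
  have hc₁ := hc.mono hU₁U
  have hcΨ := contDiffOn_gauge hΨ hc₁ hu
  let n : E → K →L[ℝ] K →L[ℝ] K := fun y => gauge (Ψ y) (c y) - c x₀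
  have hn : ContDiffOn ℝ ∞ n U₁ := hcΨ.sub contDiffOn_const
  have hnd : ∀ y ∈ U₁, DifferentiableAt ℝ n y := fun y hy =>
    (hn.contDiffAt (hU₁.mem_nhds hy)).differentiableAt (by simp)
  have hn0 : n x₀ = 0 := by
    simp only [n, Ψ, hξ0, add_zero, gauge_one, sub_self]
  -- Applying `D` to `G = 0` kills the correction, because `D r D = D`.
  have hDrn : ∀ y ∈ U₁, (D.comp r) (n y) = 0 := fun y hy => by
    have h1 : r (n y) + (ξ y - r (D (ξ y))) = 0 := (hGξ y hy).2
    have h2 : D (r (n y)) + (D (ξ y) - D (r (D (ξ y)))) = 0 := by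
      rw [← map_sub, ← map_add, h1, map_zero]
    rw [hr, sub_self, add_zero] at h2
    exact h2
  let A : E → E → K →L[ℝ] K := fun y h =>
    Ring.inverse (Ψ y) * (Γ y h * Ψ y + fderiv ℝ Ψ y h)
  -- The transformed operation is `c x₀ + n`, and `bilinAct` is linear in the operation.
  have hDn : ∀ y ∈ U₁, ∀ h, fderiv ℝ n y h = D (A y h) + bilinAct (n y) (A y h) := by
    intro y hy h
    have h1 : fderiv ℝ n y h = bilinAct (gauge (Ψ y) (c y)) (A y h) := by
      simp only [n, fderiv_sub_const]
      exact fderiv_gauge hU₁ hc₁ hΨ hu hy (hpar y (hU₁U hy) h)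
    rw [h1]
    ext v w
    simp only [hDdef, n, add_apply, bilinAct_apply, sub_apply, map_sub]
    abel
  have hDrD : ∀ y ∈ U₁, ∀ h, (D.comp r) (fderiv ℝ n y h) = 0 := by
    intro y hy h
    have h1 := (D.comp r).hasFDerivAt.comp y (hnd y hy).hasFDerivAt
    have h2 : (D.comp r) ∘ n =ᶠ[𝓝 y] fun _ => 0 := by
      filter_upwards [hU₁.mem_nhds hy] with z hz
      exact hDrn z hz
    exact DFunLike.congr_fun (h1.unique ((hasFDerivAt_const _ _).congr_of_eventuallyEq h2)) h
  let f : E → ℝ := fun y => ‖Ring.inverse (Ψ y)‖ * (‖Γ y‖ * ‖Ψ y‖ + ‖fderiv ℝ Ψ y‖)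
  have hf : ContinuousAt f x₀ := by
    have h1 : ContinuousAt Ψ x₀ := hΨ.continuousOn.continuousAt (hU₁.mem_nhds hx₁)
    have h2 : ContinuousAt (fun y => Ring.inverse (Ψ y)) x₀ := by
      obtain ⟨u, huu⟩ := hu x₀ hx₁
      have h := NormedRing.inverse_continuousAt u
      rw [huu] at h
      exact h.comp h1
    have h3 : ContinuousAt Γ x₀ := hΓ.continuousAt (hU.mem_nhds hx₀)
    have h4 : ContinuousAt (fderiv ℝ Ψ) x₀ :=
      (hΨ.continuousOn_fderiv_of_isOpen hU₁ (by simp)).continuousAt (hU₁.mem_nhds hx₁)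
    exact h2.norm.mul ((h3.norm.mul h1.norm).add h4.norm)
  have hA : ∀ y h, ‖A y h‖ ≤ f y * ‖h‖ := fun y h => by
    calc ‖A y h‖ ≤ ‖Ring.inverse (Ψ y)‖ * (‖Γ y h * Ψ y‖ + ‖fderiv ℝ Ψ y h‖) :=
          (norm_mul_le _ _).trans (by gcongr; exact norm_add_le _ _)
      _ ≤ ‖Ring.inverse (Ψ y)‖ * (‖Γ y‖ * ‖h‖ * ‖Ψ y‖ + ‖fderiv ℝ Ψ y‖ * ‖h‖) := by
          gcongr
          · exact (norm_mul_le _ _).trans (by gcongr; exact (Γ y).le_opNorm h)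
          · exact (fderiv ℝ Ψ y).le_opNorm h
      _ = f y * ‖h‖ := by simp only [f]; ring
  have hfC : ∀ᶠ y in 𝓝 x₀, f y < f x₀ + 1 := hf.eventually_lt_const (lt_add_one _)
  obtain ⟨ε, hε, hball⟩ := Metric.mem_nhds_iff.1 (Filter.inter_mem (hU₁.mem_nhds hx₁) hfC)
  refine ⟨Metric.ball x₀ ε, Ψ, Metric.isOpen_ball, Metric.mem_ball_self hε,
    fun y hy => hU₁U (hball hy).1, hΨ.mono fun y hy => (hball hy).1,
    fun y hy => hu y (hball hy).1, fun y hy v w => ?_⟩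
  -- In the constant, `1 + ‖D r‖` bounds `1 - D r`, the `3` counts the terms of `bilinAct`, and `f
  -- x₀ + 1` bounds `A` on the ball by continuity of `f`.
  have hzero : n y = 0 := by
    refine eq_zero_of_norm_fderiv_le (C := (1 + ‖D.comp r‖) * (3 * (f x₀ + 1)))
      (fun z hz => hnd z (hball hz).1) hn0 (fun z hz h => ?_) hy
    have hz1 := (hball hz).1
    have hz2 : f z ≤ f x₀ + 1 := le_of_lt (hball hz).2
    have h1 := hDn z hz1 h
    have h2 := hDrD z hz1 h
    -- Since `D r` kills `dn` and fixes `D A`, applying `1 - D r` to `dn = D A + n · A` removes the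
    -- only term that is not controlled by `n`.
    have h3 : (D.comp r) (D (A z h)) = D (A z h) := hr _
    rw [h1, map_add, h3] at h2
    have h4 : fderiv ℝ n z h = bilinAct (n z) (A z h) - (D.comp r) (bilinAct (n z) (A z h)) := by
      rw [h1, eq_neg_of_add_eq_zero_left h2]
      abel
    have h5 : ‖A z h‖ ≤ (f x₀ + 1) * ‖h‖ := (hA z h).trans (by gcongr)
    calc ‖fderiv ℝ n z h‖ ≤ ‖bilinAct (n z) (A z h)‖ + ‖D.comp r‖ * ‖bilinAct (n z) (A z h)‖ := by
          rw [h4]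
          exact (norm_sub_le _ _).trans (by gcongr; exact (D.comp r).le_opNorm _)
      _ = (1 + ‖D.comp r‖) * ‖bilinAct (n z) (A z h)‖ := by ring
      _ ≤ (1 + ‖D.comp r‖) * (3 * ‖n z‖ * ((f x₀ + 1) * ‖h‖)) := by
          gcongr
          exact (norm_bilinAct_apply_le _ _).trans (by gcongr)
      _ = _ := by ring
  have h1 : gauge (Ψ y) (c y) = c x₀ := sub_eq_zero.1 hzero
  rw [← h1]
  exact apply_gauge (hu y (hball hy).1) _ _ _

end Analysis

/-! ### Local triviality of the kernel of a transitive Lie algebroid -/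

section LocalTriviality

set_option maxSynthPendingDepth 3

variable {E : Type vE} [NormedAddCommGroup E] [NormedSpace ℝ E]
  {M : Type vM} [TopologicalSpace M] [ChartedSpace E M] [IsManifold 𝓘(ℝ, E) ∞ M]
  {F : Type vF} [NormedAddCommGroup F] [NormedSpace ℝ F] [FiniteDimensional ℝ F]

/-- The matrix of the anchor in a frame of the Lie algebroid and in a chart. -/
theorem LieAlgebroid.contMDiffOn_anchorMatrix {A : LieAlgebroid E M F} {U : Set M}
    (ψ : LocalFrame A.toSmoothVectorBundle U) (x₀ : M) :
    ContMDiffOn 𝓘(ℝ, E) 𝓘(ℝ, F →L[ℝ] E) ∞ (fun y => LinearMap.toContinuousLinearMap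
      ((mfderiv 𝓘(ℝ, E) 𝓘(ℝ, E) (chartAt E x₀) y).toLinearMap ∘ₗ A.anchor y ∘ₗ ψ.inv y :
        F →ₗ[ℝ] E)) (U ∩ (chartAt E x₀).source) := by
  refine contMDiffOn_clm_of_apply fun v => ?_
  have h1 : ContMDiffOn 𝓘(ℝ, E) 𝓘(ℝ, E).tangent ∞
      (fun y => (⟨y, A.anchor y (ψ.inv y v)⟩ : TangentBundle 𝓘(ℝ, E) M)) U :=
    A.smooth_anchor.comp_contMDiffOn
      (ψ.smooth_inv.comp (contMDiffOn_id.prodMk contMDiffOn_const) fun y hy => hy)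
  let e := trivializationAt E (TangentSpace 𝓘(ℝ, E) (M := M)) x₀
  have h2 : ContMDiffOn 𝓘(ℝ, E).tangent (𝓘(ℝ, E).prod 𝓘(ℝ, E)) ∞ e e.source := e.contMDiffOn
  have h3 := (contMDiff_snd (I := 𝓘(ℝ, E)) (J := 𝓘(ℝ, E)) (M := M) (N := E)
    (n := ∞)).comp_contMDiffOn (h2.comp (h1.mono inter_subset_left) fun y hy => by
      rw [mem_preimage, e.mem_source]
      exact hy.2)
  refine h3.congr fun y hy => ?_
  have h4 := TangentBundle.continuousLinearMapAt_trivializationAt (I := 𝓘(ℝ, E)) (𝕜 := ℝ) hy.2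
  have h5 : mfderiv 𝓘(ℝ, E) 𝓘(ℝ, E) (chartAt E x₀) y = e.continuousLinearMapAt ℝ y := h4.symm
  refine (DFunLike.congr_fun h5 (A.anchor y (ψ.inv y v))).trans ?_
  exact congrFun (e.coe_linearMapAt_of_mem (R := ℝ) (b := y) hy.2) _

variable [FiniteDimensional ℝ E] [T2Space M]
  {K : Type*} [NormedAddCommGroup K] [NormedSpace ℝ K] [FiniteDimensional ℝ K]
  {A : LieAlgebroid E M F} {L : SmoothVectorBundle E M K} {j : ∀ x, L.Fib x →ₗ[ℝ] A.Fib x}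

/-- The kernel of the anchor of a transitive Lie algebroid is locally trivial as a bundle of Lie
algebras. -/
theorem IsBundleKernel.exists_lieTrivialization (hj : IsBundleKernel L A.anchor j)
    (htrans : A.IsTransitive) (x₀ : M) : ∃ U : Set M, IsOpen U ∧ x₀ ∈ U ∧
    ∃ Φ : ∀ x : M, L.Fib x₀ →ₗ[ℝ] L.Fib x,
      (∀ x ∈ U, Function.Bijective (Φ x)) ∧
      (∀ x ∈ U, ∀ v w, Φ x (hj.lie x₀ v w) = hj.lie x (Φ x v) (Φ x w)) ∧
      ∀ v : L.Fib x₀, ContMDiffOn 𝓘(ℝ, E) (𝓘(ℝ, E).prod 𝓘(ℝ, K)) ∞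
        (fun x => (⟨x, Φ x v⟩ : L.Total)) U := by
  obtain ⟨U, φ, ψ, c, Γ, hx₀, hc, hΓ, hclie, hcΓ⟩ := hj.exists_structureFunctions x₀
  let γ := chartAt E x₀
  have hQ := A.contMDiffOn_anchorMatrix ψ x₀
  set Q : M → F →L[ℝ] E := fun y => LinearMap.toContinuousLinearMap
      ((mfderiv 𝓘(ℝ, E) 𝓘(ℝ, E) (chartAt E x₀) y).toLinearMap ∘ₗ A.anchor y ∘ₗ ψ.inv y :
        F →ₗ[ℝ] E) with hQdef
  have hQs : Function.Surjective (Q x₀) := by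
    intro h
    obtain ⟨t, ht⟩ := (mdifferentiable_chart (I := 𝓘(ℝ, E)) x₀).mfderiv_surjective (mem_chart_source E x₀) h
    obtain ⟨a, ha⟩ := htrans x₀ t
    refine ⟨ψ.coord x₀ a, ?_⟩
    refine Eq.trans ?_ ht
    refine congrArg (mfderiv 𝓘(ℝ, E) 𝓘(ℝ, E) (chartAt E x₀) x₀) ?_
    exact (congrArg (A.anchor x₀) (ψ.inv_coord x₀ hx₀ a)).trans ha
  -- Transitivity enters here: each coordinate direction `h` is the anchor of the vector with frame
  -- coefficients `s (R y h)`, which depend smoothly on `y`.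
  obtain ⟨U₁, s, R, hU₁, hx₁, hU₁U, hR, hQR, -⟩ := exists_smooth_rightInverse
    (ψ.isOpen.inter γ.open_source) hQ ⟨hx₀, mem_chart_source E x₀⟩ hQs
  let O : Set E := γ.target ∩ γ.symm ⁻¹' U₁
  have hO : IsOpen O := γ.symm.isOpen_inter_preimage hU₁
  have hsymm : ContMDiffOn 𝓘(ℝ, E) 𝓘(ℝ, E) ∞ γ.symm O :=
    (contMDiffOn_chart_symm (x := x₀)).mono inter_subset_left
  have hc' : ContDiffOn ℝ ∞ (c ∘ γ.symm) O := contMDiffOn_iff_contDiffOn.1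
    (hc.comp hsymm fun e he => (hU₁U he.2).1)
  have hΓ' : ContinuousOn (fun e => (Γ (γ.symm e)).comp (s.comp (R (γ.symm e)))) O := by
    have h1 : ContMDiffOn 𝓘(ℝ, E) 𝓘(ℝ, E →L[ℝ] K →L[ℝ] K) ∞
        (fun y => (Γ y).comp (s.comp (R y))) U₁ :=
      (hΓ.mono fun y hy => (hU₁U hy).1).clm_comp (contMDiffOn_const.clm_comp hR)
    exact h1.continuousOn.comp hsymm.continuousOn fun e he => he.2
  -- The structure equation in the chart, now valid in every direction, with connection form `Γ ∘ s
  -- ∘ R`.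
  have hpar : ∀ e ∈ O, ∀ h, fderiv ℝ (c ∘ γ.symm) e h = bilinAct ((c ∘ γ.symm) e)
      ((Γ (γ.symm e)).comp (s.comp (R (γ.symm e))) h) := by
    intro e he h
    set y := γ.symm e with hy
    have hyU : y ∈ U₁ := he.2
    have hye : γ y = e := γ.right_inv he.1
    have hys : y ∈ γ.source := γ.map_target he.1
    ext v w
    have hd : HasFDerivAt (c ∘ γ.symm) (fderiv ℝ (c ∘ γ.symm) e) e :=
      ((hc'.contDiffAt (hO.mem_nhds he)).differentiableAt (by simp)).hasFDerivAt
    let ev : (K →L[ℝ] K →L[ℝ] K) →L[ℝ] K :=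
      (ContinuousLinearMap.apply ℝ K w).comp (ContinuousLinearMap.apply ℝ (K →L[ℝ] K) v)
    have hd' := ev.hasFDerivAt.comp e hd
    rw [← hye] at hd'
    have h1 : HasMFDerivAt 𝓘(ℝ, E) 𝓘(ℝ, E) γ y (mfderiv 𝓘(ℝ, E) 𝓘(ℝ, E) γ y) :=
      (mdifferentiableAt_atlas (chart_mem_atlas E x₀) hys).hasMFDerivAt
    have h2 := hd'.hasMFDerivAt.comp y h1
    have h3 : (fun z => c z v w) =ᶠ[𝓝 y] (ev ∘ c ∘ γ.symm) ∘ γ := by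
      filter_upwards [γ.open_source.mem_nhds hys] with z hz
      simp only [Function.comp_apply, γ.left_inv hz]
      rfl
    have h4 := (h2.congr_of_eventuallyEq h3).mfderiv
    have h5 := hcΓ y (hU₁U hyU).1 (s (R y h)) v w
    have h6 := DFunLike.congr_fun h4 (A.anchor y (ψ.inv y (s (R y h))))
    have h7 := h6.symm.trans h5
    have h8 : mfderiv 𝓘(ℝ, E) 𝓘(ℝ, E) γ y (A.anchor y (ψ.inv y (s (R y h)))) = h := hQR y hyU h
    rw [bilinAct_apply]
    refine Eq.trans ?_ h7
    rw [← hye]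
    exact congrArg (fun t => fderiv ℝ (c ∘ γ.symm) (γ y) t v w) h8.symm
  obtain ⟨O', Ψ, hO', hxO', hO'O, hΨ, hΨu, hΨc⟩ := exists_trivialization_of_parallel hO
    (x₀ := γ x₀) ⟨γ.map_source (mem_chart_source E x₀), by
      rw [mem_preimage, γ.left_inv (mem_chart_source E x₀)]
      exact hx₁⟩ hc' hΓ' hpar
  have hφ : ∀ y ∈ U, ∀ v w, φ.inv y (c y v w) = hj.lie y (φ.inv y v) (φ.inv y w) :=
    fun y hy v w => by rw [hclie y hy, φ.inv_coord y hy]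
  have hφ₀ : ∀ v w, φ.coord x₀ (hj.lie x₀ v w) = c x₀ (φ.coord x₀ v) (φ.coord x₀ w) :=
    fun v w => by rw [hclie x₀ hx₀, φ.inv_coord x₀ hx₀, φ.inv_coord x₀ hx₀]
  have hU' : ∀ y ∈ γ.source ∩ γ ⁻¹' O', y ∈ U := fun y hy => by
    have h := (hU₁U (hO'O hy.2).2).1
    rwa [γ.left_inv hy.1] at h
  have hΨc' : ∀ y ∈ γ.source ∩ γ ⁻¹' O', ∀ v w,
      Ψ (γ y) (c x₀ v w) = c y (Ψ (γ y) v) (Ψ (γ y) w) := fun y hy v w => by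
    have h := hΨc (γ y) hy.2 v w
    simp only [Function.comp_apply, γ.left_inv hy.1, γ.left_inv (mem_chart_source E x₀)] at h
    exact h
  refine ⟨γ.source ∩ γ ⁻¹' O', γ.isOpen_inter_preimage hO', ⟨mem_chart_source E x₀, hxO'⟩,
    fun x => φ.inv x ∘ₗ (Ψ (γ x)).toLinearMap ∘ₗ φ.coord x₀, fun x hx => ?_, fun x hx v w => ?_,
    fun v => ?_⟩
  · have h1 : Function.Bijective (φ.inv x) := Function.bijective_iff_has_inverse.2
      ⟨φ.coord x, φ.coord_inv x (hU' x hx), φ.inv_coord x (hU' x hx)⟩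
    have h2 : Function.Bijective (φ.coord x₀) := Function.bijective_iff_has_inverse.2
      ⟨φ.inv x₀, φ.inv_coord x₀ hx₀, φ.coord_inv x₀ hx₀⟩
    have h3 : Function.Bijective (Ψ (γ x)) := by
      refine Function.bijective_iff_has_inverse.2 ⟨(Ring.inverse (Ψ (γ x)) : K →L[ℝ] K),
        fun a => ?_, fun a => ?_⟩
      · exact DFunLike.congr_fun (Ring.inverse_mul_cancel _ (hΨu _ hx.2)) a
      · exact DFunLike.congr_fun (Ring.mul_inverse_cancel _ (hΨu _ hx.2)) a
    exact h1.comp (h3.comp h2)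
  · change φ.inv x (Ψ (γ x) (φ.coord x₀ (hj.lie x₀ v w))) = _
    rw [hφ₀, hΨc' x hx, hφ x (hU' x hx)]
    rfl
  · have h1 : ContMDiffOn 𝓘(ℝ, E) 𝓘(ℝ, K) ∞ (fun x => Ψ (γ x) (φ.coord x₀ v))
        (γ.source ∩ γ ⁻¹' O') :=
      ((contMDiffOn_iff_contDiffOn.2 hΨ).comp ((contMDiffOn_chart (x := x₀)).mono
        inter_subset_left) fun y hy => hy.2).clm_apply contMDiffOn_const
    exact φ.smooth_inv.comp (contMDiffOn_id.prodMk h1) fun y hy => hU' y hy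

/-- The kernel of the anchor of a transitive Lie algebroid is a Lie algebra bundle. -/
theorem LieAlgebroid.exists_kernelLieAlgebraBundle {A : LieAlgebroid.{vE, vM, vF, vV} E M F}
    (htrans : A.IsTransitive) :
    ∃ (k : ℕ) (L : LieAlgebraBundle.{vE, vM, 0, vV} E M (EuclideanSpace ℝ (Fin k)))
      (j : ∀ x, L.Fib x →ₗ[ℝ] A.Fib x),
      IsKernelBundle A A.anchor L j ∧ IsBundleKernel L.toSmoothVectorBundle A.anchor j := by
  -- The rank of the kernel is `dim F - dim E`, nonnegative once there is a point where the anchor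
  -- is surjective; over an empty base any `k` would do.
  obtain ⟨k, hk⟩ : ∃ k : ℕ, Nonempty M → Module.finrank ℝ F = Module.finrank ℝ E + k := by
    rcases isEmpty_or_nonempty M with h | ⟨⟨x⟩⟩
    · exact ⟨0, fun h' => (not_nonempty_iff.2 h h').elim⟩
    · obtain ⟨U, hx, ⟨ψ⟩⟩ := A.exists_localFrame x
      have hs : Function.Surjective (A.anchor x ∘ₗ ψ.inv x) := (htrans x).comp
        fun v => ⟨ψ.coord x v, ψ.inv_coord x hx v⟩
      obtain ⟨k, hk⟩ := Nat.exists_eq_add_of_le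
        (LinearMap.finrank_le_finrank_of_surjective (M' := E) hs)
      exact ⟨k, fun _ => hk⟩
  obtain ⟨L, j, hj⟩ : ∃ (L : SmoothVectorBundle.{vE, vM, 0, vV} E M (EuclideanSpace ℝ (Fin k)))
      (j : ∀ x, L.Fib x →ₗ[ℝ] A.Fib x), IsBundleKernel L A.anchor j :=
    exists_bundleKernel (V := A.toSmoothVectorBundle) (W := tangentVectorBundle E M)
      A.smooth_anchor htrans fun h => by rw [hk h, finrank_euclideanSpace_fin]
  refine ⟨k, { L with
    lie := hj.lie
    lie_self := hj.lie_self
    lie_jacobi := hj.lie_jacobi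
    locally_trivial := hj.exists_lieTrivialization htrans }, j, ?_, hj⟩
  refine ⟨hj.smooth, hj.injective, hj.exact, hj.anchor_eq_zero, fun V W X Y hX hY x => ?_⟩
  have hX' : X = mapSections hj.smooth V := by ext y; exact hX y
  have hY' : Y = mapSections hj.smooth W := by ext y; exact hY y
  rw [hX', hY', ← hj.mapSections_ad]
  exact congrArg (j x) (hj.lie_apply x V W).symm

end LocalTriviality

/-! ### Restricted action and quotient of the kernel -/

section PBGLieAlgebraBundle

variable {EP : Type*} [NormedAddCommGroup EP] [NormedSpace ℝ EP]
  {EM : Type*} [NormedAddCommGroup EM] [NormedSpace ℝ EM]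
  {EG : Type*} [NormedAddCommGroup EG] [NormedSpace ℝ EG]
  {P : Type*} [TopologicalSpace P] [ChartedSpace EP P]
  {M : Type*} [TopologicalSpace M] [ChartedSpace EM M]
  {G : Type*} [TopologicalSpace G] [ChartedSpace EG G] [Group G] [MulAction Gᵐᵒᵖ P]
  {F : Type*} [NormedAddCommGroup F] [NormedSpace ℝ F]
  {K : Type*} [NormedAddCommGroup K] [NormedSpace ℝ K]

/-- An action on a vector bundle restricts to an invariant kernel. -/
theorem IsBundleKernel.exists_restrictedAction {V : SmoothVectorBundle EP P F}
    {T : P → Type*} [∀ u, AddCommGroup (T u)] [∀ u, Module ℝ (T u)]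
    {q : ∀ u, V.Fib u →ₗ[ℝ] T u} {L : SmoothVectorBundle EP P K}
    {j : ∀ u, L.Fib u →ₗ[ℝ] V.Fib u} (hj : IsBundleKernel L q j) (ρ : PBGAction EG G V)
    (hρ : ∀ (g : G) u v, q u v = 0 → q (u <• g) (ρ.R g u v) = 0) :
    ∃ ρL : PBGAction EG G L, ∀ (g : G) u v, j (u <• g) (ρL.R g u v) = ρ.R g u (j u v) := by
  have h : ∀ (g : G) u, ∃ R : L.Fib u →ₗ[ℝ] L.Fib (u <• g),
      ∀ v, j (u <• g) (R v) = ρ.R g u (j u v) := by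
    intro g u
    have hr : ∀ v, (ρ.R g u ∘ₗ j u) v ∈ LinearMap.range (j (u <• g)) := by
      intro v
      rw [hj.exact]
      refine LinearMap.mem_ker.2 (hρ g u _ (LinearMap.mem_ker.1 ?_))
      rw [← hj.exact]
      exact LinearMap.mem_range_self _ _
    refine ⟨(LinearEquiv.ofInjective (j (u <• g)) (hj.injective _)).symm.toLinearMap ∘ₗ
      (ρ.R g u ∘ₗ j u).codRestrict _ hr, fun v => ?_⟩
    exact congrArg Subtype.val
      ((LinearEquiv.ofInjective (j (u <• g)) (hj.injective _)).apply_symm_apply ⟨_, hr v⟩)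
  choose R hR using h
  -- The axioms of an action hold in `V.Total` and are reflected by the injective equivariant map
  -- `J`.
  let J : L.Total → V.Total := fun z => ⟨z.1, j z.1 z.2⟩
  have hJ : Function.Injective J := by
    rintro ⟨u, v⟩ ⟨u', v'⟩ h
    obtain rfl : u = u' := congrArg TotalSpace.proj h
    exact congrArg (TotalSpace.mk u) (hj.injective u (V.mk_inj h))
  have hJR : ∀ (g : G) (z : L.Total), J ⟨z.1 <• g, R g z.1 z.2⟩ = ρ.act g (J z) := fun g z =>
    congrArg (TotalSpace.mk (z.1 <• g)) (hR g z.1 z.2)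
  refine ⟨⟨R, fun z => hJ ((hJR 1 z).trans (ρ.act_one _)), fun g h z => hJ ?_, ?_⟩, hR⟩
  · exact (hJR (g * h) z).trans ((ρ.act_mul g h _).trans
      ((congrArg (ρ.act h) (hJR g z)).symm.trans (hJR h _).symm))
  · refine hj.contMDiff_of_comp ((ρ.contMDiff_act.comp
      ((hj.smooth.comp contMDiff_fst).prodMk contMDiff_snd)).congr fun z => ?_)
    exact hJR z.2 z.1

/-- The translate of a section. -/
theorem PBGAction.exists_translate {V : SmoothVectorBundle EP P F} (ρ : PBGAction EG G V)
    (hact : ∀ g : G, ContMDiff 𝓘(ℝ, EP) 𝓘(ℝ, EP) ∞ (fun u : P => u <• g)) (g : G)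
    (X : V.Sections) : ∃ X' : V.Sections, ∀ u, X' (u <• g) = ρ.R g u (X u) := by
  -- Stated in the total space, since `(u <• g⁻¹) <• g` equals `u` only propositionally.
  have h : ∀ u : P, ∃ v : V.Fib u, (⟨u, v⟩ : V.Total) = ρ.act g ⟨u <• g⁻¹, X (u <• g⁻¹)⟩ := by
    intro u
    have hu : (u <• g⁻¹) <• g = u := by simp
    generalize u <• g⁻¹ = u' at *
    subst hu
    exact ⟨_, rfl⟩
  choose X' hX' using h
  refine ⟨⟨X', ?_⟩, fun u => V.mk_inj ((hX' (u <• g)).trans ?_)⟩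
  · refine ((ρ.contMDiff_act.comp (contMDiff_id.prodMk (contMDiff_const (c := g)))).comp
      (X.contMDiff.comp (hact g⁻¹))).congr fun u => ?_
    exact hX' u
  · have hu : (u <• g) <• g⁻¹ = u := by simp
    exact congrArg (fun u => ρ.act g ⟨u, X u⟩) hu

/-- The kernel of the anchor of a PBG-algebroid is a PBG-Lie algebra bundle. -/
theorem IsPBGAlgebroid.isPBGLieAlgebraBundle [IsManifold 𝓘(ℝ, EP) ∞ P]
    [FiniteDimensional ℝ EP] [T2Space P] {A : LieAlgebroid EP P F}
    {ρ : PBGAction EG G A.toSmoothVectorBundle} (hA : IsPBGAlgebroid EG A ρ)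
    (hact : ∀ g : G, ContMDiff 𝓘(ℝ, EP) 𝓘(ℝ, EP) ∞ (fun u : P => u <• g))
    {L : LieAlgebraBundle EP P K} {j : ∀ u, L.Fib u →ₗ[ℝ] A.Fib u}
    (hj : IsKernelBundle A A.anchor L j) {ρL : PBGAction EG G L.toSmoothVectorBundle}
    (hρL : ∀ (g : G) u v, j (u <• g) (ρL.R g u v) = ρ.R g u (j u v)) :
    IsPBGLieAlgebraBundle EG L ρL := by
  intro g u v w
  -- Fibre brackets are computed with sections: the vectors are extended, the extensions translated
  -- by `g`, and the invariance of the bracket of `A` applied.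
  obtain ⟨e, he⟩ := exists_sectionExtension L.toSmoothVectorBundle u
  obtain ⟨Y, hY⟩ := ρL.exists_translate hact g (e v)
  obtain ⟨Z, hZ⟩ := ρL.exists_translate hact g (e w)
  apply hj.injective
  have h1 := hj.bracket Y Z (mapSections hj.smooth Y) (mapSections hj.smooth Z) (fun _ => rfl)
    (fun _ => rfl) (u <• g)
  have h2 := hj.bracket (e v) (e w) (mapSections hj.smooth (e v)) (mapSections hj.smooth (e w))
    (fun _ => rfl) (fun _ => rfl) u
  have h3 : ∀ {Y V : L.Sections}, (∀ u, Y (u <• g) = ρL.R g u (V u)) →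
      ∀ u, mapSections hj.smooth Y (u <• g) = ρ.R g u (mapSections hj.smooth V u) :=
    fun hY u => (congrArg (j _) (hY u)).trans (hρL g u _)
  have h4 := hA.bracket g (mapSections hj.smooth (e v)) (mapSections hj.smooth (e w)) _ _
    (h3 hY) (h3 hZ) u
  rw [h1, h2, ← hρL, hY, hZ, he, he] at h4
  exact h4

variable {p : P → M}

/-- A form of `equiv` for a point `x` only propositionally equal to `p u`, such as `p (s x) = x` for
a local section `s`. -/
theorem IsQuotientBundle.exists_equiv {V : SmoothVectorBundle EP P F} {ρ : PBGAction EG G V}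
    {W : SmoothVectorBundle EM M F} {nat : ∀ u : P, V.Fib u →ₗ[ℝ] W.Fib (p u)}
    (hQ : IsQuotientBundle EG p ρ W nat) (hp : IsPrincipalBundle EP EM EG (G := G) p) {u : P}
    {x : M} (h : p u = x) :
    ∃ N : V.Fib u ≃ₗ[ℝ] W.Fib x, ∀ v, (⟨p u, nat u v⟩ : W.Total) = ⟨x, N v⟩ := by
  subst h
  exact ⟨hQ.equiv hp u, fun v => rfl⟩

/-- The bracket induced on a quotient of a PBG-Lie algebra bundle. -/
theorem IsQuotientBundle.exists_lie {L : LieAlgebraBundle EP P F}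
    {ρ : PBGAction EG G L.toSmoothVectorBundle} {W : SmoothVectorBundle EM M F}
    {nat : ∀ u : P, L.Fib u →ₗ[ℝ] W.Fib (p u)} (hQ : IsQuotientBundle EG p ρ W nat)
    (hp : IsPrincipalBundle EP EM EG (G := G) p) (hL : IsPBGLieAlgebraBundle EG L ρ) (x : M) :
    ∃ b : W.Fib x →ₗ[ℝ] W.Fib x →ₗ[ℝ] W.Fib x, ∀ u v w a c,
      (⟨p u, nat u v⟩ : W.Total) = ⟨x, a⟩ → (⟨p u, nat u w⟩ : W.Total) = ⟨x, c⟩ →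
      (⟨p u, nat u (L.lie u v w)⟩ : W.Total) = ⟨x, b a c⟩ := by
  obtain ⟨u₀, rfl⟩ := hp.surjective x
  let e := hQ.equiv hp u₀
  refine ⟨((L.lie u₀).compl₁₂ e.symm.toLinearMap e.symm.toLinearMap).compr₂ (nat u₀),
    fun u v w a c ha hc => ?_⟩
  obtain ⟨v₀, rfl⟩ := hQ.surjective_nat hp u₀ a
  obtain ⟨w₀, rfl⟩ := hQ.surjective_nat hp u₀ c
  have h0 : nat u₀ (L.lie u₀ (e.symm (nat u₀ v₀)) (e.symm (nat u₀ w₀))) =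
      nat u₀ (L.lie u₀ v₀ w₀) :=
    congrArg₂ (fun v w => nat u₀ (L.lie u₀ v w)) (e.symm_apply_apply v₀) (e.symm_apply_apply w₀)
  refine Eq.trans ?_ (congrArg (TotalSpace.mk (p u₀)) h0.symm)
  clear h0
  obtain ⟨g, rfl⟩ := hp.exists_eq_smul (u := u) (u' := u₀) (congrArg TotalSpace.proj ha)
  have h1 : ∀ v v₀, (⟨p u, nat u v⟩ : W.Total) = ⟨p (u <• g), nat (u <• g) v₀⟩ →
      ρ.R g u v = v₀ := fun v v₀ h =>
    hQ.injective_nat hp _ (W.mk_inj ((hQ.mk_nat_act g ⟨u, v⟩).trans h))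
  rw [← h1 v v₀ ha, ← h1 w w₀ hc, hL]
  exact (hQ.mk_nat_act g ⟨u, L.lie u v w⟩).symm

variable [LieGroup 𝓘(ℝ, EG) ∞ G] [IsManifold 𝓘(ℝ, EP) ∞ P] [IsManifold 𝓘(ℝ, EM) ∞ M]
  [FiniteDimensional ℝ EP] [FiniteDimensional ℝ EM] [FiniteDimensional ℝ EG]
  [FiniteDimensional ℝ F]

/-- The quotient of a PBG-Lie algebra bundle. -/
theorem exists_quotientLieAlgebraBundle (hp : IsPrincipalBundle EP EM EG (G := G) p)
    {L : LieAlgebraBundle.{_, _, _, vV} EP P F} {ρ : PBGAction EG G L.toSmoothVectorBundle}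
    (hL : IsPBGLieAlgebraBundle EG L ρ) :
    ∃ (N : LieAlgebraBundle.{_, _, _, vV} EM M F) (nat : ∀ u : P, L.Fib u →ₗ[ℝ] N.Fib (p u)),
      IsQuotientLieAlgebraBundle EG p L ρ N nat ∧
      IsSmoothFibration EG (𝓘(ℝ, EP).prod 𝓘(ℝ, F)) (𝓘(ℝ, EM).prod 𝓘(ℝ, F)) G
        (fun z : L.Total => (⟨p z.1, nat z.1 z.2⟩ : N.Total)) := by
  classical
  obtain ⟨W, nat, hQ, hfib⟩ := exists_quotientBundle ρ hp
  choose b hb using hQ.exists_lie hp hL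
  have hb' : ∀ u v w, b (p u) (nat u v) (nat u w) = nat u (L.lie u v w) := fun u v w =>
    (W.mk_inj (hb (p u) u v w _ _ rfl rfl)).symm
  refine ⟨{ W with
    lie := b
    lie_self := fun x v => ?_
    lie_jacobi := fun x v w t => ?_
    locally_trivial := fun x₀ => ?_ }, nat, ⟨hQ, hb'⟩, hfib⟩
  · obtain ⟨u, rfl⟩ := hp.surjective x
    obtain ⟨v, rfl⟩ := hQ.surjective_nat hp u v
    rw [hb', L.lie_self, map_zero]
  · obtain ⟨u, rfl⟩ := hp.surjective x
    obtain ⟨v, rfl⟩ := hQ.surjective_nat hp u v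
    obtain ⟨w, rfl⟩ := hQ.surjective_nat hp u w
    obtain ⟨t, rfl⟩ := hQ.surjective_nat hp u t
    simp only [hb']
    rw [← map_add, ← map_add, L.lie_jacobi, map_zero]
  · obtain ⟨U₁, hU₁, hx₁, s, hs, hps⟩ := hp.exists_localSection x₀
    obtain ⟨U₂, hU₂, hx₂, Φ, hΦ, hΦl, hΦs⟩ := L.locally_trivial (s x₀)
    -- `N x` identifies the fibre of `L` over `s x` with that of the quotient over `x`; a
    -- trivialization of `L` around `s x₀` is carried over by conjugation.
    have h : ∀ x, ∃ N : L.Fib (s x) →ₗ[ℝ] W.Fib x, x ∈ U₁ → Function.Bijective N ∧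
        ∀ v, (⟨p (s x), nat (s x) v⟩ : W.Total) = ⟨x, N v⟩ := by
      intro x
      by_cases hx : x ∈ U₁
      · obtain ⟨N, hN⟩ := hQ.exists_equiv hp (hps x hx)
        exact ⟨N.toLinearMap, fun _ => ⟨N.bijective, hN⟩⟩
      · exact ⟨0, fun h => (hx h).elim⟩
    choose N hN using h
    have hNl : ∀ x ∈ U₁, ∀ v w, N x (L.lie (s x) v w) = b x (N x v) (N x w) := by
      intro x hx v w
      exact W.mk_inj (((hN x hx).2 _).symm.trans
        (hb x (s x) v w _ _ ((hN x hx).2 v) ((hN x hx).2 w)))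
    let e := LinearEquiv.ofBijective (N x₀) (hN x₀ hx₁).1
    have hel : ∀ v w, e.symm (b x₀ v w) = L.lie (s x₀) (e.symm v) (e.symm w) := by
      intro v w
      rw [LinearEquiv.symm_apply_eq]
      refine Eq.trans ?_ (hNl x₀ hx₁ _ _).symm
      exact congrArg₂ (fun v w => b x₀ v w) (e.apply_symm_apply v).symm
        (e.apply_symm_apply w).symm
    refine ⟨U₁ ∩ s ⁻¹' U₂, hs.continuousOn.isOpen_inter_preimage hU₁ hU₂, ⟨hx₁, hx₂⟩,
      fun x => N x ∘ₗ Φ (s x) ∘ₗ e.symm.toLinearMap, fun x hx => ?_, fun x hx v w => ?_,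
      fun v => ?_⟩
    · exact (hN x hx.1).1.comp ((hΦ _ hx.2).comp e.symm.bijective)
    · change N x (Φ (s x) (e.symm (b x₀ v w))) = _
      rw [hel, hΦl _ hx.2, hNl x hx.1]
      rfl
    · have h1 := hfib.contMDiff.comp_contMDiffOn ((hΦs (e.symm v)).comp
        (hs.mono inter_subset_left) fun x (hx : x ∈ U₁ ∩ s ⁻¹' U₂) => hx.2)
      exact h1.congr fun x hx => ((hN x hx.1).2 _).symm

end PBGLieAlgebraBundle

/-! ### The induced exact sequence -/

section AtiyahSequence

variable {EP : Type*} [NormedAddCommGroup EP] [NormedSpace ℝ EP] [FiniteDimensional ℝ EP]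
  {EM : Type*} [NormedAddCommGroup EM] [NormedSpace ℝ EM]
  {EG : Type*} [NormedAddCommGroup EG] [NormedSpace ℝ EG]
  {P : Type*} [TopologicalSpace P] [ChartedSpace EP P] [IsManifold 𝓘(ℝ, EP) ∞ P]
  {M : Type*} [TopologicalSpace M] [ChartedSpace EM M] [IsManifold 𝓘(ℝ, EM) ∞ M]
  {G : Type*} [TopologicalSpace G] [ChartedSpace EG G] [Group G] [MulAction Gᵐᵒᵖ P]
  [LieGroup 𝓘(ℝ, EG) ∞ G]
  {F : Type*} [NormedAddCommGroup F] [NormedSpace ℝ F]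
  {K : Type*} [NormedAddCommGroup K] [NormedSpace ℝ K]
  {p : P → M} {A : LieAlgebroid EP P F} {ρ : PBGAction EG G A.toSmoothVectorBundle}
  {B : LieAlgebroid EM M F} {natA : ∀ u : P, A.Fib u →ₗ[ℝ] B.Fib (p u)}

omit [FiniteDimensional ℝ EP] [LieGroup 𝓘(ℝ, EG) ∞ G] in
/-- The quotient of a transitive PBG-algebroid is transitive. -/
theorem IsQuotientLieAlgebroid.isTransitive (hB : IsQuotientLieAlgebroid EG p A ρ B natA)
    (hp : IsPrincipalBundle EP EM EG (G := G) p) (htrans : A.IsTransitive) : B.IsTransitive := by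
  intro x t
  obtain ⟨u, rfl⟩ := hp.surjective x
  obtain ⟨s, rfl⟩ := hp.surjective_mfderiv u t
  obtain ⟨v, rfl⟩ := htrans u s
  exact ⟨natA u v, hB.anchor u v⟩

/-- The anchor of a PBG-algebroid induces a morphism to the Atiyah algebroid. -/
theorem IsQuotientLieAlgebroid.exists_anchorMorphism
    (hB : IsQuotientLieAlgebroid EG p A ρ B natA) (hA : IsPBGAlgebroid EG A ρ)
    (hp : IsPrincipalBundle EP EM EG (G := G) p)
    (hfib : IsSmoothFibration EG (𝓘(ℝ, EP).prod 𝓘(ℝ, F)) (𝓘(ℝ, EM).prod 𝓘(ℝ, F)) G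
      (fun z : A.Total => (⟨p z.1, natA z.1 z.2⟩ : B.Total)))
    {At : LieAlgebroid EM M EP}
    {natT : ∀ u : P, (tangentLieAlgebroid EP P).Fib u →ₗ[ℝ] At.Fib (p u)}
    (hAt : IsQuotientLieAlgebroid EG p (tangentLieAlgebroid EP P) (tangentAction EG hp.smooth_act)
      At natT)
    (hfibT : ContMDiff 𝓘(ℝ, EP).tangent (𝓘(ℝ, EM).prod 𝓘(ℝ, EP)) ∞
      (fun z : TangentBundle 𝓘(ℝ, EP) P => (⟨p z.1, natT z.1 z.2⟩ : At.Total))) :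
    ∃ σ : ∀ x : M, B.Fib x →ₗ[ℝ] At.Fib x, IsLieAlgebroidMorphism B At σ ∧
      ∀ u v, σ (p u) (natA u v) = natT u (A.anchor u v) := by
  have : Nonempty G := ⟨1⟩
  obtain ⟨σ, hσ⟩ := hB.quotient.exists_descent hp EP (T := At.Fib)
    (fun u => natT u ∘ₗ A.anchor u) fun g u v => by
      refine Eq.trans ?_ (hAt.quotient.mk_nat_act g ⟨u, A.anchor u v⟩)
      exact congrArg (fun t => (⟨p (u <• g), natT (u <• g) t⟩ : At.Total)) (hA.anchor g u v)
  replace hσ : ∀ u v, σ (p u) (natA u v) = natT u (A.anchor u v) := hσ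
  refine ⟨σ, ⟨?_, fun x v => ?_, fun X Y X' Y' hX hY x => ?_⟩, hσ⟩
  · refine hfib.contMDiff_of_comp ((hfibT.comp A.smooth_anchor).congr fun z => ?_)
    exact congrArg (TotalSpace.mk (p z.1)) (hσ z.1 z.2)
  · obtain ⟨u, rfl⟩ := hp.surjective x
    obtain ⟨v, rfl⟩ := hB.quotient.surjective_nat hp u v
    exact (congrArg (At.anchor (p u)) (hσ u v)).trans
      ((hAt.anchor u (A.anchor u v)).trans (hB.anchor u v).symm)
  · obtain ⟨u, rfl⟩ := hp.surjective x
    let a : A.Sections →ₗ[ℝ] (tangentLieAlgebroid EP P).Sections :=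
      mapSections (W := tangentVectorBundle EP P) A.smooth_anchor
    -- The anchor of the pullback of `Z` is an equivariant vector field representing the image of
    -- `Z`, so the bracket of the images is computed on `P`.
    have h1 : ∀ {Z : B.Sections} {Z' : At.Sections}, (∀ x, Z' x = σ x (Z x)) →
        ∀ u, natT u (a (hB.quotient.pull hp hfib Z) u) = Z' (p u) := fun hZ u =>
      (hσ u _).symm.trans ((congrArg (σ (p u)) (hB.quotient.nat_pull hp hfib _ u)).trans
        (hZ (p u)).symm)
    have h2 := hAt.bracket _ _ X' Y' (h1 hX) (h1 hY) u
    have h3 := hB.bracket _ _ X Y (hB.quotient.nat_pull hp hfib X)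
      (hB.quotient.nat_pull hp hfib Y) u
    rw [← h2, ← h3, hσ]
    exact congrArg (natT u) (A.anchor_bracket _ _ u).symm

omit [FiniteDimensional ℝ EP] in
/-- The kernel of the anchor of a PBG-algebroid induces the kernel of the induced morphism of
quotients. -/
theorem IsQuotientLieAlgebroid.exists_kernelMorphism
    (hB : IsQuotientLieAlgebroid EG p A ρ B natA)
    (hp : IsPrincipalBundle EP EM EG (G := G) p)
    (hfib : IsSmoothFibration EG (𝓘(ℝ, EP).prod 𝓘(ℝ, F)) (𝓘(ℝ, EM).prod 𝓘(ℝ, F)) G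
      (fun z : A.Total => (⟨p z.1, natA z.1 z.2⟩ : B.Total)))
    {L : LieAlgebraBundle EP P K} {j : ∀ u, L.Fib u →ₗ[ℝ] A.Fib u}
    (hj : IsKernelBundle A A.anchor L j) {ρL : PBGAction EG G L.toSmoothVectorBundle}
    (hρL : ∀ (g : G) u v, j (u <• g) (ρL.R g u v) = ρ.R g u (j u v))
    {N : LieAlgebraBundle EM M K} {natL : ∀ u : P, L.Fib u →ₗ[ℝ] N.Fib (p u)}
    (hN : IsQuotientLieAlgebraBundle EG p L ρL N natL)
    (hfibL : IsSmoothFibration EG (𝓘(ℝ, EP).prod 𝓘(ℝ, K)) (𝓘(ℝ, EM).prod 𝓘(ℝ, K)) G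
      (fun z : L.Total => (⟨p z.1, natL z.1 z.2⟩ : N.Total)))
    {T' : M → Type*} [∀ x, AddCommGroup (T' x)] [∀ x, Module ℝ (T' x)]
    {σ : ∀ x : M, B.Fib x →ₗ[ℝ] T' x}
    (hσ : ∀ u v, σ (p u) (natA u v) = 0 ↔ A.anchor u v = 0) :
    ∃ ι : ∀ x : M, N.Fib x →ₗ[ℝ] B.Fib x, IsKernelBundle B σ N ι ∧
      ∀ u v, ι (p u) (natL u v) = natA u (j u v) := by
  have : Nonempty G := ⟨1⟩
  obtain ⟨ι, hι⟩ := hN.quotient.exists_descent hp F (T := B.Fib)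
    (fun u => natA u ∘ₗ j u) fun g u v => by
      refine Eq.trans ?_ (hB.quotient.mk_nat_act g ⟨u, j u v⟩)
      exact congrArg (fun t => (⟨p (u <• g), natA (u <• g) t⟩ : B.Total)) (hρL g u v)
  replace hι : ∀ u v, ι (p u) (natL u v) = natA u (j u v) := hι
  refine ⟨ι, ⟨?_, fun x v w h => ?_, fun x => ?_, fun x v => ?_, fun V W X Y hX hY x => ?_⟩, hι⟩
  · refine hfibL.contMDiff_of_comp ((hfib.contMDiff.comp hj.smooth).congr fun z => ?_)
    exact congrArg (TotalSpace.mk (p z.1)) (hι z.1 z.2)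
  · obtain ⟨u, rfl⟩ := hp.surjective x
    obtain ⟨v, rfl⟩ := hN.quotient.surjective_nat hp u v
    obtain ⟨w, rfl⟩ := hN.quotient.surjective_nat hp u w
    rw [hι, hι] at h
    rw [hj.injective u (hB.quotient.injective_nat hp u h)]
  · obtain ⟨u, rfl⟩ := hp.surjective x
    ext a
    obtain ⟨a, rfl⟩ := hB.quotient.surjective_nat hp u a
    rw [LinearMap.mem_ker, hσ, ← LinearMap.mem_ker, ← hj.exact]
    constructor
    · rintro ⟨v, hv⟩
      obtain ⟨v, rfl⟩ := hN.quotient.surjective_nat hp u v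
      rw [hι] at hv
      exact ⟨v, hB.quotient.injective_nat hp u hv⟩
    · rintro ⟨v, rfl⟩
      exact ⟨natL u v, hι u v⟩
  · obtain ⟨u, rfl⟩ := hp.surjective x
    obtain ⟨v, rfl⟩ := hN.quotient.surjective_nat hp u v
    rw [hι, hB.anchor, hj.anchor, map_zero]
  · obtain ⟨u, rfl⟩ := hp.surjective x
    -- Pulling back commutes with the inclusions, which reduces the bracket identity to the one for
    -- `j`.
    have h1 : ∀ {V : N.Sections} {X : B.Sections}, (∀ x, X x = ι x (V x)) → ∀ u,
        hB.quotient.pull hp hfib X u = j u (hN.quotient.pull hp hfibL V u) := by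
      intro V X hX u
      apply hB.quotient.injective_nat hp
      rw [hB.quotient.nat_pull hp hfib, hX, ← hι, hN.quotient.nat_pull hp hfibL]
    have h2 := hj.bracket _ _ _ _ (h1 hX) (h1 hY) u
    have h3 := hB.bracket _ _ X Y (hB.quotient.nat_pull hp hfib X)
      (hB.quotient.nat_pull hp hfib Y) u
    rw [← h3, h2, ← hι, ← hN.lie, hN.quotient.nat_pull hp hfibL, hN.quotient.nat_pull hp hfibL]

end AtiyahSequence

end PBG

end

/-! ### The theorem -/

theorem mainTheorem4
    {EP : Type uEP} [NormedAddCommGroup EP] [NormedSpace ℝ EP] [FiniteDimensional ℝ EP]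
    {EM : Type uEM} [NormedAddCommGroup EM] [NormedSpace ℝ EM] [FiniteDimensional ℝ EM]
    {EG : Type uEG} [NormedAddCommGroup EG] [NormedSpace ℝ EG] [FiniteDimensional ℝ EG]
    {F : Type uF} [NormedAddCommGroup F] [NormedSpace ℝ F] [FiniteDimensional ℝ F]
    {P : Type uP} [TopologicalSpace P] [ChartedSpace EP P] [IsManifold 𝓘(ℝ, EP) ∞ P]
    [T2Space P] [SecondCountableTopology P]
    {M : Type uM} [TopologicalSpace M] [ChartedSpace EM M] [IsManifold 𝓘(ℝ, EM) ∞ M]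
    [T2Space M] [SecondCountableTopology M]
    {G : Type uG} [TopologicalSpace G] [ChartedSpace EG G] [Group G] [LieGroup 𝓘(ℝ, EG) ∞ G]
    [T2Space G] [SecondCountableTopology G]
    [MulAction Gᵐᵒᵖ P] (p : P → M) (hp : IsPrincipalBundle EP EM EG (G := G) p)
    (A : LieAlgebroid.{uEP, uP, uF, uV} EP P F)
    (ρ : PBGAction EG G A.toSmoothVectorBundle)
    (hA : IsPBGAlgebroid EG A ρ) (htrans : A.IsTransitive) :
    ∃ _ : ChartedSpace (ModelProd EM F) ρ.OrbitSpace,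
      IsManifold (𝓘(ℝ, EM).prod 𝓘(ℝ, F)) ∞ ρ.OrbitSpace ∧
      T2Space ρ.OrbitSpace ∧ SecondCountableTopology ρ.OrbitSpace ∧
      IsSubmersion (𝓘(ℝ, EP).prod 𝓘(ℝ, F)) (𝓘(ℝ, EM).prod 𝓘(ℝ, F)) ∞ ρ.toOrbit ∧
      ∃ (B : LieAlgebroid.{uEM, uM, uF, uV} EM M F)
        (natA : ∀ u : P, A.Fib u →ₗ[ℝ] B.Fib (p u))
        (Ψ : Diffeomorph (𝓘(ℝ, EM).prod 𝓘(ℝ, F)) (𝓘(ℝ, EM).prod 𝓘(ℝ, F))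
          ρ.OrbitSpace B.Total ∞),
        (∀ z : A.Total, Ψ (ρ.toOrbit z) = ⟨p z.1, natA z.1 z.2⟩) ∧
        IsQuotientLieAlgebroid EG p A ρ B natA ∧ B.IsTransitive ∧
        ∃ (At : LieAlgebroid.{uEM, uM, uEP, uEP} EM M EP)
          (natT : ∀ u : P, (tangentLieAlgebroid EP P).Fib u →ₗ[ℝ] At.Fib (p u)),
          IsQuotientLieAlgebroid EG p (tangentLieAlgebroid EP P) (tangentAction EG hp.smooth_act)
            At natT ∧
          ∃ (k : ℕ) (L : LieAlgebraBundle.{uEP, uP, 0, uV} EP P (EuclideanSpace ℝ (Fin k)))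
            (j : ∀ u : P, L.Fib u →ₗ[ℝ] A.Fib u)
            (ρL : PBGAction EG G L.toSmoothVectorBundle)
            (K : LieAlgebraBundle.{uEM, uM, 0, uV} EM M (EuclideanSpace ℝ (Fin k)))
            (natL : ∀ u : P, L.Fib u →ₗ[ℝ] K.Fib (p u)),
            IsKernelBundle A A.anchor L j ∧
            IsPBGLieAlgebraBundle EG L ρL ∧
            (∀ (g : G) (u : P) (v : L.Fib u), j (u <• g) (ρL.R g u v) = ρ.R g u (j u v)) ∧
            IsQuotientLieAlgebraBundle EG p L ρL K natL ∧
            ∃ (ι : ∀ x : M, K.Fib x →ₗ[ℝ] B.Fib x) (σ : ∀ x : M, B.Fib x →ₗ[ℝ] At.Fib x),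
              IsKernelBundle B σ K ι ∧
              IsLieAlgebroidMorphism B At σ ∧ (∀ x, Function.Surjective (σ x)) ∧
              (∀ (u : P) (v : L.Fib u), ι (p u) (natL u v) = natA u (j u v)) ∧
              (∀ (u : P) (v : A.Fib u), σ (p u) (natA u v) = natT u (A.anchor u v)) := by
  obtain ⟨B, natA, hB, hfib⟩ := exists_quotientLieAlgebroid hp hA
  obtain ⟨At, natT, hAt, hfibT⟩ := exists_quotientLieAlgebroid hp
    (isPBGAlgebroid_tangentAction hp.smooth_act)
  obtain ⟨k, L, j, hj, hj'⟩ := LieAlgebroid.exists_kernelLieAlgebraBundle htrans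
  obtain ⟨ρL, hρL⟩ := hj'.exists_restrictedAction ρ fun g u v h =>
    (hA.anchor g u v).trans ((congrArg _ h).trans (map_zero _))
  have hL := hA.isPBGLieAlgebraBundle hp.contMDiff_act_right hj hρL
  obtain ⟨K, natL, hK, hfibL⟩ := exists_quotientLieAlgebraBundle hp hL
  obtain ⟨σ, hσm, hσ⟩ := hB.exists_anchorMorphism hA hp hfib hAt hfibT.contMDiff
  -- `natT` is injective on fibres, so the kernel of `σ` corresponds to the kernel of the anchor of
  -- `A`.
  have hker : ∀ u v, σ (p u) (natA u v) = 0 ↔ A.anchor u v = 0 := fun u v => by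
    rw [hσ]
    exact map_eq_zero_iff (natT u) (hAt.quotient.injective_nat hp u)
  obtain ⟨ι, hι, hιL⟩ := hB.exists_kernelMorphism hp hfib hj hρL hK hfibL hker
  obtain ⟨cs, hm, ht, hsc, hsub, Ψ, hΨ⟩ := hB.quotient.exists_orbitSpace_manifold hp hfib
  refine ⟨cs, hm, ht, hsc, hsub, B, natA, Ψ, hΨ, hB, hB.isTransitive hp htrans, At, natT, hAt, k,
    L, j, ρL, K, natL, hj, hL, hρL, hK, ι, σ, hι, hσm, fun x => ?_, hιL, hσ⟩
  obtain ⟨u, rfl⟩ := hp.surjective x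
  intro t
  obtain ⟨s, rfl⟩ := hAt.quotient.surjective_nat hp u t
  obtain ⟨v, hv⟩ := htrans u s
  exact ⟨natA u v, (hσ u v).trans (congrArg (natT u) hv)⟩
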